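/- **Proposition 4.** The base field is $\mathbb Q$. Let $S$ be a set, let $\mathbb L(S)$ be the free Lie algebra on $S$ (concentrated in degree $0$), and for $r\ge 1$ let $\mathbb L(r)\subset \mathbb L(S)$ be the linear span of the iterated Lie brackets of length $r$ in elements of $S$. Let $I\subset\mathbb L(S)$ be an ideal generated by elements each of which lies in some $\mathbb L(r)$, and let $L=\mathbb L(S)/I$, which is then a weighted Lie algebra $L=\bigoplus_{r\ge 1}L(r)$ with $L(r)$ the image of $\mathbb L(r)$. Let $C_*(L)=(\Lambda L,\partial)$ be the Cartan–Chevalley–Eilenberg complex, $\partial(x_1\wedge\dots\wedge x_p)=\sum_{i<j}(-1)^{i+j}[x_i,x_j]\wedge x_1\wedge\dots\widehat{x_i}\dots\widehat{x_j}\dots\wedge x_p$, and suppose that $\dim_{\mathbb Q} H(C_*(L))<\infty$. For a $\mathbb Q$-algebra $R$ with augmentation $\varepsilon:R\to\mathbb Q$ and augmentation ideal $J=\ker\varepsilon$, let $\widehat R=\varprojlim_n R/J^n$, which is augmented by $\widehat R\to R/J\to\mathbb Q$, and let $\operatorname{depth}R$ be the least $p\ge 0$ (or $\infty$ if there is none)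 such that $\operatorname{Ext}^p_R(\mathbb Q,R)\ne 0$. Let $UL$ be the universal enveloping algebra of $L$ with its augmentation that vanishes on $L$, and let $\operatorname{depth}L$ be the least $p\ge 0$ (or $\infty$ if there is none) such that $\operatorname{Ext}^p_{UL}(\mathbb Q,\widehat{UL})\neq 0$. Then $$\operatorname{depth}UL=\operatorname{depth}L=\operatorname{depth}\widehat{UL}.$$ -/

import Mathlib

universe u

namespace LieDepth

open CategoryTheory

noncomputable section

/-! ### The Cartan–Chevalley–Eilenberg complex `C_*(L) = (Λ L, ∂)` of a Lie algebra over `ℚ` -/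

section ChevalleyEilenberg

variable {L : Type u} [LieRing L] [LieAlgebra ℚ L]

/-- `x ∧ w` for `x : L` and `w` in the exterior algebra of `L`. -/
abbrev wedge (x : L) (w : ExteriorAlgebra ℚ L) : ExteriorAlgebra ℚ L :=
  ExteriorAlgebra.ι ℚ x * w

theorem wedge_self (x : L) (w : ExteriorAlgebra ℚ L) : wedge x (wedge x w) = 0 := by
  simp [wedge, ← mul_assoc]

theorem wedge_swap (x y : L) (w : ExteriorAlgebra ℚ L) :
    wedge x (wedge y w) + wedge y (wedge x w) = 0 := by
  have h := ExteriorAlgebra.ι_add_mul_swap (R := ℚ) x y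
  simp only [wedge, ← mul_assoc, ← add_mul, h, zero_mul]

theorem exterior_induction {P : ExteriorAlgebra ℚ L → Prop}
    (algebraMap : ∀ r : ℚ, P (algebraMap ℚ _ r)) (add : ∀ v w, P v → P w → P (v + w))
    (wedge : ∀ x w, P w → P (wedge x w)) (w : ExteriorAlgebra ℚ L) : P w :=
  CliffordAlgebra.left_induction (Q := (0 : QuadraticForm ℚ L)) (P := P) algebraMap add
    (fun w x hw => wedge x w hw) w

/-- The adjoint action `θ_x` of `x : L` on the exterior algebra of `L`: the derivation that extends
`y ↦ ⁅x, y⁆`, i.e. `θ_x 1 = 0` and `θ_x (y ∧ w) = ⁅x, y⁆ ∧ w + y ∧ θ_x w`. -/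
def adAction (x : L) : ExteriorAlgebra ℚ L →ₗ[ℚ] ExteriorAlgebra ℚ L :=
  CliffordAlgebra.foldr' (0 : QuadraticForm ℚ L)
    (LinearMap.mk₂ ℚ
      (fun (y : L) (p : ExteriorAlgebra ℚ L × ExteriorAlgebra ℚ L) =>
        wedge ⁅x, y⁆ p.1 + wedge y p.2)
      (by intros; simp only [wedge, lie_add, map_add, add_mul]; abel)
      (by intros; simp only [wedge, lie_smul, map_smul, smul_mul_assoc, smul_add])
      (by intros; simp only [wedge, Prod.fst_add, Prod.snd_add, mul_add]; abel)
      (by intros; simp only [wedge, Prod.smul_fst, Prod.smul_snd, mul_smul_comm, smul_add]))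
    (by
      intro y w w'
      change wedge ⁅x, y⁆ (wedge y w) + wedge y (wedge ⁅x, y⁆ w + wedge y w') = (0 : ℚ) • w'
      have h1 := wedge_swap ⁅x, y⁆ y w
      have h2 := wedge_self y w'
      simp only [wedge] at h1 h2 ⊢
      rw [mul_add, ← add_assoc, h1, h2, zero_smul, zero_add])
    0

theorem adAction_algebraMap (x : L) (r : ℚ) : adAction x (algebraMap ℚ _ r) = 0 := by
  refine (CliffordAlgebra.foldr'_algebraMap _ _ _ _ r).trans ?_
  simp

theorem adAction_wedge (x y : L) (w : ExteriorAlgebra ℚ L) :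
    adAction x (wedge y w) = wedge ⁅x, y⁆ w + wedge y (adAction x w) :=
  CliffordAlgebra.foldr'_ι_mul _ _ _ _ y w

theorem adAction_add (x y : L) (w : ExteriorAlgebra ℚ L) :
    adAction (x + y) w = adAction x w + adAction y w := by
  induction w using exterior_induction with
  | algebraMap r => simp [adAction_algebraMap]
  | add v w hv hw => simp only [map_add, hv, hw]; abel
  | wedge z w hw =>
    simp only [adAction_wedge, hw, add_lie]
    simp only [wedge, map_add, add_mul, mul_add]; abel

theorem adAction_smul (c : ℚ) (x : L) (w : ExteriorAlgebra ℚ L) :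
    adAction (c • x) w = c • adAction x w := by
  induction w using exterior_induction with
  | algebraMap r => simp [adAction_algebraMap]
  | add v w hv hw => simp only [map_add, hv, hw, smul_add]
  | wedge z w hw =>
    simp only [adAction_wedge, hw, smul_lie]
    simp only [wedge, map_smul, smul_mul_assoc, mul_smul_comm, smul_add]

/-- The Cartan–Chevalley–Eilenberg differential `∂` on the exterior algebra of `L`, given by
`∂ 1 = 0` and `∂ (x ∧ w) = - θ_x w - x ∧ ∂ w`; equivalently
`∂ (x₁ ∧ ⋯ ∧ xₚ) = ∑_{i < j} (-1)^(i+j) ⁅xᵢ, xⱼ⁆ ∧ x₁ ∧ ⋯ x̂ᵢ ⋯ x̂ⱼ ⋯ ∧ xₚ`. -/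
def ceDifferential (L : Type u) [LieRing L] [LieAlgebra ℚ L] :
    ExteriorAlgebra ℚ L →ₗ[ℚ] ExteriorAlgebra ℚ L :=
  CliffordAlgebra.foldr' (0 : QuadraticForm ℚ L)
    (LinearMap.mk₂ ℚ
      (fun (x : L) (p : ExteriorAlgebra ℚ L × ExteriorAlgebra ℚ L) =>
        - adAction x p.1 - wedge x p.2)
      (by intros; simp only [wedge, adAction_add, map_add, add_mul]; abel)
      (by intros; simp only [wedge, adAction_smul, map_smul, smul_mul_assoc, smul_sub, smul_neg])
      (by intros; simp only [wedge, Prod.fst_add, Prod.snd_add, map_add, mul_add]; abel)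
      (by intros; simp only [wedge, Prod.smul_fst, Prod.smul_snd, map_smul, mul_smul_comm,
            smul_sub, smul_neg]))
    (by
      intro x w w'
      change - adAction x (wedge x w) - wedge x (- adAction x w - wedge x w') = (0 : ℚ) • w'
      have h := wedge_self x w'
      rw [adAction_wedge, lie_self]
      simp only [wedge] at h ⊢
      rw [mul_sub, h, map_zero, zero_mul, zero_smul, mul_neg]
      abel)
    0

theorem ceDifferential_algebraMap (r : ℚ) :
    ceDifferential L (algebraMap ℚ _ r) = 0 := by
  refine (CliffordAlgebra.foldr'_algebraMap _ _ _ _ r).trans ?_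
  simp

theorem ceDifferential_wedge (x : L) (w : ExteriorAlgebra ℚ L) :
    ceDifferential L (wedge x w) = - adAction x w - wedge x (ceDifferential L w) :=
  CliffordAlgebra.foldr'_ι_mul _ _ _ _ x w

theorem adAction_lie (x y : L) (w : ExteriorAlgebra ℚ L) :
    adAction ⁅x, y⁆ w = adAction x (adAction y w) - adAction y (adAction x w) := by
  induction w using exterior_induction with
  | algebraMap r => simp [adAction_algebraMap]
  | add v w hv hw => simp only [map_add, hv, hw]; abel
  | wedge z w hw =>
    simp only [adAction_wedge, map_add, hw, lie_lie]
    simp only [wedge, map_sub, sub_mul, mul_sub]; abel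

theorem ceDifferential_adAction (x : L) (w : ExteriorAlgebra ℚ L) :
    ceDifferential L (adAction x w) = adAction x (ceDifferential L w) := by
  induction w using exterior_induction with
  | algebraMap r => simp [adAction_algebraMap, ceDifferential_algebraMap]
  | add v w hv hw => simp only [map_add, hv, hw]
  | wedge z w hw =>
    simp only [adAction_wedge, ceDifferential_wedge, map_add, map_sub, map_neg, hw, adAction_lie]
    abel

theorem ceDifferential_comp_self (w : ExteriorAlgebra ℚ L) :
    ceDifferential L (ceDifferential L w) = 0 := by
  induction w using exterior_induction with
  | algebraMap r => simp [ceDifferential_algebraMap]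
  | add v w hv hw => simp only [map_add, hv, hw, add_zero]
  | wedge z w hw =>
    simp only [ceDifferential_wedge, map_sub, map_neg, hw, ceDifferential_adAction]
    simp [wedge]

/-- The (total) homology `H(C_*(L)) = ker ∂ / im ∂`. -/
abbrev CEHomology (L : Type u) [LieRing L] [LieAlgebra ℚ L] : Type u :=
  LinearMap.ker (ceDifferential L) ⧸
    (LinearMap.range (ceDifferential L)).submoduleOf (LinearMap.ker (ceDifferential L))

end ChevalleyEilenberg

/-! ### Augmented algebras, their completions and their depth -/

section Augmented

variable {R : Type u} [Ring R] [Algebra ℚ R]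

/-- `ℚ` as a (left) module over `R` through the augmentation `ε : R → ℚ`. -/
def trivialModule (ε : R →ₐ[ℚ] ℚ) : ModuleCat.{u} R :=
  (ModuleCat.restrictScalars ε.toRingHom).obj (ModuleCat.of ℚ (ULift.{u} ℚ))

/-- The least `p` (or `∞`) such that `Ext_R^p(ℚ, M) ≠ 0`. -/
def leastExt (ε : R →ₐ[ℚ] ℚ) (M : ModuleCat.{u} R) : ℕ∞ :=
  ⨅ (p : ℕ) (_ : Nontrivial (Abelian.Ext.{u} (trivialModule ε) M p)), (p : ℕ∞)

/-- The depth of an augmented algebra `R`: the least `p` (or `∞`) such that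
`Ext_R^p(ℚ, R) ≠ 0`. -/
def depth (ε : R →ₐ[ℚ] ℚ) : ℕ∞ :=
  leastExt ε (ModuleCat.of R R)

/-- The augmentation ideal. -/
abbrev augIdeal (ε : R →ₐ[ℚ] ℚ) : Ideal R :=
  RingHom.ker ε

/-- The completion `lim_n R / Iⁿ` of an augmented algebra, `I` being the augmentation ideal:
the algebra of compatible families in `∏ n, R / Iⁿ`. -/
def completion (ε : R →ₐ[ℚ] ℚ) : Subalgebra ℚ (∀ n : ℕ, R ⧸ augIdeal ε ^ n) where
  carrier := {x | ∀ (m n : ℕ) (h : m ≤ n),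
    Ideal.Quotient.factor (Ideal.pow_le_pow_right h) (x n) = x m}
  mul_mem' := by
    intro x y hx hy m n h
    simp only [Pi.mul_apply, map_mul, hx m n h, hy m n h]
  add_mem' := by
    intro x y hx hy m n h
    simp only [Pi.add_apply, map_add, hx m n h, hy m n h]
  algebraMap_mem' := by
    intro r m n h
    rfl

/-- The canonical map from `R` to its completion. -/
def toCompletion (ε : R →ₐ[ℚ] ℚ) : R →ₐ[ℚ] completion ε :=
  AlgHom.codRestrict (AlgHom.pi fun n => Ideal.Quotient.mkₐ ℚ (augIdeal ε ^ n))
    (completion ε) (fun _ _ _ _ => rfl)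

/-- The augmentation of the completion: the projection to `R / I` followed by the map `R / I → ℚ`
that `ε` induces. -/
def completionAug (ε : R →ₐ[ℚ] ℚ) : completion ε →ₐ[ℚ] ℚ :=
  ((Ideal.Quotient.liftₐ (augIdeal ε ^ 1) ε
      (fun a ha => by rwa [Submodule.pow_one, RingHom.mem_ker] at ha)).comp
    (Pi.evalAlgHom ℚ (fun n : ℕ => R ⧸ augIdeal ε ^ n) 1)).comp (completion ε).val

theorem completionAug_toCompletion (ε : R →ₐ[ℚ] ℚ) (r : R) :
    completionAug ε (toCompletion ε r) = ε r := rfl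

end Augmented

/-! ### The depth of a Lie algebra -/

section Lie

attribute [local instance] LieRing.ofAssociativeRing

/-- The augmentation `U L → ℚ` of the enveloping algebra, which vanishes on `L`. -/
def envAug (L : Type u) [LieRing L] [LieAlgebra ℚ L] : UniversalEnvelopingAlgebra ℚ L →ₐ[ℚ] ℚ :=
  UniversalEnvelopingAlgebra.lift ℚ (0 : L →ₗ⁅ℚ⁆ ℚ)

end Lie

/-- The depth of a Lie algebra `L`: the least `p` (or `∞`) such that
`Ext_{UL}^p(ℚ, (UL)^) ≠ 0`, where `(UL)^` is the completion of `U L`. -/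
def lieDepth (L : Type u) [LieRing L] [LieAlgebra ℚ L] : ℕ∞ :=
  leastExt (envAug L) ((ModuleCat.restrictScalars (toCompletion (envAug L)).toRingHom).obj
    (ModuleCat.of (completion (envAug L)) (completion (envAug L))))

/-! ### Presentations by homogeneous relations -/

/-- `IsBracket r a`: `a` is an iterated Lie bracket, with any bracketing, of `r` elements of `S` in
the free Lie algebra on `S`. -/
inductive IsBracket {S : Type u} : ℕ → FreeLieAlgebra ℚ S → Prop
  | of (s : S) : IsBracket 1 (FreeLieAlgebra.of ℚ s)
  | lie {p q : ℕ} {a b : FreeLieAlgebra ℚ S} :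
      IsBracket p a → IsBracket q b → IsBracket (p + q) ⁅a, b⁆

/-- The linear span `𝕃(r)` of the iterated Lie brackets of length `r` in `S`. -/
def bracketSpan (S : Type u) (r : ℕ) : Submodule ℚ (FreeLieAlgebra ℚ S) :=
  Submodule.span ℚ {a | IsBracket r a}

/-- The Lie algebra `𝕃(S) / I`, where `I` is the ideal generated by `T`. -/
abbrev PresentedLie (S : Type u) (T : Set (FreeLieAlgebra ℚ S)) : Type u :=
  FreeLieAlgebra ℚ S ⧸
    (LieSubmodule.lieSpan ℚ (FreeLieAlgebra ℚ S) T : LieIdeal ℚ (FreeLieAlgebra ℚ S))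

end

end LieDepth

/-! The weights of `L` induce a grading of `UL`. Since `L` is generated in weight one, `UL` in
degree `n` is spanned by words of length `n` in `W 1`, and the `n`-th power of the augmentation
ideal consists of the elements without components below degree `n` (`isConnectedGrading`). The
completion is therefore the product of the homogeneous pieces of `UL`.

Suppose `ℚ` has a resolution over `UL` by free modules of finite rank whose generators have bounded
weights and whose matrices are homogeneous. All three depths are then read off from these matrices.
A homogeneous matrix acts degree by degree, and exactness of homogeneous maps passes between a
graded group and its completion: solutions over the completion are assembled from components, and
solutions over the graded group are cut out of them (`GradedPair.exact_iff`). Applied to rows, this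
shows that the same matrices resolve `ℚ` over the completion. Applied to columns, it shows that the
cochain complexes with coefficients in `UL` and in its completion are exact in the same places. The
second application needs the bound on the weights, because dualizing reverses them. This is
`depth_eq_of_resolution`.

The resolution is a truncation of the Koszul complex `UL ⊗ ΛL`. That complex is acyclic in positive
total weight: a homotopy `koszulS` built from the Euler derivation has Laplacian `DS + SD` equal to
multiplication by the total weight (`koszulH_of_mem`), so no Poincaré–Birkhoff–Witt basis is needed.
Finite dimensional homology makes `C_*(L)` exact in all high weights (`exists_weight_bound`).
Filtered by the weight of the exterior factor, the Koszul differential has leading term `1 ⊗ ∂`. A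
splitting of `∂` in a high weight therefore removes the top part of a chain whose boundary has low
weight (`exists_lower_weight`), and the subcomplex on exterior weights below the bound is still a
resolution. Its ranks are finite because `W 1` embeds in the homology and generates `L`. -/

namespace LieDepth
open CategoryTheory

/-! ### Ext groups from a projective resolution -/

section ExtOfResolution

variable {R : Type u} [Ring R] {P : ℕ → Type u} [∀ n, AddCommGroup (P n)] [∀ n, Module R (P n)]
  {Q : Type u} [AddCommGroup Q] [Module R Q]

/-- The chain complex of modules attached to a sequence of composable linear maps. -/
noncomputable abbrev chainComplexOf (d : ∀ n, P (n + 1) →ₗ[R] P n)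
    (hd : ∀ n, Function.Exact (d (n + 1)) (d n)) : ChainComplex (ModuleCat.{u} R) ℕ :=
  ChainComplex.of (fun n => ModuleCat.of R (P n)) (fun n => ModuleCat.ofHom (d n))
    (fun n => by
      ext x
      exact (hd n).apply_apply_eq_zero x)

theorem chainComplexOf_d (d : ∀ n, P (n + 1) →ₗ[R] P n)
    (hd : ∀ n, Function.Exact (d (n + 1)) (d n)) (n : ℕ) :
    (chainComplexOf d hd).d (n + 1) n = ModuleCat.ofHom (d n) :=
  ChainComplex.of_d (fun n => ModuleCat.of R (P n)) (fun n => ModuleCat.ofHom (d n)) n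

/-- The projective resolution attached to a sequence of projective modules that is exact
everywhere. -/
noncomputable def projectiveResolution [∀ n, Module.Projective R (P n)] (d : ∀ n, P (n + 1) →ₗ[R] P n) (η : P 0 →ₗ[R] Q)
    (hη : Function.Surjective η) (h₀ : Function.Exact (d 0) η)
    (hd : ∀ n, Function.Exact (d (n + 1)) (d n)) :
    ProjectiveResolution (ModuleCat.of R Q) where
  complex := chainComplexOf d hd
  projective n := ModuleCat.projective_of_categoryTheory_projective (ModuleCat.of R (P n))
  π := (ChainComplex.toSingle₀Equiv _ _).symm ⟨ModuleCat.ofHom η, by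
    rw [chainComplexOf_d]
    ext x
    exact h₀.apply_apply_eq_zero x⟩
  quasiIso := ⟨fun n => by
    cases n with
    | zero =>
      rw [ChainComplex.quasiIsoAt₀_iff, ShortComplex.quasiIso_iff_of_zeros']
      · have e : ShortComplex.mk (ModuleCat.ofHom (d 0)) (ModuleCat.ofHom η) (by
            ext x
            exact h₀.apply_apply_eq_zero x) ≅ ShortComplex.mk ((chainComplexOf d hd).d 1 0)
            (ModuleCat.ofHom η) (by 
              rw [chainComplexOf_d]
              ext x
              exact h₀.apply_apply_eq_zero x) :=
          ShortComplex.isoMk (Iso.refl _) (Iso.refl _) (Iso.refl _)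
            (by simpa using! (chainComplexOf_d d hd 0).symm) (by simp)
        refine (ShortComplex.exact_and_epi_g_iff_of_iso (S₂ := ShortComplex.mk ((chainComplexOf d hd).d 1 0) (ModuleCat.ofHom η) _) e).1 ⟨?_, ?_⟩
        · rw [ShortComplex.moduleCat_exact_iff]
          intro x hx
          exact (h₀ x).1 hx
        · exact (ModuleCat.epi_iff_surjective _).2 hη
      all_goals rfl
    | succ n =>
      rw [quasiIsoAt_iff_exactAt']
      · rw [HomologicalComplex.exactAt_iff' _ (n + 1 + 1) (n + 1) n (by simp) (by simp)]
        rw [ShortComplex.moduleCat_exact_iff]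
        intro x hx
        obtain ⟨y, hy⟩ := (hd n x).1
          ((ConcreteCategory.congr_hom (chainComplexOf_d d hd n) x).symm.trans hx)
        exact ⟨y, (ConcreteCategory.congr_hom (chainComplexOf_d d hd (n + 1)) y).trans hy⟩
      · apply ChainComplex.exactAt_succ_single_obj⟩


/-- `Q` is the cokernel of `d`, so maps out of `Q` are the maps out of `P 0` that vanish on the
image of `d`. -/
theorem nontrivial_ext_zero_iff (d : P 1 →ₗ[R] P 0) (η : P 0 →ₗ[R] Q)
    (hη : Function.Surjective η) (h₀ : Function.Exact d η) (M : ModuleCat.{u} R) :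
    Nontrivial (Abelian.Ext.{u} (ModuleCat.of R Q) M 0) ↔
      ∃ f : P 0 →ₗ[R] M, f ∘ₗ d = 0 ∧ f ≠ 0 := by
  rw [Abelian.Ext.homEquiv₀.nontrivial_congr, ModuleCat.homEquiv.nontrivial_congr]
  constructor
  · intro h
    obtain ⟨f, hf⟩ := exists_ne (0 : Q →ₗ[R] M)
    refine ⟨f ∘ₗ η, ?_, fun h => hf ?_⟩
    · rw [LinearMap.comp_assoc, h₀.linearMap_comp_eq_zero, LinearMap.comp_zero]
    · ext x
      obtain ⟨y, rfl⟩ := hη x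
      exact LinearMap.congr_fun h y
  · rintro ⟨f, hf, hne⟩
    have hker : LinearMap.ker η ≤ LinearMap.ker f := by
      intro x hx
      obtain ⟨y, rfl⟩ := (h₀ x).1 hx
      exact LinearMap.congr_fun hf y
    let g : Q →ₗ[R] M := (LinearMap.ker η).liftQ f hker ∘ₗ
      (η.quotKerEquivOfSurjective hη).symm.toLinearMap
    refine ⟨⟨g, 0, fun hg => hne ?_⟩⟩
    ext x
    have := LinearMap.congr_fun hg (η x)
    have h2 : (η.quotKerEquivOfSurjective hη).symm (η x) = Submodule.Quotient.mk x := by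
      rw [LinearEquiv.symm_apply_eq]
      rfl
    simpa [g, h2] using this

/-- Classes in positive degree are cocycles on the resolution modulo the maps that factor through
the preceding differential. -/
theorem nontrivial_ext_succ_iff [∀ n, Module.Projective R (P n)] (d : ∀ n, P (n + 1) →ₗ[R] P n)
    (η : P 0 →ₗ[R] Q) (hη : Function.Surjective η) (h₀ : Function.Exact (d 0) η)
    (hd : ∀ n, Function.Exact (d (n + 1)) (d n)) (M : ModuleCat.{u} R) (n : ℕ) :
    Nontrivial (Abelian.Ext.{u} (ModuleCat.of R Q) M (n + 1)) ↔
      ∃ f : P (n + 1) →ₗ[R] M, f ∘ₗ d (n + 1) = 0 ∧ ∀ g : P n →ₗ[R] M, g ∘ₗ d n ≠ f := by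
  let res := projectiveResolution d η hη h₀ hd
  have hdd : ∀ n, res.complex.d (n + 1) n = ModuleCat.ofHom (d n) := chainComplexOf_d d hd
  constructor
  · intro h
    obtain ⟨α, hα⟩ := exists_ne (0 : Abelian.Ext.{u} (ModuleCat.of R Q) M (n + 1))
    obtain ⟨f, hf, rfl⟩ := res.extMk_surjective α (n + 2) rfl
    rw [Ne, res.extMk_eq_zero_iff _ _ _ _ n rfl] at hα
    rw [hdd] at hf
    refine ⟨ModuleCat.Hom.hom f, ?_, fun g hg => hα ⟨ModuleCat.ofHom g, ?_⟩⟩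
    · exact congrArg ModuleCat.Hom.hom hf
    · rw [hdd]
      exact ModuleCat.hom_ext hg
  · rintro ⟨f, hf, hne⟩
    have hf' : res.complex.d (n + 2) (n + 1) ≫ ModuleCat.ofHom f = 0 := by
      rw [hdd]
      exact ModuleCat.hom_ext hf
    refine ⟨⟨res.extMk (ModuleCat.ofHom f) (n + 2) rfl hf', 0, fun h => ?_⟩⟩
    obtain ⟨g, hg⟩ := (res.extMk_eq_zero_iff _ _ _ hf' n rfl).1 h
    rw [hdd] at hg
    exact hne (ModuleCat.Hom.hom g) (congrArg ModuleCat.Hom.hom hg)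

end ExtOfResolution

/-! ### Ext groups from the matrices of a free resolution -/

section MatrixExt

/-- Exactness of `M ^ ι' → M ^ ι → M ^ ι''` in the middle, the maps being the left multiplications
by the matrices `D'` and `D`. -/
def CochainExact {R : Type*} [Ring R] {ι ι' ι'' : Type*} [Fintype ι] [Fintype ι']
    (D' : ι → ι' → R) (D : ι'' → ι → R) (M : Type*) [AddCommGroup M] [Module R M] : Prop :=
  ∀ m : ι → M, (∀ i, ∑ j, D i j • m j = 0) → ∃ n : ι' → M, ∀ i, ∑ j, D' i j • n j = m i

variable {R : Type u} [Ring R] {ι : ℕ → Type} [∀ n, Fintype (ι n)]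
  (D : ∀ n, ι (n + 1) → ι n → R)

/-- Elements of free left modules are row vectors, and differentials multiply them by matrices from
the right. Under `Hom (κ → R, M) = (κ → M)`, precomposition becomes multiplication of columns by the
same matrix from the left, which is the form that `CochainExact` uses. -/
theorem linearCombination_comp_linearCombination {R M κ κ' : Type*} [Ring R] [AddCommGroup M]
    [Module R M] [Fintype κ] [Fintype κ'] (D : κ → κ' → R) (m : κ' → M) :
    Fintype.linearCombination R m ∘ₗ Fintype.linearCombination R D =
      Fintype.linearCombination R (fun i => ∑ j, D i j • m j) := by
  classical
  ext i
  simp [Fintype.linearCombination_apply]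

theorem linearCombination_surjective {R M κ : Type*} [Ring R] [AddCommGroup M]
    [Module R M] [Fintype κ] (f : (κ → R) →ₗ[R] M) :
    ∃ m : κ → M, Fintype.linearCombination R m = f := by
  classical
  refine ⟨fun i => f (Pi.single i 1), ?_⟩
  ext i
  simp [Fintype.linearCombination_apply]

theorem linearCombination_injective {R M κ : Type*} [Ring R] [AddCommGroup M]
    [Module R M] [Fintype κ] {m m' : κ → M}
    (h : Fintype.linearCombination R m = Fintype.linearCombination R m') : m = m' := by
  classical
  ext i
  simpa [Fintype.linearCombination_apply] using LinearMap.congr_fun h (Pi.single i 1)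

theorem linearCombination_zero {R M κ : Type*} [Ring R] [AddCommGroup M]
    [Module R M] [Fintype κ] : Fintype.linearCombination R (0 : κ → M) = 0 := by
  ext
  simp [Fintype.linearCombination_apply]

/-- The least degree of a nonzero Ext group is determined by the matrices of a resolution by free
modules of finite rank. -/
theorem nontrivial_ext_iff {Q : Type u} [AddCommGroup Q] [Module R Q] (c : ι 0 → Q)
    (hc : Function.Surjective (Fintype.linearCombination R c))
    (h₀ : Function.Exact (Fintype.linearCombination R (D 0)) (Fintype.linearCombination R c))
    (hD : ∀ n, Function.Exact (Fintype.linearCombination R (D (n + 1)))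
      (Fintype.linearCombination R (D n)))
    (M : ModuleCat.{u} R) (p : ℕ) :
    Nontrivial (Abelian.Ext.{u} (ModuleCat.of R Q) M p) ↔
      match p with
      | 0 => ¬ CochainExact (fun (_ : ι 0) (j : Empty) => j.elim) (D 0) M
      | n + 1 => ¬ CochainExact (D n) (D (n + 1)) M := by
  cases p with
  | zero =>
    rw [nontrivial_ext_zero_iff (P := fun n => ι n → R) _ _ hc h₀]
    simp only [CochainExact, not_forall]
    constructor
    · rintro ⟨f, hf, hne⟩
      obtain ⟨m, rfl⟩ := linearCombination_surjective f
      rw [linearCombination_comp_linearCombination] at hf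
      refine ⟨m, fun i => congrFun (linearCombination_injective
        (hf.trans linearCombination_zero.symm)) i, fun ⟨n, hn⟩ => hne ?_⟩
      obtain rfl : m = 0 := funext fun i => by simpa using (hn i).symm
      exact linearCombination_zero
    · rintro ⟨m, hm, hne⟩
      refine ⟨Fintype.linearCombination R m, ?_, fun h => hne ⟨fun j => j.elim, fun i => ?_⟩⟩
      · rw [linearCombination_comp_linearCombination, ← linearCombination_zero]
        exact congrArg _ (funext hm)
      · rw [linearCombination_injective (h.trans linearCombination_zero.symm)]
        simp
  | succ n =>
    rw [nontrivial_ext_succ_iff (P := fun n => ι n → R) _ _ hc h₀ hD]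
    simp only [CochainExact, not_forall]
    constructor
    · rintro ⟨f, hf, hne⟩
      obtain ⟨m, rfl⟩ := linearCombination_surjective f
      rw [linearCombination_comp_linearCombination] at hf
      refine ⟨m, fun i => congrFun (linearCombination_injective
        (hf.trans linearCombination_zero.symm)) i, fun ⟨g, hg⟩ =>
          hne (Fintype.linearCombination R g) ?_⟩
      rw [linearCombination_comp_linearCombination]
      exact congrArg _ (funext hg)
    · rintro ⟨m, hm, hne⟩
      refine ⟨Fintype.linearCombination R m, ?_, fun g hg => ?_⟩
      · rw [linearCombination_comp_linearCombination, ← linearCombination_zero]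
        exact congrArg _ (funext hm)
      · obtain ⟨g, rfl⟩ := linearCombination_surjective g
        rw [linearCombination_comp_linearCombination] at hg
        exact hne ⟨g, fun i => congrFun (linearCombination_injective hg) i⟩

end MatrixExt
end LieDepth

/-! ### Exactness and completion of graded groups -/

namespace LieDepth
open CategoryTheory

/-- A group `A` with projections indexed by `ℕ`, of which every element involves finitely many,
together with the completion `B` of `A`, in which all families of components occur. -/
structure GradedPair (A B : Type*) [AddCommGroup A] [AddCommGroup B] where
  /-- the components of an element of the completion -/
  γ : ℕ → B →+ A
  /-- the map into the completion -/
  j : A →+ B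
  γ_j_γ : ∀ n x, γ n (j (γ n x)) = γ n x
  eq_zero : ∀ x, (∀ n, γ n x = 0) → x = 0
  complete : ∀ y : ℕ → A, (∀ n, γ n (j (y n)) = y n) → ∃ x, ∀ n, γ n x = y n
  finite : ∀ a, ∃ N, ∀ N' ≥ N, ∑ n ∈ Finset.range N', γ n (j a) = a

namespace GradedPair

variable {A A' B B' C C' : Type*} [AddCommGroup A] [AddCommGroup A'] [AddCommGroup B]
  [AddCommGroup B'] [AddCommGroup C] [AddCommGroup C']

/-- A homomorphism commutes with an extension of it to the completions. -/
structure Compat (P : GradedPair A A') (Q : GradedPair B B') (f : A →+ B) (f' : A' →+ B') :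
    Prop where
  γ : ∀ n x, Q.γ n (f' x) = f (P.γ n x)
  j : ∀ a, f' (P.j a) = Q.j (f a)

/-- Everything happens one degree at a time. From the graded groups to the completions, each
component of `b` is a cycle, hence has a preimage. The degree `n` part of that preimage is still
one, and these parts assemble to an element of `A'`. Conversely, a preimage in the completion is cut
off beyond the finitely many degrees of `b`. -/
theorem exact_iff {P : GradedPair A A'} {Q : GradedPair B B'} {T : GradedPair C C'}
    {f : A →+ B} {f' : A' →+ B'} {g : B →+ C} {g' : B' →+ C'}
    (hf : Compat P Q f f') (hg : Compat Q T g g') :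
    (∀ b, g b = 0 → ∃ a, f a = b) ↔ ∀ b, g' b = 0 → ∃ a, f' a = b := by
  constructor
  · intro h b hb
    have h1 : ∀ n, ∃ a, f a = Q.γ n b := fun n => h _ (by rw [← hg.γ, hb, map_zero])
    choose a ha using h1
    have h2 : ∀ n, f (P.γ n (P.j (a n))) = Q.γ n b := fun n => by
      rw [← hf.γ, hf.j, ha, Q.γ_j_γ]
    obtain ⟨x, hx⟩ := P.complete (fun n => P.γ n (P.j (a n))) (fun n => P.γ_j_γ _ _)
    refine ⟨x, sub_eq_zero.1 (Q.eq_zero _ fun n => ?_)⟩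
    rw [map_sub, hf.γ, hx, h2, sub_self]
  · intro h b hb
    obtain ⟨a, ha⟩ := h (Q.j b) (by rw [hg.j, hb, map_zero])
    obtain ⟨N, hN⟩ := Q.finite b
    refine ⟨∑ n ∈ Finset.range N, P.γ n a, ?_⟩
    rw [map_sum, ← hN N le_rfl]
    exact Finset.sum_congr rfl fun n _ => by rw [← hf.γ, ha]

/-- The finite power of a pair, with the degrees shifted by `a` . -/
def pi (P : GradedPair A A') {ι : Type*} [Fintype ι] (a : ι → ℕ) :
    GradedPair (ι → A) (ι → A') where
  γ n :=
    { toFun := fun x i => if a i ≤ n then P.γ (n - a i) (x i) else 0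
      map_zero' := by ext; simp
      map_add' := fun x y => by
        ext i
        simp only [Pi.add_apply]
        split_ifs <;> simp }
  j :=
    { toFun := fun x i => P.j (x i)
      map_zero' := by ext; simp
      map_add' := fun x y => by ext; simp }
  γ_j_γ n x := by
    ext i
    simp only [AddMonoidHom.coe_mk, ZeroHom.coe_mk]
    split_ifs
    · exact P.γ_j_γ _ _
    · rfl
  eq_zero x hx := by
    ext i
    refine P.eq_zero _ fun n => ?_
    have := congrFun (hx (n + a i)) i
    simpa using this
  complete y hy := by
    have h : ∀ i, ∃ x, ∀ n, P.γ n x = y (n + a i) i := fun i =>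
      P.complete _ fun n => by
        have := congrFun (hy (n + a i)) i
        simpa using this
    choose x hx using h
    refine ⟨x, fun n => funext fun i => ?_⟩
    simp only [AddMonoidHom.coe_mk, ZeroHom.coe_mk]
    split_ifs with h
    · rw [hx, Nat.sub_add_cancel h]
    · have := congrFun (hy n) i
      simpa [h] using this
  finite x := by
    choose N hN using fun i => P.finite (x i)
    refine ⟨∑ i, (a i + N i), fun N' hN' => funext fun i => ?_⟩
    have h1 : a i + N i ≤ N' :=
      (Finset.single_le_sum (f := fun i => a i + N i) (fun _ _ => Nat.zero_le _)
        (Finset.mem_univ i)).trans hN'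
    obtain ⟨k, rfl⟩ := Nat.exists_eq_add_of_le ((Nat.le_add_right _ _).trans h1)
    rw [Finset.sum_apply, Finset.sum_range_add, Finset.sum_eq_zero, zero_add]
    · simpa using hN i k (by omega)
    · intro n hn
      have : ¬ a i ≤ n := by simpa using hn
      simp [this]

@[simp] theorem pi_γ_apply (P : GradedPair A A') {ι : Type*} [Fintype ι] (a : ι → ℕ) (n : ℕ)
    (x : ι → A') (i : ι) :
    (P.pi a).γ n x i = if a i ≤ n then P.γ (n - a i) (x i) else 0 := rfl

@[simp] theorem pi_j_apply (P : GradedPair A A') {ι : Type*} [Fintype ι] (a : ι → ℕ)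
    (x : ι → A) (i : ι) : (P.pi a).j x i = P.j (x i) := rfl

/-- A group concentrated in degree zero. -/
def const (A : Type*) [AddCommGroup A] : GradedPair A A where
  γ n := if n = 0 then AddMonoidHom.id A else 0
  j := AddMonoidHom.id A
  γ_j_γ n x := by split_ifs <;> simp
  eq_zero x hx := by simpa using hx 0
  complete y hy := by
    refine ⟨y 0, fun n => ?_⟩
    rw [← hy n]
    split_ifs with h
    · simp [h]
    · simp
  finite x := by
    refine ⟨1, fun N hN => ?_⟩
    rw [Finset.sum_eq_single_of_mem 0 (Finset.mem_range.2 (by omega))]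
    · simp
    · intro b _ hb
      simp [hb]

end GradedPair

/-! ### The completion of a connected graded algebra -/

section Completion

variable {R : Type u} [Ring R] [Algebra ℚ R] (ε : R →ₐ[ℚ] ℚ) (𝒜 : ℕ → Submodule ℚ R)
  [GradedAlgebra 𝒜]

/-- The powers of the augmentation ideal are the ideals of the elements with components of high
degree. -/
def IsConnectedGrading : Prop :=
  ∀ n x, x ∈ augIdeal ε ^ n ↔ ∀ m < n, (DirectSum.decompose 𝒜 x m : R) = 0

/-- The component of degree `n` of an element of the completion. -/
noncomputable def completionComponent (n : ℕ) (x : completion ε) : R :=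
  DirectSum.decompose 𝒜
    (Function.surjInv (Ideal.Quotient.mk_surjective (I := augIdeal ε ^ (n + 1))) (x.1 (n + 1))) n

variable {ε 𝒜} (h : IsConnectedGrading ε 𝒜)
include h

/-- Any representative modulo a power `m > n` may be used: two of them differ, modulo the power `n +
1`, by an element without components of degree at most `n`. -/
theorem completionComponent_eq {x : completion ε} {n m : ℕ} (hm : n < m) {r : R}
    (hr : x.1 m = Ideal.Quotient.mk _ r) :
    completionComponent ε 𝒜 n x = DirectSum.decompose 𝒜 r n := by
  have h1 := Function.surjInv_eq (Ideal.Quotient.mk_surjective (I := augIdeal ε ^ (n + 1)))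
    (x.1 (n + 1))
  have h2 := x.2 (n + 1) m hm
  rw [hr, Ideal.Quotient.factor_mk] at h2
  rw [← h2, Ideal.Quotient.mk_eq_mk_iff_sub_mem, h] at h1
  have h3 := h1 n (Nat.lt_succ_self n)
  rw [DirectSum.decompose_sub] at h3
  rw [completionComponent]
  rw [← h2]
  exact sub_eq_zero.1 (by simpa using h3)

theorem completionComponent_toCompletion (n : ℕ) (r : R) :
    completionComponent ε 𝒜 n (toCompletion ε r) = DirectSum.decompose 𝒜 r n :=
  completionComponent_eq h (Nat.lt_succ_self n) rfl

theorem completionComponent_add (n : ℕ) (x y : completion ε) :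
    completionComponent ε 𝒜 n (x + y) =
      completionComponent ε 𝒜 n x + completionComponent ε 𝒜 n y := by
  obtain ⟨r, hr⟩ := Ideal.Quotient.mk_surjective (x.1 (n + 1))
  obtain ⟨s, hs⟩ := Ideal.Quotient.mk_surjective (y.1 (n + 1))
  rw [completionComponent_eq h (Nat.lt_succ_self n) hr.symm,
    completionComponent_eq h (Nat.lt_succ_self n) hs.symm,
    completionComponent_eq h (Nat.lt_succ_self n) (r := r + s)]
  · simp
  · rw [map_add, hr, hs]; rfl

theorem completionComponent_mul_toCompletion {k : ℕ} {a : R} (ha : a ∈ 𝒜 k) (n : ℕ)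
    (x : completion ε) : completionComponent ε 𝒜 n (x * toCompletion ε a) =
      if k ≤ n then completionComponent ε 𝒜 (n - k) x * a else 0 := by
  obtain ⟨r, hr⟩ := Ideal.Quotient.mk_surjective (x.1 (n + 1))
  rw [completionComponent_eq h (Nat.lt_succ_self n) (r := r * a)]
  · split_ifs with hk
    · rw [completionComponent_eq h (Nat.lt_succ_of_le (Nat.sub_le n k)) hr.symm,
        DirectSum.coe_decompose_mul_of_right_mem_of_le 𝒜 ha hk]
    · rw [DirectSum.coe_decompose_mul_of_right_mem_of_not_le 𝒜 ha hk]
  · rw [map_mul, hr]; rfl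

theorem completionComponent_toCompletion_mul {k : ℕ} {a : R} (ha : a ∈ 𝒜 k) (n : ℕ)
    (x : completion ε) : completionComponent ε 𝒜 n (toCompletion ε a * x) =
      if k ≤ n then a * completionComponent ε 𝒜 (n - k) x else 0 := by
  obtain ⟨r, hr⟩ := Ideal.Quotient.mk_surjective (x.1 (n + 1))
  rw [completionComponent_eq h (Nat.lt_succ_self n) (r := a * r)]
  · split_ifs with hk
    · rw [completionComponent_eq h (Nat.lt_succ_of_le (Nat.sub_le n k)) hr.symm,
        DirectSum.coe_decompose_mul_of_left_mem_of_le 𝒜 ha hk]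
    · rw [DirectSum.coe_decompose_mul_of_left_mem_of_not_le 𝒜 ha hk]
  · rw [map_mul, hr]; rfl

theorem completion_eq_zero {x : completion ε} (hx : ∀ n, completionComponent ε 𝒜 n x = 0) :
    x = 0 := by
  ext m
  obtain ⟨r, hr⟩ := Ideal.Quotient.mk_surjective (x.1 m)
  rw [← hr]
  refine Ideal.Quotient.eq_zero_iff_mem.2 ((h m r).2 fun n hn => ?_)
  rw [← completionComponent_eq h hn hr.symm, hx]

/-- The partial sums are compatible, since the terms added between stages `m` and `n` all have
degree at least `m`. -/
theorem exists_completionComponent_eq (y : ℕ → R) (hy : ∀ n, y n ∈ 𝒜 n) :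
    ∃ x, ∀ n, completionComponent ε 𝒜 n x = y n := by
  refine ⟨⟨fun m => Ideal.Quotient.mk _ (∑ n ∈ Finset.range m, y n), fun m n hmn => ?_⟩,
    fun n => ?_⟩
  · rw [Ideal.Quotient.factor_mk, Ideal.Quotient.mk_eq_mk_iff_sub_mem, h]
    intro k hk
    obtain ⟨l, rfl⟩ := Nat.exists_eq_add_of_le hmn
    rw [Finset.sum_range_add, add_sub_cancel_left, DirectSum.decompose_sum, DFinsupp.finsetSum_apply,
      AddSubmonoidClass.coe_finsetSum]
    refine Finset.sum_eq_zero fun i _ => ?_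
    rw [DirectSum.decompose_of_mem_ne 𝒜 (hy (m + i)) (by omega)]
  · rw [completionComponent_eq h (Nat.lt_succ_self n) (r := ∑ n ∈ Finset.range (n + 1), y n) rfl,
      DirectSum.decompose_sum, DFinsupp.finsetSum_apply, AddSubmonoidClass.coe_finsetSum,
      Finset.sum_eq_single_of_mem n (by simp)]
    · rw [DirectSum.decompose_of_mem_same 𝒜 (hy n)]
    · intro b _ hb
      rw [DirectSum.decompose_of_mem_ne 𝒜 (hy b) hb]

/-- A graded algebra and its completion. -/
noncomputable def completionPair : GradedPair R (completion ε) where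
  γ n :=
    { toFun := completionComponent ε 𝒜 n
      map_zero' := by
        have := completionComponent_add h n 0 0
        simpa using this
      map_add' := completionComponent_add h n }
  j := (toCompletion ε : R →+ completion ε)
  γ_j_γ n x := by
    change completionComponent ε 𝒜 n (toCompletion ε (completionComponent ε 𝒜 n x)) = _
    rw [completionComponent_toCompletion h, completionComponent,
      DirectSum.decompose_of_mem_same 𝒜 (SetLike.coe_mem _)]
    rfl
  eq_zero x hx := completion_eq_zero h hx
  complete y hy := by
    refine exists_completionComponent_eq h y fun n => ?_
    rw [← hy n]
    change completionComponent ε 𝒜 n _ ∈ _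
    exact SetLike.coe_mem _
  finite a := by
    classical
    refine ⟨(DirectSum.decompose 𝒜 a).support.sup id + 1, fun N hN => ?_⟩
    conv_rhs => rw [← DirectSum.sum_support_decompose 𝒜 a]
    symm
    refine (Finset.sum_subset (fun i hi => ?_) fun i _ hi => ?_).trans
      (Finset.sum_congr rfl fun i _ => (completionComponent_toCompletion h i a).symm)
    · have := Finset.le_sup (f := id) hi
      simp only [id_eq] at this
      exact Finset.mem_range.2 (by omega)
    · simpa using hi

theorem completionPair_γ (n : ℕ) (x : completion ε) :
    (completionPair h).γ n x = completionComponent ε 𝒜 n x := rfl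

end Completion

end LieDepth

/-! ### Homogeneous matrices over the algebra and over its completion -/

namespace LieDepth
open CategoryTheory

section HomogeneousMatrix

variable {R : Type u} [Ring R] [Algebra ℚ R]

/-- A matrix over a graded ring that is homogeneous of degree zero for weights on its rows and
columns. -/
def IsHomogeneousMatrix (𝒜 : ℕ → Submodule ℚ R) {ι ι' : Type*} (wt : ι → ℕ) (wt' : ι' → ℕ)
    (D : ι → ι' → R) : Prop :=
  ∀ i j, D i j = 0 ∨ ∃ k, wt i = wt' j + k ∧ D i j ∈ 𝒜 k

variable {ε : R →ₐ[ℚ] ℚ} {𝒜 : ℕ → Submodule ℚ R} [GradedAlgebra 𝒜]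
  (h : IsConnectedGrading ε 𝒜) {ι ι' ι'' : Type*} [Fintype ι] [Fintype ι'] [Fintype ι'']
  {wt : ι → ℕ} {wt' : ι' → ℕ} {wt'' : ι'' → ℕ}

/-- Shifting each coordinate by the weight of its generator makes the homogeneous matrix a map of
degree zero on rows. -/
theorem compat_rowMul {D : ι → ι' → R} (hD : IsHomogeneousMatrix 𝒜 wt wt' D) :
    GradedPair.Compat ((completionPair h).pi wt) ((completionPair h).pi wt')
      (Fintype.linearCombination R D).toAddMonoidHom
      (Fintype.linearCombination (completion ε)
        (fun i j => toCompletion ε (D i j))).toAddMonoidHom where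
  γ n x := by
    ext j
    simp only [LinearMap.toAddMonoidHom_coe, GradedPair.pi_γ_apply,
      Fintype.linearCombination_apply, Finset.sum_apply, Pi.smul_apply, smul_eq_mul, map_sum]
    have key : ∀ i, (if wt' j ≤ n then (completionPair h).γ (n - wt' j)
        (x i * toCompletion ε (D i j)) else 0) =
        (if wt i ≤ n then (completionPair h).γ (n - wt i) (x i) else 0) * D i j := by
      intro i
      obtain h0 | ⟨k, hk, hm⟩ := hD i j
      · simp [h0]
      · split_ifs with hj hi hi
        · rw [completionPair_γ, completionComponent_mul_toCompletion h hm, if_pos (by omega),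
            completionPair_γ]
          congr 2
          omega
        · rw [completionPair_γ, completionComponent_mul_toCompletion h hm, if_neg (by omega),
            zero_mul]
        · omega
        · rw [zero_mul]
    rw [← Finset.sum_congr rfl fun i _ => key i]
    split_ifs <;> simp
  j x := by
    ext j : 1
    simp only [LinearMap.toAddMonoidHom_coe, GradedPair.pi_j_apply,
      Fintype.linearCombination_apply, Finset.sum_apply, Pi.smul_apply, smul_eq_mul, map_sum]
    exact Finset.sum_congr rfl fun i _ => (map_mul (toCompletion ε) (x i) (D i j)).symm

/-- Left multiplication by a matrix. -/
def colMul {A : Type*} [Ring A] (D : ι → ι' → A) : (ι' → A) →+ (ι → A) where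
  toFun m i := ∑ j, D i j * m j
  map_zero' := by ext; simp
  map_add' x y := by ext; simp [mul_add, Finset.sum_add_distrib]

omit [Fintype ι] in
theorem colMul_apply {A : Type*} [Ring A] (D : ι → ι' → A) (m : ι' → A) (i : ι) :
    colMul D m i = ∑ j, D i j * m j := rfl

/-- On columns the dual generators carry the negatives of the weights. A common bound `N` turns
these into the natural numbers `N - wt`; this is why the weights of the resolution must be bounded.
-/
theorem compat_colMul {D : ι → ι' → R} (hD : IsHomogeneousMatrix 𝒜 wt wt' D) {N : ℕ}
    (hwt : ∀ i, wt i ≤ N) (hwt' : ∀ j, wt' j ≤ N) :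
    GradedPair.Compat ((completionPair h).pi fun j => N - wt' j)
      ((completionPair h).pi fun i => N - wt i)
      (colMul D) (colMul (fun i j => toCompletion ε (D i j))) where
  γ n x := by
    ext i
    simp only [GradedPair.pi_γ_apply, colMul_apply, map_sum]
    have key : ∀ j, (if N - wt i ≤ n then (completionPair h).γ (n - (N - wt i))
        (toCompletion ε (D i j) * x j) else 0) =
        D i j * if N - wt' j ≤ n then (completionPair h).γ (n - (N - wt' j)) (x j) else 0 := by
      intro j
      have := hwt i
      have := hwt' j
      obtain h0 | ⟨k, hk, hm⟩ := hD i j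
      · simp [h0]
      · split_ifs with hi hj hj
        · rw [completionPair_γ, completionComponent_toCompletion_mul h hm, if_pos (by omega),
            completionPair_γ]
          congr 2
          omega
        · rw [completionPair_γ, completionComponent_toCompletion_mul h hm, if_neg (by omega),
            mul_zero]
        · omega
        · rw [mul_zero]
    rw [← Finset.sum_congr rfl fun j _ => key j]
    split_ifs <;> simp
  j x := by
    ext i : 1
    simp only [GradedPair.pi_j_apply, colMul_apply, map_sum]
    exact Finset.sum_congr rfl fun j _ => (map_mul (toCompletion ε) (D i j) (x j)).symm

include h in
theorem cochainExact_completion_iff {D' : ι → ι' → R} {D : ι'' → ι → R}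
    (hD' : IsHomogeneousMatrix 𝒜 wt wt' D') (hD : IsHomogeneousMatrix 𝒜 wt'' wt D) {N : ℕ}
    (hwt : ∀ i, wt i ≤ N) (hwt' : ∀ i, wt' i ≤ N) (hwt'' : ∀ i, wt'' i ≤ N) :
    CochainExact D' D R ↔ CochainExact (fun i j => toCompletion ε (D' i j))
      (fun i j => toCompletion ε (D i j)) (completion ε) := by
  have := GradedPair.exact_iff (compat_colMul h hD' hwt hwt') (compat_colMul h hD hwt'' hwt)
  simpa only [funext_iff, colMul_apply, Pi.zero_apply, CochainExact, smul_eq_mul] using this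

include h in
theorem exact_completion {D : ι → ι' → R} {D' : ι' → ι'' → R}
    (hD : IsHomogeneousMatrix 𝒜 wt wt' D) (hD' : IsHomogeneousMatrix 𝒜 wt' wt'' D')
    (hex : Function.Exact (Fintype.linearCombination R D) (Fintype.linearCombination R D')) :
    Function.Exact (Fintype.linearCombination (completion ε) fun i j => toCompletion ε (D i j))
      (Fintype.linearCombination (completion ε) fun i j => toCompletion ε (D' i j)) := by
  have h1 := (GradedPair.exact_iff (compat_rowMul h hD) (compat_rowMul h hD')).1
    fun b hb => (hex b).1 hb
  have h2 := hex.linearMap_comp_eq_zero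
  rw [linearCombination_comp_linearCombination, ← linearCombination_zero] at h2
  have h3 := linearCombination_injective h2
  refine fun b => ⟨h1 b, ?_⟩
  rintro ⟨a, rfl⟩
  rw [← LinearMap.comp_apply, linearCombination_comp_linearCombination]
  -- That the composite vanishes is an identity between matrix entries, which `toCompletion` carries
  -- over.
  convert LinearMap.zero_apply a
  rw [← linearCombination_zero]
  congr 1
  ext i j : 2
  have h4 := congrArg (toCompletion ε) (congrFun (congrFun h3 i) j)
  simpa using h4

/-- The map `x ↦ ∑ i, ε (x i) * c i`. -/
def augSum {A : Type*} [Ring A] [Algebra ℚ A] (ε : A →ₐ[ℚ] ℚ) (c : ι → ℚ) : (ι → A) →+ ℚ where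
  toFun x := ∑ i, ε (x i) * c i
  map_zero' := by simp
  map_add' x y := by simp [add_mul, Finset.sum_add_distrib]

include h in
-- The augmentation factors through the quotient by the first power of the augmentation ideal, and
-- that ideal consists of the elements without a component of degree zero.
theorem completionAug_eq (x : completion ε) :
    completionAug ε x = ε (completionComponent ε 𝒜 0 x) := by
  obtain ⟨r, hr⟩ := Ideal.Quotient.mk_surjective (x.1 1)
  have h1 : completionAug ε x = ε r := by
    change Ideal.Quotient.liftₐ (augIdeal ε ^ 1) ε
      (fun a ha => by rwa [Submodule.pow_one, RingHom.mem_ker] at ha) (x.1 1) = ε r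
    rw [← hr]
    rfl
  rw [h1, completionComponent_eq h zero_lt_one hr.symm, ← sub_eq_zero, ← map_sub,
    ← RingHom.mem_ker, ← Submodule.pow_one (RingHom.ker ε), h]
  intro m hm
  obtain rfl : m = 0 := by omega
  simp

include h in
theorem aug_eq_zero {n : ℕ} (hn : n ≠ 0) {x : R} (hx : x ∈ 𝒜 n) : ε x = 0 := by
  rw [← RingHom.mem_ker, ← Submodule.pow_one (RingHom.ker ε), h]
  intro m hm
  rw [DirectSum.decompose_of_mem_ne 𝒜 hx (by omega)]

/-- With `ℚ` placed in degree zero, the augmentation of the resolution preserves degrees because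
only generators of weight zero contribute to it. -/
theorem compat_augSum {c : ι → ℚ} (hc : ∀ i, c i ≠ 0 → wt i = 0) :
    GradedPair.Compat ((completionPair h).pi wt) (GradedPair.const ℚ) (augSum ε c)
      (augSum (completionAug ε) c) where
  γ n x := by
    have key : ∀ i, ε (((completionPair h).pi wt).γ n x i) * c i =
        (GradedPair.const ℚ).γ n (completionAug ε (x i) * c i) := by
      intro i
      by_cases h0 : c i = 0
      · simp [h0]
      · rw [GradedPair.pi_γ_apply, hc i h0, if_pos (Nat.zero_le n), Nat.sub_zero, completionPair_γ]
        by_cases hn : n = 0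
        · subst hn
          simp [GradedPair.const, completionAug_eq h]
        · rw [aug_eq_zero h hn (by exact SetLike.coe_mem _)]
          simp [GradedPair.const, hn]
    simp only [augSum, AddMonoidHom.coe_mk, ZeroHom.coe_mk, map_sum, key]
  j x := Finset.sum_congr rfl fun _ _ => rfl

include h in
theorem exact_augSum_completion {D : ι → ι' → R} (hD : IsHomogeneousMatrix 𝒜 wt wt' D)
    {c : ι' → ℚ} (hc : ∀ i, c i ≠ 0 → wt' i = 0)
    (hex : Function.Exact (Fintype.linearCombination R D) (augSum ε c)) :
    Function.Exact (Fintype.linearCombination (completion ε) fun i j => toCompletion ε (D i j))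
      (augSum (completionAug ε) c) := by
  classical
  have h1 := (GradedPair.exact_iff (compat_rowMul h hD) (compat_augSum h hc)).1
    fun b hb => (hex b).1 hb
  refine fun b => ⟨h1 b, ?_⟩
  rintro ⟨a, rfl⟩
  have h2 : ∀ i, ∑ j, ε (D i j) * c j = 0 := fun i => by
    have := (hex (D i)).2 ⟨Pi.single i 1, by simp⟩
    simpa [augSum] using this
  simp only [augSum, AddMonoidHom.coe_mk, ZeroHom.coe_mk, Fintype.linearCombination_apply,
    Pi.smul_apply, smul_eq_mul, map_sum, map_mul, completionAug_toCompletion]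
  refine Finset.sum_eq_zero fun i _ => ?_
  simp only [mul_assoc]
  rw [← Finset.mul_sum, h2, mul_zero]

end HomogeneousMatrix

end LieDepth

/-! ### Equality of depths, given a suitable resolution -/

namespace LieDepth
open CategoryTheory

section DepthOfResolution

theorem cochainExact_restrictScalars_iff {R A : Type u} [Ring R] [Ring A] (f : R →+* A)
    {κ κ' κ'' : Type} [Fintype κ] [Fintype κ'] (D' : κ → κ' → R) (D : κ'' → κ → R) :
    CochainExact D' D ((ModuleCat.restrictScalars f).obj (ModuleCat.of A A)) ↔
      CochainExact (fun i j => f (D' i j)) (fun i j => f (D i j)) A :=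
  Iff.rfl

variable {R : Type u} [Ring R] [Algebra ℚ R] {ι : ℕ → Type} [∀ n, Fintype (ι n)]

theorem leastExt_congr {A : Type u} [Ring A] [Algebra ℚ A] {ε : R →ₐ[ℚ] ℚ} {ε' : A →ₐ[ℚ] ℚ}
    {M : ModuleCat.{u} R} {M' : ModuleCat.{u} A}
    (h : ∀ p, Nontrivial (Abelian.Ext.{u} (trivialModule ε) M p) ↔
      Nontrivial (Abelian.Ext.{u} (trivialModule ε') M' p)) : leastExt ε M = leastExt ε' M' :=
  iInf_congr fun p => iInf_congr_Prop (h p) fun _ => rfl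

/-- Vanishing of the cohomology in degree `p` of the complex `Hom (R ^ ι p, M)`. -/
def CohomologyVanishes (D : ∀ n, ι (n + 1) → ι n → R) (M : Type*) [AddCommGroup M] [Module R M] :
    ℕ → Prop
  | 0 => CochainExact (fun (_ : ι 0) (j : Empty) => j.elim) (D 0) M
  | n + 1 => CochainExact (D n) (D (n + 1)) M

/-- An element of the trivial module. -/
def trivialModule.mk (ε : R →ₐ[ℚ] ℚ) (q : ℚ) : trivialModule ε := ULift.up q

theorem nontrivial_ext_trivialModule_iff {ε : R →ₐ[ℚ] ℚ} {D : ∀ n, ι (n + 1) → ι n → R}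
    {c : ι 0 → ℚ} (hc : Function.Surjective (augSum ε c))
    (h₀ : Function.Exact (Fintype.linearCombination R (D 0)) (augSum ε c))
    (hD : ∀ n, Function.Exact (Fintype.linearCombination R (D (n + 1)))
      (Fintype.linearCombination R (D n)))
    (M : ModuleCat.{u} R) (p : ℕ) :
    Nontrivial (Abelian.Ext.{u} (trivialModule ε) M p) ↔ ¬ CohomologyVanishes D M p := by
  -- The underlying type of the trivial module is `ULift ℚ`, so the rational-valued `augSum` is
  -- transported through `ULift.down`.
  have key : ∀ x, Fintype.linearCombination R
      (fun i => trivialModule.mk ε (c i)) x = trivialModule.mk ε (augSum ε c x) := by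
    intro x
    let e : trivialModule ε →+ ℚ := 
      { toFun := ULift.down, map_zero' := rfl, map_add' := fun _ _ => rfl }
    refine ULift.down_injective ?_
    change e _ = _
    rw [Fintype.linearCombination_apply, map_sum]
    rfl
  refine (nontrivial_ext_iff D (Q := trivialModule ε) (fun i => trivialModule.mk ε (c i)) ?_ ?_ hD M p).trans ?_
  · rintro ⟨q⟩
    obtain ⟨x, hx⟩ := hc q
    exact ⟨x, (key x).trans (congrArg _ hx)⟩
  · intro x
    rw [← h₀ x, key]
    exact ULift.ext_iff
  · cases p <;> rfl

variable {ε : R →ₐ[ℚ] ℚ} {𝒜 : ℕ → Submodule ℚ R} [GradedAlgebra 𝒜]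

omit [Algebra ℚ R] in
theorem cohomologyVanishes_restrictScalars_iff {A : Type u} [Ring A] (f : R →+* A)
    (D : ∀ n, ι (n + 1) → ι n → R) (p : ℕ) :
    CohomologyVanishes D ((ModuleCat.restrictScalars f).obj (ModuleCat.of A A)) p ↔
      CohomologyVanishes (fun n i j => f (D n i j)) A p := by
  cases p with
  | zero =>
    refine (cochainExact_restrictScalars_iff _ _ _).trans ?_
    rw [CohomologyVanishes]
    refine iff_of_eq (congrArg (fun E => CochainExact E _ _) ?_)
    exact funext fun _ => funext fun j => j.elim
  | succ n => exact cochainExact_restrictScalars_iff _ _ _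

theorem cohomologyVanishes_completion_iff (h : IsConnectedGrading ε 𝒜) {N : ℕ}
    {wt : ∀ n, ι n → ℕ} (hwt : ∀ n i, wt n i ≤ N) {D : ∀ n, ι (n + 1) → ι n → R}
    (hD : ∀ n, IsHomogeneousMatrix 𝒜 (wt (n + 1)) (wt n) (D n)) (p : ℕ) :
    CohomologyVanishes D R p ↔
      CohomologyVanishes (fun n i j => toCompletion ε (D n i j)) (completion ε) p := by
  cases p with
  | zero =>
    -- In degree `0` the incoming module is zero, with index set `Empty`, so any weight function
    -- serves there.
    refine (cochainExact_completion_iff h (wt' := fun _ => 0) (fun _ j => j.elim) (hD 0)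
      (hwt 0) (fun j => j.elim) (hwt 1)).trans ?_
    rw [CohomologyVanishes]
    refine iff_of_eq (congrArg (fun E => CochainExact E _ _) ?_)
    exact funext fun _ => funext fun j => j.elim
  | succ n => exact cochainExact_completion_iff h (hD n) (hD (n + 1)) (hwt _) (hwt _) (hwt _)

/-- A connected graded algebra over which `ℚ` has a resolution by graded free modules of finite
rank with generators of bounded weights has the same depth as its completion. -/
theorem depth_eq_of_resolution (h : IsConnectedGrading ε 𝒜) {N : ℕ} {wt : ∀ n, ι n → ℕ}
    (hwt : ∀ n i, wt n i ≤ N) {D : ∀ n, ι (n + 1) → ι n → R}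
    (hD : ∀ n, IsHomogeneousMatrix 𝒜 (wt (n + 1)) (wt n) (D n))
    {c : ι 0 → ℚ} (hc : ∀ i, c i ≠ 0 → wt 0 i = 0) (hc' : ∃ i, c i ≠ 0)
    (h₀ : Function.Exact (Fintype.linearCombination R (D 0)) (augSum ε c))
    (hex : ∀ n, Function.Exact (Fintype.linearCombination R (D (n + 1)))
      (Fintype.linearCombination R (D n))) :
    depth ε = leastExt ε ((ModuleCat.restrictScalars (toCompletion ε).toRingHom).obj
        (ModuleCat.of (completion ε) (completion ε))) ∧
      leastExt ε ((ModuleCat.restrictScalars (toCompletion ε).toRingHom).obj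
        (ModuleCat.of (completion ε) (completion ε))) = depth (completionAug ε) := by
  have hs : ∀ {A : Type u} [Ring A] [Algebra ℚ A] (ε : A →ₐ[ℚ] ℚ),
      Function.Surjective (augSum ε c) := by
    classical
    intro A _ _ ε q
    obtain ⟨i, hi⟩ := hc'
    refine ⟨Pi.single i (algebraMap ℚ A (q / c i)), ?_⟩
    simp only [augSum, AddMonoidHom.coe_mk, ZeroHom.coe_mk]
    rw [Finset.sum_eq_single_of_mem i (Finset.mem_univ i)]
    · simp [hi]
    · intro j _ hj
      simp [hj]
  have h1 := nontrivial_ext_trivialModule_iff (hs ε) h₀ hex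
  -- The images of the matrices in the completion resolve `ℚ` over the completion.
  have h2 := nontrivial_ext_trivialModule_iff (ε := completionAug ε)
    (D := fun n i j => toCompletion ε (D n i j)) (c := c) (hs (completionAug ε))
    (exact_augSum_completion h (hD 0) hc h₀)
    (fun n => exact_completion h (hD (n + 1)) (hD n) (hex n))
  refine ⟨leastExt_congr fun p => ?_, leastExt_congr fun p => ?_⟩
  -- Same resolution, two coefficient modules: columns over the algebra against columns over its
  -- completion.
  · refine (h1 _ p).trans (Iff.trans ?_ (h1 _ p).symm)
    exact not_congr ((cohomologyVanishes_completion_iff h hwt hD p).trans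
      (cohomologyVanishes_restrictScalars_iff (toCompletion ε).toRingHom D p).symm)
  -- Same coefficients, two rings: both resolutions yield the same complex of columns over the
  -- completion.
  · refine (h1 _ p).trans (Iff.trans ?_ (h2 _ p).symm)
    exact not_congr (cohomologyVanishes_restrictScalars_iff (toCompletion ε).toRingHom D p)

end DepthOfResolution

end LieDepth

/-! ### Decompositions into eigenspaces -/

namespace LieDepth

section Decomposition

variable {ι M N : Type*} [DecidableEq ι] [AddCommGroup M] [Module ℚ M] [AddCommGroup N] [Module ℚ N]

/-- Subspaces that span and on which an operator acts by distinct scalars form a decomposition. -/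
@[reducible]
noncomputable def decompositionOfEigenvalues (ℳ : ι → Submodule ℚ M) (T : M →ₗ[ℚ] M) (μ : ι → ℚ)
    (hμ : Function.Injective μ) (hT : ∀ i, ∀ x ∈ ℳ i, T x = μ i • x) (htop : ⨆ i, ℳ i = ⊤) :
    DirectSum.Decomposition ℳ :=
  (DirectSum.isInternal_submodule_of_iSupIndep_of_iSup_eq_top
    (((Module.End.eigenspaces_iSupIndep T).comp hμ).mono
      fun i x hx => Module.End.mem_eigenspace_iff.2 (hT i x hx)) htop).chooseDecomposition

variable (ℳ : ι → Submodule ℚ M) [DirectSum.Decomposition ℳ]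

/-- The operator that acts on the pieces of a decomposition by given scalars. -/
noncomputable def diag (c : ι → ℚ) : M →ₗ[ℚ] M :=
  DirectSum.toModule ℚ ι M (fun i => c i • (ℳ i).subtype) ∘ₗ
    (DirectSum.decomposeLinearEquiv ℳ).toLinearMap

theorem diag_of_mem {c : ι → ℚ} {i : ι} {x : M} (hx : x ∈ ℳ i) : diag ℳ c x = c i • x := by
  simp only [diag, LinearMap.comp_apply, LinearEquiv.coe_coe, DirectSum.decomposeLinearEquiv_apply]
  rw [DirectSum.decompose_of_mem ℳ hx]
  erw [DirectSum.toModule_lof]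
  rfl

theorem linearMap_eq_of_mem {f g : M →ₗ[ℚ] N} (h : ∀ i, ∀ x ∈ ℳ i, f x = g x) : f = g := by
  ext x
  induction x using DirectSum.Decomposition.inductionOn ℳ with
  | zero => simp
  | homogeneous m => exact h _ _ m.2
  | add m m' h h' => rw [map_add, map_add, h, h']

/-- Used for a differential that carries pieces to pieces with matching scalars. Pieces that `f`
kills impose no condition, so `σ` may take arbitrary values on them. -/
theorem diag_comm {κ : Type*} [DecidableEq κ] (𝒩 : κ → Submodule ℚ N)
    [DirectSum.Decomposition 𝒩] {f : M →ₗ[ℚ] N} {σ : ι → κ} {c : ι → ℚ} {c' : κ → ℚ}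
    (hf : ∀ i, ∀ x ∈ ℳ i, f x = 0 ∨ f x ∈ 𝒩 (σ i) ∧ c' (σ i) = c i) (x : M) :
    f (diag ℳ c x) = diag 𝒩 c' (f x) := by
  refine LinearMap.congr_fun (linearMap_eq_of_mem ℳ (f := f ∘ₗ diag ℳ c) (g := diag 𝒩 c' ∘ₗ f) ?_) x
  intro i x hx
  simp only [LinearMap.comp_apply]
  rw [diag_of_mem ℳ hx, map_smul]
  obtain h | ⟨h, h'⟩ := hf i x hx
  · simp [h]
  · rw [diag_of_mem 𝒩 h, h']

theorem diag_single_mem (i : ι) (x : M) : diag ℳ (Pi.single i 1) x ∈ ℳ i := by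
  induction x using DirectSum.Decomposition.inductionOn ℳ with
  | zero => simp
  | @homogeneous j m =>
    rw [diag_of_mem ℳ m.2]
    by_cases h : j = i
    · subst h
      exact Submodule.smul_mem _ _ m.2
    · simp [h]
  | add m m' h h' => rw [map_add]; exact add_mem h h'

theorem diag_single_of_mem {i : ι} {x : M} (hx : x ∈ ℳ i) : diag ℳ (Pi.single i 1) x = x := by
  rw [diag_of_mem ℳ hx, Pi.single_eq_same, one_smul]

theorem diag_single_of_mem_ne {i j : ι} {x : M} (hx : x ∈ ℳ i) (h : i ≠ j) :
    diag ℳ (Pi.single j 1) x = 0 := by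
  rw [diag_of_mem ℳ hx, Pi.single_eq_of_ne h, zero_smul]

end Decomposition

/-! ### The weight grading of a Lie algebra with homogeneous relations -/

/-- A grading of a Lie algebra by positive integers for which the part of degree one generates. -/
structure LieGrading (L : Type*) [LieRing L] [LieAlgebra ℚ L] where
  /-- the homogeneous pieces -/
  W : ℕ → Submodule ℚ L
  dec : DirectSum.Decomposition W
  zero : W 0 = ⊥
  lie_mem : ∀ {i j x y}, x ∈ W i → y ∈ W j → ⁅x, y⁆ ∈ W (i + j)
  generated : ∀ n, W (n + 2) ≤ Submodule.span ℚ
    {z | ∃ i j x y, 0 < i ∧ 0 < j ∧ i + j = n + 2 ∧ x ∈ W i ∧ y ∈ W j ∧ ⁅x, y⁆ = z}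

section Presented

variable {S : Type u}

theorem IsBracket.pos {r : ℕ} {a : FreeLieAlgebra ℚ S} (h : IsBracket r a) : 0 < r := by
  induction h with
  | of => exact one_pos
  | lie => omega

theorem lie_mem_bracketSpan {p q : ℕ} {x y : FreeLieAlgebra ℚ S} (hx : x ∈ bracketSpan S p)
    (hy : y ∈ bracketSpan S q) : ⁅x, y⁆ ∈ bracketSpan S (p + q) := by
  induction hx using Submodule.span_induction with
  | mem a ha =>
    induction hy using Submodule.span_induction with
    | mem b hb => exact Submodule.subset_span (IsBracket.lie ha hb)
    | zero => simp
    | add b c _ _ hb hc => rw [lie_add]; exact add_mem hb hc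
    | smul t b _ hb => rw [lie_smul]; exact Submodule.smul_mem _ _ hb
  | zero => simp
  | add b c _ _ hb hc => rw [add_lie]; exact add_mem hb hc
  | smul t b _ hb => rw [smul_lie]; exact Submodule.smul_mem _ _ hb

/-- The sum of the spans is a Lie subalgebra that contains the generators, and by freeness the
identity factors through it. -/
theorem iSup_bracketSpan : ⨆ r, bracketSpan S r = ⊤ := by
  let A : LieSubalgebra ℚ (FreeLieAlgebra ℚ S) :=
    { (⨆ r, bracketSpan S r : Submodule ℚ (FreeLieAlgebra ℚ S)) with
      lie_mem' := by
        intro x y hx hy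
        simp only [AddSubsemigroup.mem_carrier, AddSubmonoid.mem_toSubsemigroup,
          Submodule.mem_toAddSubmonoid] at hx hy ⊢
        induction hx using Submodule.iSup_induction' with
        | mem i x hx =>
          induction hy using Submodule.iSup_induction' with
          | mem j y hy =>
            exact Submodule.mem_iSup_of_mem (i + j) (lie_mem_bracketSpan hx hy)
          | zero => simp
          | add y z _ _ hy hz => rw [lie_add]; exact add_mem hy hz
        | zero => simp
        | add y z _ _ hy hz => rw [add_lie]; exact add_mem hy hz }
  have hA : ∀ s : S, FreeLieAlgebra.of ℚ s ∈ A := fun s =>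
    Submodule.mem_iSup_of_mem (p := bracketSpan S) 1 (Submodule.subset_span (IsBracket.of s))
  let f : FreeLieAlgebra ℚ S →ₗ⁅ℚ⁆ A := FreeLieAlgebra.lift ℚ fun s => ⟨_, hA s⟩
  have hf : A.incl.comp f = LieHom.id := by
    refine FreeLieAlgebra.hom_ext fun s => ?_
    simp [f]
  refine eq_top_iff.2 fun x _ => ?_
  have hx := LieHom.congr_fun hf x
  have h2 : x ∈ A := by
    rw [LieHom.id_apply] at hx
    rw [← hx]
    exact (f x).2
  exact h2

theorem map_bracketSpan {M : Type*} [LieRing M] [LieAlgebra ℚ M]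
    {f g : FreeLieAlgebra ℚ S →ₗ⁅ℚ⁆ M} {t : ℚ}
    (h : ∀ s, f (FreeLieAlgebra.of ℚ s) = t • g (FreeLieAlgebra.of ℚ s)) {r : ℕ}
    {x : FreeLieAlgebra ℚ S} (hx : x ∈ bracketSpan S r) : f x = t ^ r • g x := by
  induction hx using Submodule.span_induction with
  | mem a ha =>
    induction ha with
    | of s => simp [h]
    | lie _ _ h1 h2 =>
      rw [LieHom.map_lie, LieHom.map_lie, h1, h2, smul_lie, lie_smul, smul_smul, pow_add]
  | zero => simp
  | add b c _ _ hb hc => rw [map_add, map_add, hb, hc, smul_add]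
  | smul q b _ hb => rw [map_smul, map_smul, hb, smul_comm]

variable (T : Set (FreeLieAlgebra ℚ S))

/-- The projection onto a presented Lie algebra. -/
noncomputable def presentedMk : FreeLieAlgebra ℚ S →ₗ⁅ℚ⁆ PresentedLie S T :=
  { (LieSubmodule.Quotient.mk' (LieSubmodule.lieSpan ℚ (FreeLieAlgebra ℚ S) T) :
      FreeLieAlgebra ℚ S →ₗ[ℚ] PresentedLie S T) with
    map_lie' := fun {x y} => LieSubmodule.Quotient.mk_bracket _ x y }

theorem presentedMk_surjective : Function.Surjective (presentedMk T) :=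
  LieSubmodule.Quotient.surjective_mk' _

/-- The image of `𝕃(r)`. -/
noncomputable def presentedPiece (r : ℕ) : Submodule ℚ (PresentedLie S T) :=
  (bracketSpan S r).map (presentedMk T : FreeLieAlgebra ℚ S →ₗ[ℚ] PresentedLie S T)

theorem iSup_presentedPiece : ⨆ r, presentedPiece T r = ⊤ := by
  simp only [presentedPiece]
  rw [← Submodule.map_iSup, iSup_bracketSpan, Submodule.map_top, LinearMap.range_eq_top]
  exact presentedMk_surjective T

variable {T} (hT : ∀ t ∈ T, ∃ r : ℕ, t ∈ bracketSpan S r)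
include hT

/-- Doubling every generator multiplies a relation of length `r` by `2 ^ r`, so the map descends to
the quotient. As the powers of two are distinct, the images of the `𝕃(r)` are independent, and no
decomposition of the free Lie algebra itself is needed. -/
theorem exists_scaling : ∃ φ : PresentedLie S T →ₗ[ℚ] PresentedLie S T,
    ∀ r, ∀ x ∈ presentedPiece T r, φ x = (2 : ℚ) ^ r • x := by
  let f : FreeLieAlgebra ℚ S →ₗ⁅ℚ⁆ PresentedLie S T :=
    FreeLieAlgebra.lift ℚ fun s => (2 : ℚ) • presentedMk T (FreeLieAlgebra.of ℚ s)
  have hf : ∀ r, ∀ x ∈ bracketSpan S r, f x = (2 : ℚ) ^ r • presentedMk T x := fun r x hx =>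
    map_bracketSpan (fun s => by simp [f]) hx
  let I : LieIdeal ℚ (FreeLieAlgebra ℚ S) := LieSubmodule.lieSpan ℚ (FreeLieAlgebra ℚ S) T
  have hker : I ≤ f.ker := by
    refine LieSubmodule.lieSpan_le.2 fun t ht => ?_
    obtain ⟨r, hr⟩ := hT t ht
    have h0 : presentedMk T t = 0 :=
      (LieSubmodule.Quotient.mk_eq_zero _).2 (LieSubmodule.subset_lieSpan ht)
    change t ∈ f.ker
    rw [LieHom.mem_ker, hf r t hr, h0, smul_zero]
  refine ⟨Submodule.liftQ I.toSubmodule (f : FreeLieAlgebra ℚ S →ₗ[ℚ] PresentedLie S T)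
    (fun x hx => hker hx), ?_⟩
  rintro r _ ⟨x, hx, rfl⟩
  exact hf r x hx

/-- The weights of a Lie algebra with homogeneous relations. -/
noncomputable def presentedGrading : LieGrading (PresentedLie S T) where
  W := presentedPiece T
  dec := decompositionOfEigenvalues _ (exists_scaling hT).choose (fun r => 2 ^ r)
    (pow_right_injective₀ two_pos (by norm_num)) (exists_scaling hT).choose_spec
    (iSup_presentedPiece T)
  zero := by
    have : bracketSpan S 0 = ⊥ :=
      Submodule.span_eq_bot.2 fun x (hx : IsBracket 0 x) => absurd hx.pos (lt_irrefl 0)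
    rw [presentedPiece, this, Submodule.map_bot]
  lie_mem := by
    rintro i j _ _ ⟨x, hx, rfl⟩ ⟨y, hy, rfl⟩
    exact ⟨_, lie_mem_bracketSpan hx hy, LieHom.map_lie _ _ _⟩
  generated n := by
    rw [presentedPiece, bracketSpan, Submodule.map_span, Submodule.span_le]
    rintro _ ⟨a, ha, rfl⟩
    refine Submodule.subset_span ?_
    -- A bracket of length at least two is not a generator, so its outermost bracket splits it into
    -- two shorter ones. The length becomes a variable `m` so that case analysis applies.
    have key : ∀ m a, IsBracket m a → m = n + 2 → ∃ i j x y, 0 < i ∧ 0 < j ∧ i + j = n + 2 ∧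
        x ∈ presentedPiece T i ∧ y ∈ presentedPiece T j ∧ ⁅x, y⁆ = presentedMk T a := by
      intro m a hm he
      cases hm with
      | of s => omega
      | @lie p q a b ha' hb =>
        exact ⟨p, q, presentedMk T a, presentedMk T b, ha'.pos, hb.pos, he,
          ⟨a, Submodule.subset_span ha', rfl⟩, ⟨b, Submodule.subset_span hb, rfl⟩,
          (LieHom.map_lie _ _ _).symm⟩
    exact key _ _ ha rfl

end Presented

end LieDepth

/-! ### Scaling automorphism and Euler derivation -/

namespace LieDepth

namespace LieGrading

variable {L : Type u} [LieRing L] [LieAlgebra ℚ L] (G : LieGrading L)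

instance : DirectSum.Decomposition G.W := G.dec

/-- The automorphism that multiplies by `2 ^ n` in degree `n`. -/
noncomputable def scaling : L →ₗ⁅ℚ⁆ L :=
  { diag G.W (fun n => 2 ^ n) with
    map_lie' := by
      intro x y
      simp only [AddHom.toFun_eq_coe, LinearMap.coe_toAddHom]
      induction x using DirectSum.Decomposition.inductionOn G.W with
      | zero => simp
      | @homogeneous i x =>
        induction y using DirectSum.Decomposition.inductionOn G.W with
        | zero => simp
        | @homogeneous j y =>
          rw [diag_of_mem G.W (G.lie_mem x.2 y.2), diag_of_mem G.W x.2, diag_of_mem G.W y.2,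
            smul_lie, lie_smul, smul_smul, pow_add]
        | add m m' h h' => rw [lie_add, map_add, h, h', map_add, lie_add]
      | add m m' h h' => rw [add_lie, map_add, h, h', map_add, add_lie] }

theorem scaling_of_mem {n : ℕ} {x : L} (hx : x ∈ G.W n) : G.scaling x = (2 : ℚ) ^ n • x :=
  diag_of_mem G.W hx

/-- The derivation that multiplies by `n` in degree `n`. -/
noncomputable def euler : L →ₗ[ℚ] L := diag G.W (fun n => n)

theorem euler_of_mem {n : ℕ} {x : L} (hx : x ∈ G.W n) : G.euler x = (n : ℚ) • x :=
  diag_of_mem G.W hx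

theorem euler_lie (x y : L) : G.euler ⁅x, y⁆ = ⁅G.euler x, y⁆ + ⁅x, G.euler y⁆ := by
  induction x using DirectSum.Decomposition.inductionOn G.W with
  | zero => simp
  | @homogeneous i x =>
    induction y using DirectSum.Decomposition.inductionOn G.W with
    | zero => simp
    | @homogeneous j y =>
      rw [G.euler_of_mem (G.lie_mem x.2 y.2), G.euler_of_mem x.2, G.euler_of_mem y.2,
        smul_lie, lie_smul, ← add_smul, Nat.cast_add]
    | add m m' h h' => rw [lie_add, map_add, h, h', map_add, lie_add, lie_add]; abel
  | add m m' h h' => rw [add_lie, map_add, h, h', map_add, add_lie, add_lie]; abel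

end LieGrading

/-! ### The grading of the enveloping algebra -/

section Enveloping

attribute [local instance] LieRing.ofAssociativeRing

variable {L : Type u} [LieRing L] [LieAlgebra ℚ L]

local notation "U" => UniversalEnvelopingAlgebra ℚ

theorem env_induction {P : U L → Prop} (one : P 1) (smul : ∀ (q : ℚ) u, P u → P (q • u))
    (add : ∀ u v, P u → P v → P (u + v))
    (mul : ∀ u x, P u → P (u * UniversalEnvelopingAlgebra.ι ℚ x)) (u : U L) : P u := by
  -- The left factor `u` is kept arbitrary so that a product in the tensor algebra can be absorbed
  -- one factor at a time.
  have key : ∀ (t : TensorAlgebra ℚ L) (u : U L), P u →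
      P (u * UniversalEnvelopingAlgebra.mkAlgHom ℚ L t) := by
    intro t
    induction t using TensorAlgebra.induction with
    | algebraMap r =>
      intro u hu
      rw [AlgHom.commutes, ← Algebra.commutes, ← Algebra.smul_def]
      exact smul r u hu
    | ι x => exact fun u hu => mul u x hu
    | mul a b ha hb =>
      intro u hu
      rw [map_mul, ← mul_assoc]
      exact hb _ (ha _ hu)
    | add a b ha hb =>
      intro u hu
      rw [map_add, mul_add]
      exact add _ _ (ha _ hu) (hb _ hu)
  obtain ⟨t, rfl⟩ : ∃ t, UniversalEnvelopingAlgebra.mkAlgHom ℚ L t = u :=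
    Quot.mk_surjective u
  have := key t 1 one
  rwa [one_mul] at this


namespace LieGrading

variable (G : LieGrading L)

/-- The span of the words of length `n` in the elements of degree one. -/
noncomputable def envPiece (n : ℕ) : Submodule ℚ (U L) :=
  (G.W 1).map ((UniversalEnvelopingAlgebra.ι ℚ : L →ₗ⁅ℚ⁆ U L) : L →ₗ[ℚ] U L) ^ n

instance : SetLike.GradedMonoid G.envPiece :=
  inferInstanceAs (SetLike.GradedMonoid (_ ^ · : ℕ → Submodule ℚ (U L)))

/-- In weight at least two, `x` is a combination of brackets of elements of smaller weight, and a
bracket becomes a commutator in `UL`. -/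
theorem ι_mem_envPiece {r : ℕ} {x : L} (hx : x ∈ G.W r) :
    UniversalEnvelopingAlgebra.ι ℚ x ∈ G.envPiece r := by
  induction r using Nat.strong_induction_on generalizing x with
  | _ r ih =>
    match r with
    | 0 =>
      rw [G.zero, Submodule.mem_bot] at hx
      subst hx
      simp
    | 1 =>
      rw [envPiece, pow_one]
      exact ⟨x, hx, rfl⟩
    | n + 2 =>
      have hspan := G.generated n hx
      clear hx
      induction hspan using Submodule.span_induction with
      | mem z hz =>
        obtain ⟨i, j, x, y, hi, hj, hij, hx, hy, rfl⟩ := hz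
        rw [LieHom.map_lie, LieRing.of_associative_ring_bracket, ← hij]
        have h1 := ih i (by omega) hx
        have h2 := ih j (by omega) hy
        exact sub_mem (SetLike.mul_mem_graded h1 h2)
          (by rw [add_comm i j]; exact SetLike.mul_mem_graded h2 h1)
      | zero => simp
      | add b c _ _ hb hc => rw [map_add]; exact add_mem hb hc
      | smul t b _ hb => rw [map_smul]; exact Submodule.smul_mem _ _ hb

theorem iSup_envPiece : ⨆ n, G.envPiece n = ⊤ := by
  suffices h : ∀ u, u ∈ ⨆ n, G.envPiece n from eq_top_iff.2 fun u _ => h u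
  intro u
  induction u using env_induction with
  | one => exact Submodule.mem_iSup_of_mem 0 SetLike.GradedOne.one_mem
  | smul q u hu => exact Submodule.smul_mem _ _ hu
  | add u v hu hv => exact add_mem hu hv
  | mul u x hu =>
    induction x using DirectSum.Decomposition.inductionOn G.W with
    | zero => simp
    | @homogeneous i x =>
      induction hu using Submodule.iSup_induction' with
      | mem j u hu =>
        exact Submodule.mem_iSup_of_mem (j + i)
          (SetLike.mul_mem_graded hu (G.ι_mem_envPiece x.2))
      | zero => simp
      | add u v _ _ h1 h2 => rw [add_mul]; exact add_mem h1 h2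
    | add m m' h h' => rw [map_add, mul_add]; exact add_mem h h'

/-- The automorphism of the enveloping algebra that multiplies by `2 ^ n` in degree `n`. -/
noncomputable def envScaling : U L →ₐ[ℚ] U L :=
  UniversalEnvelopingAlgebra.lift ℚ ((UniversalEnvelopingAlgebra.ι ℚ).comp G.scaling)

theorem envScaling_of_mem {n : ℕ} {u : U L} (hu : u ∈ G.envPiece n) :
    G.envScaling u = (2 : ℚ) ^ n • u := by
  rw [envPiece] at hu
  induction hu using Submodule.pow_induction_on_left' with
  | algebraMap r => simp
  | add u v n _ _ h1 h2 => rw [map_add, h1, h2, smul_add]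
  | mem_mul m hm n u _ hu =>
    obtain ⟨x, hx, rfl⟩ := hm
    rw [map_mul, hu]
    have : G.envScaling (UniversalEnvelopingAlgebra.ι ℚ x) =
        (2 : ℚ) • UniversalEnvelopingAlgebra.ι ℚ x := by
      rw [envScaling, UniversalEnvelopingAlgebra.lift_ι_apply, LieHom.comp_apply,
        G.scaling_of_mem hx, pow_one, map_smul]
    change G.envScaling (UniversalEnvelopingAlgebra.ι ℚ x) * _ = _ • (UniversalEnvelopingAlgebra.ι ℚ x * u)
    rw [this, smul_mul_smul_comm, pow_succ']

noncomputable instance : GradedAlgebra G.envPiece where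
  toDecomposition := decompositionOfEigenvalues _ G.envScaling.toLinearMap (fun n => 2 ^ n)
    (pow_right_injective₀ two_pos (by norm_num)) (fun _ _ h => G.envScaling_of_mem h)
    G.iSup_envPiece

theorem envAug_ι (x : L) : envAug L (UniversalEnvelopingAlgebra.ι ℚ x) = 0 := by
  rw [envAug, UniversalEnvelopingAlgebra.lift_ι_apply]
  rfl

theorem envPiece_one_le : G.envPiece 1 ≤ (augIdeal (envAug L)).restrictScalars ℚ := by
  rw [envPiece, pow_one]
  rintro _ ⟨x, _, rfl⟩
  exact envAug_ι x

theorem mem_pow_of_mem_envPiece {n : ℕ} {u : U L} (hu : u ∈ G.envPiece n) :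
    u ∈ augIdeal (envAug L) ^ n := by
  rw [envPiece] at hu
  induction hu using Submodule.pow_induction_on_right' with
  | algebraMap r =>
    rw [Submodule.pow_zero, Ideal.one_eq_top]
    exact Submodule.mem_top
  | add u v n _ _ h1 h2 => exact add_mem h1 h2
  | mul_mem n u _ hu m hm =>
    rw [Nat.succ_eq_add_one, Submodule.pow_succ]
    refine Submodule.mul_mem_mul hu (G.envPiece_one_le ?_)
    rwa [envPiece, pow_one]

/-- Components of positive degree lie in the augmentation ideal, so `u` and its degree zero
component have the same augmentation. The latter is a scalar, which the augmentation detects. -/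
theorem decompose_zero_eq_zero {u : U L} (hu : envAug L u = 0) :
    (DirectSum.decompose G.envPiece u 0 : U L) = 0 := by
  classical
  have h1 : ∀ n ≠ 0, envAug L (DirectSum.decompose G.envPiece u n) = 0 := by
    intro n hn
    have := G.mem_pow_of_mem_envPiece (DirectSum.decompose G.envPiece u n).2
    have := Ideal.pow_le_self hn this
    exact this
  have h2 : (DirectSum.decompose G.envPiece u 0 : U L) ∈ (1 : Submodule ℚ (U L)) :=
    (DirectSum.decompose G.envPiece u 0).2
  rw [Submodule.mem_one] at h2
  obtain ⟨q, hq⟩ := h2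
  have h3 : envAug L u = envAug L (DirectSum.decompose G.envPiece u 0) := by
    conv_lhs => rw [← DirectSum.sum_support_decompose G.envPiece u]
    rw [map_sum]
    by_cases h0 : 0 ∈ (DirectSum.decompose G.envPiece u).support
    · exact Finset.sum_eq_single_of_mem 0 h0 fun n _ hn => h1 n hn
    · rw [Finset.sum_eq_zero fun n hn => h1 n fun h => h0 (h ▸ hn)]
      rw [DFinsupp.notMem_support_iff] at h0
      simp [h0]
  rw [hu, ← hq, AlgHom.commutes] at h3
  have : q = 0 := h3.symm
  rw [← hq, this, map_zero]

/-- Each factor from the augmentation ideal starts in degree one, so a product of `n` of them starts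
in degree `n`. Conversely, a piece of degree `i ≥ n` is spanned by words of `i` letters from that
ideal; here generation in weight one is essential. -/
theorem isConnectedGrading : IsConnectedGrading (envAug L) G.envPiece := by
  classical
  intro n u
  constructor
  · intro hu
    induction n generalizing u with
    | zero => intro m hm; omega
    | succ n ih =>
      rw [Submodule.pow_succ] at hu
      refine Submodule.mul_induction_on hu ?_ ?_
      · intro a ha b hb m hm
        rw [DirectSum.decompose_mul, DirectSum.coe_mul_apply]
        refine Finset.sum_eq_zero fun ij hij => ?_
        simp only [Finset.mem_filter] at hij
        by_cases hi : ij.1 < n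
        · rw [ih a ha _ hi, zero_mul]
        · rw [show ij.2 = 0 by omega, G.decompose_zero_eq_zero hb, mul_zero]
      · intro a b ha hb m hm
        simp [ha m hm, hb m hm]
  · intro h
    rw [← DirectSum.sum_support_decompose G.envPiece u]
    refine sum_mem fun i hi => ?_
    have hin : n ≤ i := by
      by_contra hlt
      refine DFinsupp.mem_support_iff.1 hi (Subtype.ext ?_)
      exact h i (by omega)
    exact Ideal.pow_le_pow_right hin (G.mem_pow_of_mem_envPiece (SetLike.coe_mem _))

end LieGrading

end Enveloping

end LieDepth

/-! ### The bigrading of the exterior algebra -/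

namespace LieDepth

namespace LieGrading

variable {L : Type u} [LieRing L] [LieAlgebra ℚ L] (G : LieGrading L)

/-- Exterior products of `p` homogeneous elements of total weight `w`. -/
inductive IsMonomial : ℕ → ℕ → ExteriorAlgebra ℚ L → Prop
  | one : IsMonomial 0 0 1
  | wedge {p w r : ℕ} {x : L} {m : ExteriorAlgebra ℚ L} :
      x ∈ G.W r → IsMonomial p w m → IsMonomial (p + 1) (w + r) (wedge x m)

/-- The part of the exterior algebra of exterior degree `i.1` and of weight `i.2`. -/
def extPiece (i : ℕ × ℕ) : Submodule ℚ (ExteriorAlgebra ℚ L) :=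
  Submodule.span ℚ {m | G.IsMonomial i.1 i.2 m}

variable {G}

theorem extPiece_induction {P : ℕ → ℕ → ExteriorAlgebra ℚ L → Prop} (zero : ∀ p w, P p w 0)
    (add : ∀ p w u v, P p w u → P p w v → P p w (u + v))
    (smul : ∀ p w (q : ℚ) u, P p w u → P p w (q • u)) (one : P 0 0 1)
    (wedge : ∀ p w r x m, x ∈ G.W r → m ∈ G.extPiece (p, w) → P p w m →
      P (p + 1) (w + r) (wedge x m)) {p w : ℕ} {m : ExteriorAlgebra ℚ L}
    (hm : m ∈ G.extPiece (p, w)) : P p w m := by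
  induction hm using Submodule.span_induction with
  | mem m hm =>
    have key : ∀ p w, G.IsMonomial p w m → m ∈ G.extPiece (p, w) ∧ P p w m := by
      clear hm
      intro p w h
      induction h with
      | one => exact ⟨Submodule.subset_span IsMonomial.one, one⟩
      | wedge hx hm ih => exact ⟨Submodule.subset_span (IsMonomial.wedge hx hm),
          wedge _ _ _ _ _ hx ih.1 ih.2⟩
    exact (key p w hm).2
  | zero => exact zero _ _
  | add u v _ _ hu hv => exact add _ _ _ _ hu hv
  | smul q u _ hu => exact smul _ _ _ _ hu

theorem one_mem_extPiece : 1 ∈ G.extPiece (0, 0) := Submodule.subset_span IsMonomial.one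

theorem wedge_mem_extPiece {p w r : ℕ} {x : L} {m : ExteriorAlgebra ℚ L} (hx : x ∈ G.W r)
    (hm : m ∈ G.extPiece (p, w)) : wedge x m ∈ G.extPiece (p + 1, w + r) := by
  induction hm using Submodule.span_induction with
  | mem m hm => exact Submodule.subset_span (IsMonomial.wedge hx hm)
  | zero => simp [wedge]
  | add u v _ _ hu hv => rw [wedge, mul_add]; exact add_mem hu hv
  | smul q u _ hu => rw [wedge, mul_smul_comm]; exact Submodule.smul_mem _ _ hu

variable (G) in
theorem iSup_extPiece : ⨆ i, G.extPiece i = ⊤ := by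
  suffices h : ∀ m, m ∈ ⨆ i, G.extPiece i from eq_top_iff.2 fun m _ => h m
  intro m
  induction m using exterior_induction with
  | algebraMap r =>
    rw [Algebra.algebraMap_eq_smul_one]
    exact Submodule.smul_mem _ _ (Submodule.mem_iSup_of_mem (0, 0) one_mem_extPiece)
  | add v w hv hw => exact add_mem hv hw
  | wedge x m hm =>
    induction x using DirectSum.Decomposition.inductionOn G.W with
    | zero => simp [wedge]
    | @homogeneous r x =>
      induction hm using Submodule.iSup_induction' with
      | mem i m hm =>
        exact Submodule.mem_iSup_of_mem (i.1 + 1, i.2 + r) (wedge_mem_extPiece x.2 hm)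
      | zero => simp [wedge]
      | add u v _ _ h1 h2 => rw [wedge, mul_add]; exact add_mem h1 h2
    | add x y hx hy => rw [wedge, map_add, add_mul]; exact add_mem hx hy

variable (G) in
/-- The automorphism of the exterior algebra that multiplies by `3 ^ p * 2 ^ w` in exterior degree
`p` and weight `w`. -/
noncomputable def extScaling : ExteriorAlgebra ℚ L →ₐ[ℚ] ExteriorAlgebra ℚ L :=
  ExteriorAlgebra.map ((3 : ℚ) • (G.scaling : L →ₗ[ℚ] L))

theorem extScaling_of_mem {p w : ℕ} {m : ExteriorAlgebra ℚ L} (hm : m ∈ G.extPiece (p, w)) :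
    G.extScaling m = ((3 : ℚ) ^ p * 2 ^ w) • m := by
  refine extPiece_induction (P := fun p w m => G.extScaling m = ((3 : ℚ) ^ p * 2 ^ w) • m)
    (by simp) (fun p w u v hu hv => by rw [map_add, hu, hv, smul_add])
    (fun p w q u hu => by rw [map_smul, hu, smul_comm]) (by simp) (fun p w r x m hx _ hm => ?_) hm
  rw [wedge, map_mul, hm]
  have : G.extScaling (ExteriorAlgebra.ι ℚ x) = ((3 : ℚ) * 2 ^ r) • ExteriorAlgebra.ι ℚ x := by
    rw [extScaling, ExteriorAlgebra.map_apply_ι, LinearMap.smul_apply, LieHom.coe_toLinearMap,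
      G.scaling_of_mem hx, smul_smul, map_smul]
  rw [this, smul_mul_smul_comm]
  congr 1
  ring

/-- Unique factorization lets one scaling operator separate exterior degree and weight
simultaneously. -/
theorem three_pow_mul_two_pow_injective :
    Function.Injective fun i : ℕ × ℕ => (3 : ℚ) ^ i.1 * 2 ^ i.2 := by
  rintro ⟨a, b⟩ ⟨c, d⟩ h
  dsimp only at h
  have h' : 3 ^ a * 2 ^ b = 3 ^ c * 2 ^ d := by exact_mod_cast h
  have h2 := congrArg (padicValNat 2) h'
  have h3 := congrArg (padicValNat 3) h'
  have h4 : padicValNat 3 2 = 0 := padicValNat.eq_zero_of_not_dvd (by norm_num)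
  have h5 : padicValNat 2 3 = 0 := padicValNat.eq_zero_of_not_dvd (by norm_num)
  rw [padicValNat.mul (by positivity) (by positivity), padicValNat.mul (by positivity)
    (by positivity)] at h2 h3
  simp only [padicValNat.pow, h4, h5, padicValNat.self (p := 2) (by norm_num),
    padicValNat.self (p := 3) (by norm_num)] at h2 h3
  ext <;> simp <;> omega

noncomputable instance : DirectSum.Decomposition G.extPiece :=
  decompositionOfEigenvalues _ G.extScaling.toLinearMap _ three_pow_mul_two_pow_injective
    (fun _ _ h => extScaling_of_mem h) G.iSup_extPiece

theorem adAction_mem_extPiece {r : ℕ} {x : L} (hx : x ∈ G.W r) {p w : ℕ}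
    {m : ExteriorAlgebra ℚ L} (hm : m ∈ G.extPiece (p, w)) :
    adAction x m ∈ G.extPiece (p, w + r) := by
  refine extPiece_induction (P := fun p w m => adAction x m ∈ G.extPiece (p, w + r))
    (by simp) (fun p w u v hu hv => by rw [map_add]; exact add_mem hu hv)
    (fun p w q u hu => by rw [map_smul]; exact Submodule.smul_mem _ _ hu)
    (by rw [← map_one (algebraMap ℚ _), adAction_algebraMap]; exact zero_mem _)
    (fun p w s y m hy hm h => ?_) hm
  rw [adAction_wedge]
  refine add_mem ?_ ?_
  · rw [add_assoc, add_comm s r]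
    exact wedge_mem_extPiece (G.lie_mem hx hy) hm
  · rw [add_right_comm]
    exact wedge_mem_extPiece hy h

theorem ceDifferential_eq_zero_of_mem {w : ℕ} {m : ExteriorAlgebra ℚ L}
    (hm : m ∈ G.extPiece (0, w)) : ceDifferential L m = 0 := by
  refine extPiece_induction (P := fun p w m => p = 0 → ceDifferential L m = 0)
    (by simp) (fun p w u v hu hv h => by rw [map_add, hu h, hv h, add_zero])
    (fun p w q u hu h => by rw [map_smul, hu h, smul_zero])
    (fun _ => by rw [← map_one (algebraMap ℚ _), ceDifferential_algebraMap])
    (fun p w s y m hy hm _ h => by omega) hm rfl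

theorem ceDifferential_mem_extPiece {p w : ℕ} {m : ExteriorAlgebra ℚ L}
    (hm : m ∈ G.extPiece (p + 1, w)) : ceDifferential L m ∈ G.extPiece (p, w) := by
  refine extPiece_induction
    (P := fun q w m => ∀ p, q = p + 1 → ceDifferential L m ∈ G.extPiece (p, w))
    (by simp) (fun p w u v hu hv p h => by rw [map_add]; exact add_mem (hu p h) (hv p h))
    (fun p w q u hu p h => by rw [map_smul]; exact Submodule.smul_mem _ _ (hu p h))
    (fun p h => by omega)
    (fun q w s y m hy hm ih p h => ?_) hm p rfl
  obtain rfl : q = p := by omega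
  rw [ceDifferential_wedge]
  refine sub_mem (neg_mem (adAction_mem_extPiece hy hm)) ?_
  cases q with
  | zero => simp [ceDifferential_eq_zero_of_mem hm, wedge]
  | succ q => exact wedge_mem_extPiece hy (ih q rfl)

/-- Each of the `p` factors has weight at least one, as `W 0 = ⊥`. -/
theorem eq_zero_of_mem_extPiece_of_lt {p w : ℕ} (hpw : w < p) {m : ExteriorAlgebra ℚ L}
    (hm : m ∈ G.extPiece (p, w)) : m = 0 := by
  refine extPiece_induction (P := fun p w m => w < p → m = 0)
    (by simp) (fun p w u v hu hv h => by rw [hu h, hv h, add_zero])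
    (fun p w q u hu h => by rw [hu h, smul_zero]) (by simp)
    (fun p w r x m hx _ hm h => ?_) hm hpw
  cases r with
  | zero =>
    rw [G.zero, Submodule.mem_bot] at hx
    simp [hx, wedge]
  | succ r => rw [hm (by omega), wedge, mul_zero]

theorem exists_algebraMap_of_mem_extPiece {w : ℕ} {m : ExteriorAlgebra ℚ L}
    (hm : m ∈ G.extPiece (0, w)) : ∃ q : ℚ, (q ≠ 0 → w = 0) ∧ algebraMap ℚ _ q = m := by
  refine extPiece_induction
    (P := fun p w m => p = 0 → ∃ q : ℚ, (q ≠ 0 → w = 0) ∧ algebraMap ℚ _ q = m)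
    (fun _ _ _ => ⟨0, by simp⟩) (fun p w u v hu hv h => ?_) (fun p w q u hu h => ?_)
    (fun _ => ⟨1, by simp⟩) (fun p w r x m hx _ hm h => by omega) hm rfl
  · obtain ⟨q, hq, rfl⟩ := hu h
    obtain ⟨q', hq', rfl⟩ := hv h
    refine ⟨q + q', fun h0 => ?_, map_add _ _ _⟩
    by_cases h1 : q = 0
    · exact hq' fun h2 => h0 (by rw [h1, h2, add_zero])
    · exact hq h1
  · obtain ⟨q', hq', rfl⟩ := hu h
    exact ⟨q * q', fun h0 => hq' (right_ne_zero_of_mul h0), by rw [map_mul, Algebra.smul_def]⟩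

end LieGrading

end LieDepth

/-! ### Consequences of finite dimensional homology -/

namespace LieDepth

namespace LieGrading

variable {L : Type u} [LieRing L] [LieAlgebra ℚ L] (G : LieGrading L)

/-- The projection onto the part of exterior degree `i.1` and weight `i.2`. -/
noncomputable def extProj (i : ℕ × ℕ) : ExteriorAlgebra ℚ L →ₗ[ℚ] ExteriorAlgebra ℚ L :=
  diag G.extPiece (Pi.single i 1)

theorem ceDifferential_extProj (p w : ℕ) (m : ExteriorAlgebra ℚ L) :
    ceDifferential L (G.extProj (p + 1, w) m) = G.extProj (p, w) (ceDifferential L m) := by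
  -- The truncated subtraction at exterior degree `0` is harmless because `∂` vanishes there.
  refine diag_comm G.extPiece G.extPiece (σ := fun i => (i.1 - 1, i.2)) ?_ m
  rintro ⟨q, v⟩ x hx
  cases q with
  | zero => exact Or.inl (ceDifferential_eq_zero_of_mem hx)
  | succ q =>
    refine Or.inr ⟨ceDifferential_mem_extPiece hx, ?_⟩
    simp [Pi.single_apply]

/-- Each vector involves finitely many weights, so finitely many generators have a common bound. -/
theorem exists_extProj_eq_zero (F : Submodule ℚ (ExteriorAlgebra ℚ L)) (hF : F.FG) :
    ∃ N, ∀ v ∈ F, ∀ p, ∀ w > N, G.extProj (p, w) v = 0 := by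
  have h1 : ∀ v, ∃ N, ∀ p, ∀ w > N, G.extProj (p, w) v = 0 := by
    intro v
    induction v using DirectSum.Decomposition.inductionOn G.extPiece with
    | zero => exact ⟨0, by simp⟩
    | @homogeneous i m =>
      refine ⟨i.2, fun p w hw => diag_single_of_mem_ne G.extPiece m.2 fun h => ?_⟩
      rw [h] at hw
      exact lt_irrefl _ hw
    | add m m' h h' =>
      obtain ⟨N, hN⟩ := h
      obtain ⟨N', hN'⟩ := h'
      refine ⟨max N N', fun p w hw => ?_⟩
      rw [map_add, hN p w (lt_of_le_of_lt (le_max_left _ _) hw),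
        hN' p w (lt_of_le_of_lt (le_max_right _ _) hw), add_zero]
  choose N hN using h1
  obtain ⟨s, rfl⟩ := hF
  refine ⟨s.sup N, fun v hv p w hw => ?_⟩
  induction hv using Submodule.span_induction with
  | mem v hv => exact hN v p w (lt_of_le_of_lt (Finset.le_sup hv) hw)
  | zero => simp
  | add u v _ _ hu hv => rw [map_add, hu, hv, add_zero]
  | smul q u _ hu => rw [map_smul, hu, smul_zero]

/-- In high weights the Chevalley–Eilenberg complex is exact if its homology is finite
dimensional. -/
theorem exists_weight_bound [FiniteDimensional ℚ (CEHomology L)] :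
    ∃ N, ∀ p, ∀ w > N, ∀ z ∈ G.extPiece (p, w), ceDifferential L z = 0 →
      ∃ y ∈ G.extPiece (p + 1, w), ceDifferential L y = z := by
  let B := (LinearMap.range (ceDifferential L)).submoduleOf (LinearMap.ker (ceDifferential L))
  -- A linear choice of cycles representing the homology has finite dimensional image, hence bounded
  -- weights. A cycle `z` of higher weight differs from its representative by a boundary `∂ y`, and
  -- projecting this relation to the bidegree of `z` kills the representative.
  obtain ⟨σ, hσ⟩ := B.mkQ.exists_rightInverse_of_surjective B.range_mkQ
  let f : CEHomology L →ₗ[ℚ] ExteriorAlgebra ℚ L :=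
    (LinearMap.ker (ceDifferential L)).subtype ∘ₗ σ
  obtain ⟨N, hN⟩ := G.exists_extProj_eq_zero (LinearMap.range f)
    (by rw [LinearMap.range_eq_map]; exact Submodule.FG.map _ Module.Finite.fg_top)
  refine ⟨N, fun p w hw z hz hdz => ?_⟩
  have h1 : (⟨z, hdz⟩ : LinearMap.ker (ceDifferential L)) - σ (B.mkQ ⟨z, hdz⟩) ∈ B := by
    refine (Submodule.Quotient.mk_eq_zero B).1 (((B.mkQ).map_sub _ _).trans (sub_eq_zero.2 ?_))
    exact (LinearMap.congr_fun hσ (B.mkQ ⟨z, hdz⟩)).symm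
  obtain ⟨y, hy⟩ := h1
  change ceDifferential L y = z - f (B.mkQ ⟨z, hdz⟩) at hy
  refine ⟨G.extProj (p + 1, w) y, diag_single_mem _ _ _, ?_⟩
  rw [ceDifferential_extProj, hy, map_sub, hN _ (LinearMap.mem_range_self _ _) p w hw, sub_zero]
  exact diag_single_of_mem G.extPiece hz

/-- In the weights in which the Chevalley–Eilenberg complex is exact it is split. -/
theorem exists_splitting {p w : ℕ} (h : ∀ z ∈ G.extPiece (p, w), ceDifferential L z = 0 →
      ∃ y ∈ G.extPiece (p + 1, w), ceDifferential L y = z) :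
    ∃ s t : ExteriorAlgebra ℚ L →ₗ[ℚ] ExteriorAlgebra ℚ L,
      (∀ v, s v ∈ G.extPiece (p + 1, w)) ∧
      ∀ v ∈ G.extPiece (p, w), ceDifferential L (s v) + t (ceDifferential L v) = v := by
  obtain ⟨s₀, hs₀⟩ := (ceDifferential L).rangeRestrict.exists_rightInverse_of_surjective
    (LinearMap.range_rangeRestrict _)
  obtain ⟨s₁, hs₁⟩ := s₀.exists_extend
  have hs : ∀ b, ceDifferential L (s₁ (ceDifferential L b)) = ceDifferential L b := fun b => by
    have h1 := LinearMap.congr_fun hs₁ ⟨_, LinearMap.mem_range_self (ceDifferential L) b⟩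
    have h2 := LinearMap.congr_fun hs₀ ⟨_, LinearMap.mem_range_self (ceDifferential L) b⟩
    exact (congrArg (ceDifferential L) h1).trans (congrArg Subtype.val h2)
  let t₀ := G.extProj (p, w) ∘ₗ s₁
  refine ⟨G.extProj (p + 1, w) ∘ₗ s₁,
    -- Writing `s` for the first map, `v - t₀ ∂v` is a cycle, so `∂ s` fixes it by exactness.
    -- Expanding `∂ s (v - t₀ ∂v) = v - t₀ ∂v` gives `t = t₀ - ∂ s t₀`.
    t₀ - ceDifferential L ∘ₗ G.extProj (p + 1, w) ∘ₗ s₁ ∘ₗ t₀,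
    fun v => diag_single_mem _ _ _, fun v hv => ?_⟩
  have hv' : v - t₀ (ceDifferential L v) ∈ G.extPiece (p, w) :=
    sub_mem hv (diag_single_mem _ _ _)
  have h0 : ceDifferential L (v - t₀ (ceDifferential L v)) = 0 := by
    cases p with
    | zero => exact ceDifferential_eq_zero_of_mem hv'
    | succ p =>
      rw [map_sub, LinearMap.comp_apply, ceDifferential_extProj, hs, ← ceDifferential_extProj]
      rw [extProj, diag_single_of_mem G.extPiece hv, sub_self]
  obtain ⟨y, hy, hy'⟩ := h _ hv' h0
  have h1 : ceDifferential L (G.extProj (p + 1, w) (s₁ (v - t₀ (ceDifferential L v)))) =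
      v - t₀ (ceDifferential L v) := by
    rw [ceDifferential_extProj, ← hy', hs, hy']
    exact diag_single_of_mem G.extPiece hv'
  simp only [LinearMap.comp_apply, LinearMap.sub_apply, map_sub] at h1 ⊢
  rw [← sub_eq_zero] at h1 ⊢
  rw [← h1]
  abel

theorem ceDifferential_ι (x : L) : ceDifferential L (ExteriorAlgebra.ι ℚ x) = 0 := by
  have := ceDifferential_wedge x 1
  rw [← map_one (algebraMap ℚ _), adAction_algebraMap, ceDifferential_algebraMap, map_one] at this
  simpa [wedge] using this

/-- Elements of `W 1` are cycles, and none but zero is a boundary since exterior degree two has no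
part of weight one. Hence `W 1` embeds in the homology. -/
theorem finiteDimensional_piece_one [FiniteDimensional ℚ (CEHomology L)] :
    FiniteDimensional ℚ (G.W 1) := by
  let B := (LinearMap.range (ceDifferential L)).submoduleOf (LinearMap.ker (ceDifferential L))
  let f : G.W 1 →ₗ[ℚ] CEHomology L := B.mkQ ∘ₗ
    LinearMap.codRestrict (LinearMap.ker (ceDifferential L))
      (ExteriorAlgebra.ι ℚ ∘ₗ (G.W 1).subtype) (fun x => ceDifferential_ι x.1)
  refine FiniteDimensional.of_injective f ((injective_iff_map_eq_zero f).2 fun x hx => ?_)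
  obtain ⟨y, hy⟩ : _ ∈ B := (Submodule.Quotient.mk_eq_zero B).1 hx
  change ceDifferential L y = ExteriorAlgebra.ι ℚ (x : L) at hy
  have h1 : ExteriorAlgebra.ι ℚ (x : L) ∈ G.extPiece (1, 1) := by
    have := wedge_mem_extPiece x.2 (one_mem_extPiece (G := G))
    rwa [wedge, mul_one] at this
  have h2 := G.ceDifferential_extProj 1 1 y
  have h3 : G.extProj (1 + 1, 1) y = 0 :=
    eq_zero_of_mem_extPiece_of_lt (by norm_num) (diag_single_mem G.extPiece (1 + 1, 1) y)
  rw [hy, h3, map_zero, extProj,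
    diag_single_of_mem G.extPiece h1] at h2
  exact Subtype.ext (ExteriorAlgebra.ι_leftInverse.injective (h2.symm.trans (map_zero _).symm))

theorem fg_piece (h1 : (G.W 1).FG) (n : ℕ) : (G.W n).FG := by
  induction n using Nat.strong_induction_on with
  | _ n ih =>
    match n with
    | 0 => rw [G.zero]; exact Submodule.fg_bot
    | 1 => exact h1
    | n + 2 =>
      classical
      let b : L →ₗ[ℚ] L →ₗ[ℚ] L := LinearMap.mk₂ ℚ (fun x y => ⁅x, y⁆) add_lie smul_lie lie_add
        lie_smul
      let F : Submodule ℚ L := (((Finset.HasAntidiagonal.antidiagonal (n + 2)).filter fun i => 0 < i.1 ∧ 0 < i.2).sup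
        fun i => Submodule.map₂ b (G.W i.1) (G.W i.2))
      have hF : F.FG := by
        refine Submodule.fg_finset_sup _ _ fun i hi => ?_
        simp only [Finset.mem_filter, Finset.HasAntidiagonal.mem_antidiagonal] at hi
        exact Submodule.FG.map₂ _ (ih _ (by omega)) (ih _ (by omega))
      refine Submodule.FG.of_le hF ((G.generated n).trans (Submodule.span_le.2 ?_))
      rintro _ ⟨i, j, x, y, hi, hj, hij, hx, hy, rfl⟩
      refine Finset.le_sup (f := fun i : ℕ × ℕ => Submodule.map₂ b (G.W i.1) (G.W i.2))
        (b := (i, j)) (by simp [hi, hj, hij]) ?_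
      exact Submodule.apply_mem_map₂ b hx hy

theorem fg_extPiece (h1 : (G.W 1).FG) (p w : ℕ) : (G.extPiece (p, w)).FG := by
  induction p generalizing w with
  | zero =>
    refine Submodule.FG.of_le (Submodule.fg_span_singleton (1 : ExteriorAlgebra ℚ L)) ?_
    intro m hm
    obtain ⟨q, -, rfl⟩ := exists_algebraMap_of_mem_extPiece hm
    rw [Algebra.algebraMap_eq_smul_one]
    exact Submodule.smul_mem _ _ (Submodule.mem_span_singleton_self _)
  | succ p ih =>
    let b : L →ₗ[ℚ] ExteriorAlgebra ℚ L →ₗ[ℚ] ExteriorAlgebra ℚ L :=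
      LinearMap.mul ℚ _ ∘ₗ ExteriorAlgebra.ι ℚ
    let F : Submodule ℚ (ExteriorAlgebra ℚ L) := (Finset.HasAntidiagonal.antidiagonal w).sup
      fun i => Submodule.map₂ b (G.W i.2) (G.extPiece (p, i.1))
    have hF : F.FG := Submodule.fg_finset_sup _ _ fun i _ =>
      Submodule.FG.map₂ _ (G.fg_piece h1 _) (ih _)
    refine Submodule.FG.of_le hF (Submodule.span_le.2 ?_)
    intro m hm
    obtain ⟨q, hq⟩ : ∃ q, q = p + 1 := ⟨_, rfl⟩
    change G.IsMonomial (p + 1) w m at hm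
    rw [← hq] at hm
    cases hm with
    | one => omega
    | @wedge p' w' r x m hx hm =>
      obtain rfl : p' = p := by omega
      refine Finset.le_sup
        (f := fun i : ℕ × ℕ => Submodule.map₂ b (G.W i.2) (G.extPiece (p', i.1)))
        (b := (w', r)) (by simp) ?_
      exact Submodule.apply_mem_map₂ b hx (Submodule.subset_span hm)

end LieGrading

end LieDepth

/-! ### The Koszul complex and its differential -/

namespace LieDepth
open scoped TensorProduct

section Koszul

attribute [local instance] LieRing.ofAssociativeRing

variable {L : Type u} [LieRing L] [LieAlgebra ℚ L]

local notation "U" => UniversalEnvelopingAlgebra ℚ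

theorem adAction_mul (x : L) (v w : ExteriorAlgebra ℚ L) :
    adAction x (v * w) = adAction x v * w + v * adAction x w := by
  induction v using exterior_induction with
  | algebraMap r =>
    rw [← Algebra.smul_def, map_smul, adAction_algebraMap, zero_mul, zero_add, Algebra.smul_def]
  | add u v hu hv => simp only [add_mul, map_add, hu, hv]; abel
  | wedge y v hv =>
    have h := adAction_wedge x y (v * w)
    simp only [wedge] at h ⊢
    rw [mul_assoc, h, hv]
    have h' := adAction_wedge x y v
    simp only [wedge] at h'
    rw [h', add_mul, mul_add]
    simp only [mul_assoc]
    abel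

theorem adAction_ι (x y : L) :
    adAction x (ExteriorAlgebra.ι ℚ y) = ExteriorAlgebra.ι ℚ ⁅x, y⁆ := by
  have := adAction_wedge x y 1
  rw [← map_one (algebraMap ℚ _), adAction_algebraMap, map_one] at this
  simpa [wedge] using this

variable (L) in
/-- The underlying algebra `UL ⊗ ΛL` of the Koszul resolution. -/
abbrev Koszul : Type u := U L ⊗[ℚ] ExteriorAlgebra ℚ L

/-- Multiplication by an element of `L` in the exterior algebra. -/
noncomputable def koszulWedge (x : L) : Koszul L →ₗ[ℚ] Koszul L :=
  LinearMap.mulLeft ℚ ((1 : U L) ⊗ₜ ExteriorAlgebra.ι ℚ x)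

/-- Multiplication by an element of the enveloping algebra. -/
noncomputable def koszulMul (u : U L) : Koszul L →ₗ[ℚ] Koszul L :=
  LinearMap.mulLeft ℚ (u ⊗ₜ[ℚ] (1 : ExteriorAlgebra ℚ L))

/-- The right action of `L` on the Koszul resolution. -/
noncomputable def koszulAct (x : L) : Koszul L →ₗ[ℚ] Koszul L :=
  LinearMap.rTensor _ (LinearMap.mulRight ℚ (UniversalEnvelopingAlgebra.ι ℚ x)) -
    LinearMap.lTensor _ (adAction x)

@[simp] theorem koszulWedge_tmul (x : L) (u : U L) (w : ExteriorAlgebra ℚ L) :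
    koszulWedge x (u ⊗ₜ[ℚ] w) = u ⊗ₜ wedge x w := by
  simp [koszulWedge]

@[simp] theorem koszulMul_tmul (v u : U L) (w : ExteriorAlgebra ℚ L) :
    koszulMul v (u ⊗ₜ[ℚ] w) = (v * u) ⊗ₜ w := by
  simp [koszulMul]

@[simp] theorem koszulAct_tmul (x : L) (u : U L) (w : ExteriorAlgebra ℚ L) :
    koszulAct x (u ⊗ₜ[ℚ] w) =
      (u * UniversalEnvelopingAlgebra.ι ℚ x) ⊗ₜ w - u ⊗ₜ adAction x w := by
  simp [koszulAct]

theorem koszulWedge_add (x y : L) : koszulWedge (x + y) = koszulWedge x + koszulWedge y := by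
  ext; simp [wedge, add_mul, TensorProduct.tmul_add]

theorem koszulWedge_smul (q : ℚ) (x : L) : koszulWedge (q • x) = q • koszulWedge x := by
  ext; simp [wedge]

theorem koszulAct_add (x y : L) : koszulAct (x + y) = koszulAct x + koszulAct y := by
  ext
  simp [adAction_add, mul_add, TensorProduct.tmul_add, TensorProduct.add_tmul]
  abel

theorem koszulAct_smul (q : ℚ) (x : L) : koszulAct (q • x) = q • koszulAct x := by
  ext
  simp [adAction_smul, smul_sub, TensorProduct.smul_tmul']

theorem koszulWedge_self (x : L) (k : Koszul L) : koszulWedge x (koszulWedge x k) = 0 := by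
  induction k using TensorProduct.induction_on with
  | zero => simp
  | tmul u w => rw [koszulWedge_tmul, koszulWedge_tmul, wedge_self, TensorProduct.tmul_zero]
  | add k l hk hl => rw [map_add, map_add, hk, hl, add_zero]

theorem koszulMul_koszulWedge (u : U L) (x : L) (k : Koszul L) :
    koszulMul u (koszulWedge x k) = koszulWedge x (koszulMul u k) := by
  induction k using TensorProduct.induction_on with
  | zero => simp
  | tmul v w => simp
  | add k l hk hl => simp only [map_add, hk, hl]

theorem koszulMul_koszulAct (u : U L) (x : L) (k : Koszul L) :
    koszulMul u (koszulAct x k) = koszulAct x (koszulMul u k) := by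
  induction k using TensorProduct.induction_on with
  | zero => simp
  | tmul v w => simp [mul_assoc]
  | add k l hk hl => simp only [map_add, hk, hl]

theorem koszulMul_koszulMul (u v : U L) (k : Koszul L) :
    koszulMul u (koszulMul v k) = koszulMul (u * v) k := by
  induction k using TensorProduct.induction_on with
  | zero => simp
  | tmul v w => simp [mul_assoc]
  | add k l hk hl => simp only [map_add, hk, hl]

theorem koszulAct_koszulWedge (x y : L) (k : Koszul L) :
    koszulAct x (koszulWedge y k) = koszulWedge y (koszulAct x k) - koszulWedge ⁅x, y⁆ k := by
  induction k using TensorProduct.induction_on with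
  | zero => simp
  | tmul u w =>
    simp only [koszulWedge_tmul, koszulAct_tmul, map_sub, adAction_wedge, TensorProduct.tmul_add]
    abel
  | add k l hk hl => simp only [map_add, hk, hl]; abel

theorem koszulAct_lie (x y : L) (k : Koszul L) :
    koszulAct ⁅x, y⁆ k = koszulAct y (koszulAct x k) - koszulAct x (koszulAct y k) := by
  induction k using TensorProduct.induction_on with
  | zero => simp
  | tmul u w =>
    simp only [koszulAct_tmul, map_sub, adAction_lie, TensorProduct.tmul_sub, LieHom.map_lie,
      LieRing.of_associative_ring_bracket, mul_sub, TensorProduct.sub_tmul, mul_assoc]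
    abel
  | add k l hk hl => simp only [map_add, hk, hl]; abel

theorem koszulAct_mul (x : L) (k : Koszul L) (w : ExteriorAlgebra ℚ L) :
    koszulAct x (k * (1 ⊗ₜ w)) = koszulAct x k * (1 ⊗ₜ w) - k * (1 ⊗ₜ adAction x w) := by
  induction k using TensorProduct.induction_on with
  | zero => simp
  | tmul u v =>
    simp only [Algebra.TensorProduct.tmul_mul_tmul, koszulAct_tmul, mul_one, sub_mul, adAction_mul,
      TensorProduct.tmul_add]
    abel
  | add k l hk hl => simp only [add_mul, map_add, hk, hl]; abel

variable (L) in
/-- The differential of the Koszul resolution on the generators. -/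
noncomputable def koszulGen : ExteriorAlgebra ℚ L →ₗ[ℚ] Koszul L :=
  CliffordAlgebra.foldr' (0 : QuadraticForm ℚ L)
    (LinearMap.mk₂ ℚ
      (fun (x : L) (p : ExteriorAlgebra ℚ L × Koszul L) =>
        koszulAct x (1 ⊗ₜ p.1) - koszulWedge x p.2)
      (by intros; simp only [koszulAct_add, koszulWedge_add, LinearMap.add_apply]; abel)
      (by intros; simp only [koszulAct_smul, koszulWedge_smul, LinearMap.smul_apply, smul_sub])
      (by intros; simp only [Prod.fst_add, Prod.snd_add, TensorProduct.tmul_add, map_add]; abel)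
      (by intros; simp only [Prod.smul_fst, Prod.smul_snd, TensorProduct.tmul_smul, map_smul,
            smul_sub]))
    (by
      intro x w k
      change koszulAct x (1 ⊗ₜ wedge x w) -
        koszulWedge x (koszulAct x (1 ⊗ₜ w) - koszulWedge x k) = (0 : ℚ) • k
      rw [← koszulWedge_tmul, koszulAct_koszulWedge, map_sub, koszulWedge_self, lie_self, zero_smul]
      have : koszulWedge (0 : L) = 0 := by ext; simp [wedge]
      rw [this]
      simp)
    0

theorem koszulGen_algebraMap (r : ℚ) : koszulGen L (algebraMap ℚ _ r) = 0 := by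
  refine (CliffordAlgebra.foldr'_algebraMap _ _ _ _ r).trans ?_
  simp

theorem koszulGen_wedge (x : L) (w : ExteriorAlgebra ℚ L) :
    koszulGen L (wedge x w) = koszulAct x (1 ⊗ₜ w) - koszulWedge x (koszulGen L w) :=
  CliffordAlgebra.foldr'_ι_mul _ _ _ _ x w

variable (L) in
/-- The differential of the Koszul resolution. -/
noncomputable def koszulD : Koszul L →ₗ[ℚ] Koszul L :=
  TensorProduct.lift (((LinearMap.mul ℚ (Koszul L)).compl₂ (koszulGen L)) ∘ₗ
    Algebra.TensorProduct.includeLeft.toLinearMap)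

theorem koszulD_tmul (u : U L) (w : ExteriorAlgebra ℚ L) :
    koszulD L (u ⊗ₜ w) = koszulMul u (koszulGen L w) := by
  simp [koszulD, koszulMul]

theorem koszulD_koszulMul (u : U L) (k : Koszul L) :
    koszulD L (koszulMul u k) = koszulMul u (koszulD L k) := by
  induction k using TensorProduct.induction_on with
  | zero => simp
  | tmul v w => rw [koszulMul_tmul, koszulD_tmul, koszulD_tmul, koszulMul_koszulMul]
  | add k l hk hl => simp only [map_add, hk, hl]

theorem koszul_induction {P : Koszul L → Prop} (add : ∀ k l, P k → P l → P (k + l))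
    (mul : ∀ u k, P k → P (koszulMul u k)) (one : P (1 ⊗ₜ 1))
    (wedge : ∀ x w, P (1 ⊗ₜ w) → P (koszulWedge x (1 ⊗ₜ w))) (k : Koszul L) : P k := by
  have h : ∀ w : ExteriorAlgebra ℚ L, P (1 ⊗ₜ w) := by
    intro w
    induction w using exterior_induction with
    | algebraMap r =>
      have := mul (algebraMap ℚ _ r) _ one
      rwa [koszulMul_tmul, mul_one, Algebra.algebraMap_eq_smul_one, ← TensorProduct.smul_tmul',
        ← TensorProduct.tmul_smul, ← Algebra.algebraMap_eq_smul_one] at this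
    | add v w hv hw => rw [TensorProduct.tmul_add]; exact add _ _ hv hw
    | wedge x w hw =>
      rw [← koszulWedge_tmul]
      exact wedge x w hw
  induction k using TensorProduct.induction_on with
  | zero =>
    have := mul 0 _ one
    rwa [koszulMul_tmul, zero_mul, TensorProduct.zero_tmul] at this
  | tmul u w =>
    have := mul u _ (h w)
    rwa [koszulMul_tmul, mul_one] at this
  | add k l hk hl => exact add _ _ hk hl

/-- Cartan's formula `D e_x + e_x D = θ_x`. The recursion for `koszulGen` is the case `k = 1 ⊗ w`,
and linearity over `UL` gives the rest. With `D (u ⊗ 1) = 0`, it yields by induction that `D`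
commutes with `θ_x` and that `D² = 0`. -/
theorem koszulD_koszulWedge (x : L) (k : Koszul L) :
    koszulD L (koszulWedge x k) = koszulAct x k - koszulWedge x (koszulD L k) := by
  induction k using TensorProduct.induction_on with
  | zero => simp
  | tmul u w =>
    rw [koszulWedge_tmul, koszulD_tmul, koszulGen_wedge, map_sub, koszulMul_koszulAct,
      koszulMul_tmul, mul_one, koszulMul_koszulWedge, koszulD_tmul]
  | add k l hk hl => simp only [map_add, hk, hl]; abel

theorem koszulD_tmul_one (u : U L) : koszulD L (u ⊗ₜ 1) = 0 := by
  rw [koszulD_tmul, ← map_one (algebraMap ℚ _), koszulGen_algebraMap, map_zero]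

theorem koszulD_koszulAct (x : L) (k : Koszul L) :
    koszulD L (koszulAct x k) = koszulAct x (koszulD L k) := by
  induction k using koszul_induction with
  | add k l hk hl => simp only [map_add, hk, hl]
  | mul u k hk =>
    rw [← koszulMul_koszulAct, koszulD_koszulMul, hk, koszulMul_koszulAct, koszulD_koszulMul]
  | one =>
    rw [koszulD_tmul_one, koszulAct_tmul, ← map_one (algebraMap ℚ (ExteriorAlgebra ℚ L)),
      adAction_algebraMap, TensorProduct.tmul_zero, sub_zero, map_one, koszulD_tmul_one, map_zero]
  | wedge y w h =>
    rw [koszulAct_koszulWedge, map_sub, koszulD_koszulWedge, koszulD_koszulWedge,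
      koszulD_koszulWedge, map_sub, h, koszulAct_koszulWedge, koszulAct_lie]
    abel

theorem koszulD_koszulD (k : Koszul L) : koszulD L (koszulD L k) = 0 := by
  induction k using koszul_induction with
  | add k l hk hl => simp only [map_add, hk, hl, add_zero]
  | mul u k hk => rw [koszulD_koszulMul, koszulD_koszulMul, hk, map_zero]
  | one => rw [koszulD_tmul_one, map_zero]
  | wedge y w h =>
    rw [koszulD_koszulWedge, map_sub, koszulD_koszulAct, koszulD_koszulWedge, h, map_zero]
    abel

/-! ### The Euler homotopy and its Laplacian -/

namespace LieGrading

variable (G : LieGrading L)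

/-- The right action of `L` on `(UL ⊗ ΛL) × UL` that is twisted by the Euler derivation. -/
noncomputable def twistedAct (x : L) : Module.End ℚ (Koszul L × U L) :=
  LinearMap.prod
    (koszulAct x ∘ₗ LinearMap.fst ℚ _ _ +
      (TensorProduct.mk ℚ (U L) _).flip (ExteriorAlgebra.ι ℚ (G.euler x)) ∘ₗ LinearMap.snd ℚ _ _)
    (LinearMap.mulRight ℚ (UniversalEnvelopingAlgebra.ι ℚ x) ∘ₗ LinearMap.snd ℚ _ _)

@[simp] theorem twistedAct_apply (x : L) (p : Koszul L × U L) :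
    G.twistedAct x p = (koszulAct x p.1 + p.2 ⊗ₜ ExteriorAlgebra.ι ℚ (G.euler x),
      p.2 * UniversalEnvelopingAlgebra.ι ℚ x) := rfl

/-- The twisted right action as a homomorphism to an opposite algebra. -/
noncomputable def twistedHom : L →ₗ⁅ℚ⁆ (Module.End ℚ (Koszul L × U L))ᵐᵒᵖ where
  toFun x := MulOpposite.op (G.twistedAct x)
  map_add' x y := by
    rw [← MulOpposite.op_add]
    congr 1
    refine LinearMap.ext fun p => ?_
    ext
    · simp only [twistedAct_apply, koszulAct_add, map_add, LinearMap.add_apply,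
        TensorProduct.tmul_add, Prod.fst_add]
      abel
    · simp [mul_add]
  map_smul' q x := by
    rw [RingHom.id_apply, ← MulOpposite.op_smul]
    congr 1
    refine LinearMap.ext fun p => ?_
    ext
    · simp only [twistedAct_apply, koszulAct_smul, map_smul, LinearMap.smul_apply,
        TensorProduct.tmul_smul, Prod.smul_fst, smul_add]
    · simp
  -- The twisted operators form a right action because `koszulAct` is one and the Euler map is a
  -- derivation.
  map_lie' {x y} := by
    rw [LieRing.of_associative_ring_bracket, ← MulOpposite.op_mul, ← MulOpposite.op_mul,
      ← MulOpposite.op_sub]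
    congr 1
    refine LinearMap.ext fun p => ?_
    ext
    · simp only [twistedAct_apply, koszulAct_lie, LinearMap.sub_apply, Module.End.mul_apply,
        Prod.fst_sub, map_add, koszulAct_tmul, G.euler_lie, TensorProduct.tmul_add]
      rw [adAction_ι, adAction_ι, ← lie_skew (G.euler x) y]
      simp only [map_neg, TensorProduct.tmul_neg]
      abel
    · simp [LieRing.of_associative_ring_bracket, mul_sub, mul_assoc]

/-- The crossed homomorphism that extends the Euler derivation `L → L = Λ¹ L`. -/
noncomputable def crossedEuler : U L →ₗ[ℚ] Koszul L where
  toFun u := ((UniversalEnvelopingAlgebra.lift ℚ G.twistedHom u).unop (0, 1)).1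
  map_add' u v := by simp
  map_smul' q u := by simp

theorem twistedHom_snd (u : U L) :
    ((UniversalEnvelopingAlgebra.lift ℚ G.twistedHom u).unop (0, 1)).2 = u := by
  induction u using env_induction with
  | one => simp
  | smul q u hu => simp [hu]
  | add u v hu hv => simp [hu, hv]
  | mul u x hu =>
    rw [map_mul, UniversalEnvelopingAlgebra.lift_ι_apply, MulOpposite.unop_mul,
      Module.End.mul_apply]
    change (G.twistedAct x _).2 = _
    rw [twistedAct_apply, hu]

theorem crossedEuler_one : G.crossedEuler 1 = 0 := by
  simp [crossedEuler]

/-- Acting by `u` on `(0, 1)` produces `u` in the second coordinate and the crossed homomorphism in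
the first. Defining it through the action makes it automatically compatible with the relations of
`UL`. -/
theorem crossedEuler_mul (u : U L) (x : L) :
    G.crossedEuler (u * UniversalEnvelopingAlgebra.ι ℚ x) =
      koszulAct x (G.crossedEuler u) + u ⊗ₜ ExteriorAlgebra.ι ℚ (G.euler x) := by
  simp only [crossedEuler, LinearMap.coe_mk, AddHom.coe_mk]
  rw [map_mul, UniversalEnvelopingAlgebra.lift_ι_apply, MulOpposite.unop_mul,
    Module.End.mul_apply]
  change (G.twistedAct x _).1 = _
  rw [twistedAct_apply, twistedHom_snd]

/-- The values of `crossedEuler` have exterior degree one, so they anticommute with `1 ⊗ x`. The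
induction on `u` is carried out for all `x` at once because the right action replaces `x` by a
bracket. -/
theorem crossedEuler_mul_tmul (u : U L) (x : L) (w : ExteriorAlgebra ℚ L) :
    G.crossedEuler u * (1 ⊗ₜ wedge x w) = - koszulWedge x (G.crossedEuler u * (1 ⊗ₜ w)) := by
  have key : ∀ x : L, G.crossedEuler u * (1 ⊗ₜ ExteriorAlgebra.ι ℚ x) =
      - koszulWedge x (G.crossedEuler u) := by
    induction u using env_induction with
    | one => simp [crossedEuler_one]
    | smul q u hu => intro x; simp [hu x]
    | add u v hu hv => intro x; rw [map_add, add_mul, hu, hv, map_add]; abel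
    | mul u y hu =>
      intro x
      have h0 := koszulAct_mul y (G.crossedEuler u) (ExteriorAlgebra.ι ℚ x)
      have h1 : ExteriorAlgebra.ι ℚ (G.euler y) * ExteriorAlgebra.ι ℚ x =
          - (ExteriorAlgebra.ι ℚ x * ExteriorAlgebra.ι ℚ (G.euler y)) :=
        eq_neg_of_add_eq_zero_left (ExteriorAlgebra.ι_add_mul_swap _ _)
      rw [adAction_ι, hu, hu, map_neg, koszulAct_koszulWedge] at h0
      rw [eq_sub_iff_add_eq] at h0
      rw [crossedEuler_mul, add_mul, Algebra.TensorProduct.tmul_mul_tmul, mul_one, map_add, ← h0,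
        koszulWedge_tmul, h1, TensorProduct.tmul_neg]
      abel
  rw [wedge, ← one_mul (1 : U L), ← Algebra.TensorProduct.tmul_mul_tmul, ← mul_assoc, key]
  simp [koszulWedge, mul_assoc]

/-- The contracting homotopy of the Koszul resolution. -/
noncomputable def koszulS : Koszul L →ₗ[ℚ] Koszul L :=
  TensorProduct.lift (((LinearMap.mul ℚ (Koszul L)).compl₂
    (Algebra.TensorProduct.includeRight (R := ℚ) (A := U L)).toLinearMap) ∘ₗ G.crossedEuler)

theorem koszulS_tmul (u : U L) (w : ExteriorAlgebra ℚ L) :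
    G.koszulS (u ⊗ₜ w) = G.crossedEuler u * (1 ⊗ₜ w) := by
  simp [koszulS]

theorem koszulS_koszulWedge (x : L) (k : Koszul L) :
    G.koszulS (koszulWedge x k) = - koszulWedge x (G.koszulS k) := by
  induction k using TensorProduct.induction_on with
  | zero => simp
  | tmul u w => rw [koszulWedge_tmul, koszulS_tmul, koszulS_tmul, crossedEuler_mul_tmul]
  | add k l hk hl => simp only [map_add, hk, hl]; abel

theorem koszulS_koszulAct (x : L) (k : Koszul L) :
    G.koszulS (koszulAct x k) = koszulAct x (G.koszulS k) + koszulWedge (G.euler x) k := by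
  induction k using TensorProduct.induction_on with
  | zero => simp
  | tmul u w =>
    rw [koszulAct_tmul, map_sub, koszulS_tmul, koszulS_tmul, koszulS_tmul, crossedEuler_mul,
      koszulAct_mul, add_mul, Algebra.TensorProduct.tmul_mul_tmul, koszulWedge_tmul, mul_one]
    simp only [wedge]
    abel
  | add k l hk hl => simp only [map_add, hk, hl]; abel

/-- The Laplacian of the Koszul resolution. -/
noncomputable def koszulH : Koszul L →ₗ[ℚ] Koszul L :=
  koszulD L ∘ₗ G.koszulS + G.koszulS ∘ₗ koszulD L

theorem koszulH_apply (k : Koszul L) :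
    G.koszulH k = koszulD L (G.koszulS k) + G.koszulS (koszulD L k) := rfl

theorem koszulH_koszulAct (x : L) (k : Koszul L) :
    G.koszulH (koszulAct x k) = koszulAct x (G.koszulH k) + koszulAct (G.euler x) k := by
  simp only [koszulH_apply, koszulS_koszulAct, koszulD_koszulAct, map_add, koszulD_koszulWedge]
  abel

theorem koszulH_koszulWedge (x : L) (k : Koszul L) :
    G.koszulH (koszulWedge x k) = koszulWedge x (G.koszulH k) + koszulWedge (G.euler x) k := by
  simp only [koszulH_apply, koszulS_koszulWedge, koszulD_koszulWedge, map_add, map_neg, map_sub,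
    koszulS_koszulAct]
  abel

/-- The commutators of the Laplacian with `koszulAct x` and `koszulWedge x` are the same operators
for `euler x`. Since `1 ⊗ 1` is killed, each letter adds its weight to the eigenvalue. -/
theorem koszulH_tmul {n p w : ℕ} {u : U L} (hu : u ∈ G.envPiece n) {v : ExteriorAlgebra ℚ L}
    (hv : v ∈ G.extPiece (p, w)) : G.koszulH (u ⊗ₜ v) = ((n + w : ℕ) : ℚ) • (u ⊗ₜ[ℚ] v) := by
  refine extPiece_induction
    (P := fun p w v => G.koszulH (u ⊗ₜ v) = ((n + w : ℕ) : ℚ) • (u ⊗ₜ[ℚ] v))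
    (by simp) (fun p w x y hx hy => by rw [TensorProduct.tmul_add, map_add, hx, hy, smul_add])
    (fun p w q x hx => by rw [TensorProduct.tmul_smul, map_smul, hx, smul_comm]) ?_
    (fun p w r x m hx hm h => ?_) hv
  · rw [envPiece] at hu
    induction hu using Submodule.pow_induction_on_right' with
    | algebraMap r =>
      rw [koszulH_apply, koszulD_tmul_one, koszulS_tmul, Algebra.algebraMap_eq_smul_one, map_smul,
        crossedEuler_one]
      simp
    | add u v n _ _ h1 h2 => rw [TensorProduct.add_tmul, map_add, h1, h2, smul_add]
    | mul_mem n u _ hu m hm =>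
      obtain ⟨x, hx, rfl⟩ := hm
      have h1 : koszulAct x (u ⊗ₜ[ℚ] (1 : ExteriorAlgebra ℚ L)) =
          (u * UniversalEnvelopingAlgebra.ι ℚ x) ⊗ₜ 1 := by
        rw [koszulAct_tmul, ← map_one (algebraMap ℚ (ExteriorAlgebra ℚ L)), adAction_algebraMap,
          TensorProduct.tmul_zero, sub_zero]
      change G.koszulH ((u * UniversalEnvelopingAlgebra.ι ℚ x) ⊗ₜ 1) =
        _ • ((u * UniversalEnvelopingAlgebra.ι ℚ x) ⊗ₜ 1)
      rw [← h1, koszulH_koszulAct, hu, G.euler_of_mem hx, map_smul, Nat.cast_one, one_smul]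
      push_cast
      module
  · rw [← koszulWedge_tmul, koszulH_koszulWedge, h, G.euler_of_mem hx, koszulWedge_smul,
      map_smul, LinearMap.smul_apply, ← add_smul]
    congr 1
    push_cast
    ring

end LieGrading

end Koszul

end LieDepth

/-! ### The bigrading and exactness of the Koszul complex -/

namespace LieDepth
open scoped TensorProduct

namespace LieGrading

variable {L : Type u} [LieRing L] [LieAlgebra ℚ L] (G : LieGrading L)

local notation "U" => UniversalEnvelopingAlgebra ℚ

/-- The part of exterior degree `i.1` and total weight `i.2` of the Koszul resolution. -/
def koszulPiece (i : ℕ × ℕ) : Submodule ℚ (Koszul L) :=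
  Submodule.span ℚ {k | ∃ a b u v, u ∈ G.envPiece a ∧ v ∈ G.extPiece (i.1, b) ∧ a + b = i.2 ∧
    u ⊗ₜ[ℚ] v = k}

variable {G}

theorem tmul_mem_koszulPiece {a p b : ℕ} {u : U L} {v : ExteriorAlgebra ℚ L}
    (hu : u ∈ G.envPiece a) (hv : v ∈ G.extPiece (p, b)) : u ⊗ₜ v ∈ G.koszulPiece (p, a + b) :=
  Submodule.subset_span ⟨a, b, u, v, hu, hv, rfl, rfl⟩

theorem map_mem_of_koszulPiece {M : Type*} [AddCommGroup M] [Module ℚ M] {f : Koszul L →ₗ[ℚ] M}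
    {N : Submodule ℚ M} {p n : ℕ}
    (h : ∀ a b u v, u ∈ G.envPiece a → v ∈ G.extPiece (p, b) → a + b = n → f (u ⊗ₜ v) ∈ N)
    {k : Koszul L} (hk : k ∈ G.koszulPiece (p, n)) : f k ∈ N := by
  refine (Submodule.span_le (p := N.comap f)).2 ?_ hk
  rintro _ ⟨a, b, u, v, hu, hv, hab, rfl⟩
  exact h a b u v hu hv hab

theorem eq_of_koszulPiece {M : Type*} [AddCommGroup M] [Module ℚ M] {f g : Koszul L →ₗ[ℚ] M}
    {p n : ℕ}
    (h : ∀ a b u v, u ∈ G.envPiece a → v ∈ G.extPiece (p, b) → a + b = n →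
      f (u ⊗ₜ v) = g (u ⊗ₜ v))
    {k : Koszul L} (hk : k ∈ G.koszulPiece (p, n)) : f k = g k := by
  have := map_mem_of_koszulPiece (f := f - g) (N := ⊥)
    (fun a b u v hu hv hab => by simp [h a b u v hu hv hab]) hk
  simpa [sub_eq_zero] using this

variable (G) in
theorem iSup_koszulPiece : ⨆ i, G.koszulPiece i = ⊤ := by
  suffices h : ∀ k, k ∈ ⨆ i, G.koszulPiece i from eq_top_iff.2 fun m _ => h m
  intro k
  induction k using TensorProduct.induction_on with
  | zero => exact zero_mem _
  | tmul u v =>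
    induction u using DirectSum.Decomposition.inductionOn G.envPiece with
    | zero => simp
    | @homogeneous a u =>
      induction v using DirectSum.Decomposition.inductionOn G.extPiece with
      | zero => simp
      | @homogeneous i v =>
        exact Submodule.mem_iSup_of_mem (i.1, a + i.2) (tmul_mem_koszulPiece u.2 v.2)
      | add m m' h h' => rw [TensorProduct.tmul_add]; exact add_mem h h'
    | add m m' h h' => rw [TensorProduct.add_tmul]; exact add_mem h h'
  | add k l hk hl => exact add_mem hk hl

theorem koszulScaling_of_mem {p n : ℕ} {k : Koszul L} (hk : k ∈ G.koszulPiece (p, n)) :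
    TensorProduct.map G.envScaling.toLinearMap G.extScaling.toLinearMap k =
      ((3 : ℚ) ^ p * 2 ^ n) • k := by
  refine eq_of_koszulPiece (g := ((3 : ℚ) ^ p * 2 ^ n) • LinearMap.id) ?_ hk
  rintro a b u v hu hv rfl
  rw [TensorProduct.map_tmul, AlgHom.toLinearMap_apply, AlgHom.toLinearMap_apply,
    G.envScaling_of_mem hu, extScaling_of_mem hv, TensorProduct.smul_tmul_smul,
    LinearMap.smul_apply, LinearMap.id_apply]
  congr 1
  ring

noncomputable instance : DirectSum.Decomposition G.koszulPiece :=
  decompositionOfEigenvalues _ _ _ three_pow_mul_two_pow_injective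
    (fun _ _ h => koszulScaling_of_mem h) G.iSup_koszulPiece

theorem koszulMul_mem {a p n : ℕ} {u : U L} (hu : u ∈ G.envPiece a) {k : Koszul L}
    (hk : k ∈ G.koszulPiece (p, n)) : koszulMul u k ∈ G.koszulPiece (p, n + a) := by
  refine map_mem_of_koszulPiece ?_ hk
  rintro c b v w hv hw rfl
  rw [koszulMul_tmul, add_right_comm, add_comm c a]
  exact tmul_mem_koszulPiece (SetLike.mul_mem_graded hu hv) hw

theorem koszulWedge_mem {r p n : ℕ} {x : L} (hx : x ∈ G.W r) {k : Koszul L}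
    (hk : k ∈ G.koszulPiece (p, n)) : koszulWedge x k ∈ G.koszulPiece (p + 1, n + r) := by
  refine map_mem_of_koszulPiece ?_ hk
  rintro c b v w hv hw rfl
  rw [koszulWedge_tmul, add_assoc]
  exact tmul_mem_koszulPiece hv (wedge_mem_extPiece hx hw)

theorem koszulAct_mem {r p n : ℕ} {x : L} (hx : x ∈ G.W r) {k : Koszul L}
    (hk : k ∈ G.koszulPiece (p, n)) : koszulAct x k ∈ G.koszulPiece (p, n + r) := by
  refine map_mem_of_koszulPiece ?_ hk
  rintro c b v w hv hw rfl
  rw [koszulAct_tmul]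
  refine sub_mem ?_ ?_
  · rw [add_right_comm]
    exact tmul_mem_koszulPiece (SetLike.mul_mem_graded hv (G.ι_mem_envPiece hx)) hw
  · rw [add_assoc]
    exact tmul_mem_koszulPiece hv (adAction_mem_extPiece hx hw)

theorem one_tmul_mem {p w : ℕ} {v : ExteriorAlgebra ℚ L} (hv : v ∈ G.extPiece (p, w)) :
    (1 : U L) ⊗ₜ v ∈ G.koszulPiece (p, w) := by
  have := tmul_mem_koszulPiece (SetLike.GradedOne.one_mem : (1 : U L) ∈ G.envPiece 0) hv
  rwa [zero_add] at this

theorem koszulGen_eq_zero {w : ℕ} {v : ExteriorAlgebra ℚ L} (hv : v ∈ G.extPiece (0, w)) :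
    koszulGen L v = 0 := by
  obtain ⟨q, -, rfl⟩ := exists_algebraMap_of_mem_extPiece hv
  exact koszulGen_algebraMap q

theorem koszulGen_mem {p w : ℕ} {v : ExteriorAlgebra ℚ L} (hv : v ∈ G.extPiece (p + 1, w)) :
    koszulGen L v ∈ G.koszulPiece (p, w) := by
  refine extPiece_induction
    (P := fun q w m => ∀ p, q = p + 1 → koszulGen L m ∈ G.koszulPiece (p, w))
    (by simp) (fun p w u v hu hv p h => by rw [map_add]; exact add_mem (hu p h) (hv p h))
    (fun p w q u hu p h => by rw [map_smul]; exact Submodule.smul_mem _ _ (hu p h))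
    (fun p h => by omega)
    (fun q w s y m hy hm ih p h => ?_) hv p rfl
  obtain rfl : q = p := by omega
  rw [koszulGen_wedge]
  refine sub_mem (koszulAct_mem hy (one_tmul_mem hm)) ?_
  cases q with
  | zero => rw [koszulGen_eq_zero hm, map_zero]; exact zero_mem _
  | succ q => exact koszulWedge_mem hy (ih q rfl)

theorem koszulD_eq_zero {n : ℕ} {k : Koszul L} (hk : k ∈ G.koszulPiece (0, n)) :
    koszulD L k = 0 := by
  refine eq_of_koszulPiece (g := 0) (fun a b u v _ hv _ => ?_) hk
  rw [koszulD_tmul, koszulGen_eq_zero hv, map_zero, LinearMap.zero_apply]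

theorem koszulD_mem {p n : ℕ} {k : Koszul L} (hk : k ∈ G.koszulPiece (p + 1, n)) :
    koszulD L k ∈ G.koszulPiece (p, n) := by
  refine map_mem_of_koszulPiece ?_ hk
  rintro c b u v hu hv rfl
  rw [koszulD_tmul, add_comm]
  exact koszulMul_mem hu (koszulGen_mem hv)

theorem ι_mem_extPiece {r : ℕ} {x : L} (hx : x ∈ G.W r) :
    ExteriorAlgebra.ι ℚ x ∈ G.extPiece (1, r) := by
  have := wedge_mem_extPiece hx (one_mem_extPiece (G := G))
  rwa [wedge, mul_one, zero_add, zero_add] at this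

theorem mul_mem_extPiece {p q b w : ℕ} {m v : ExteriorAlgebra ℚ L} (hm : m ∈ G.extPiece (p, b))
    (hv : v ∈ G.extPiece (q, w)) : m * v ∈ G.extPiece (p + q, b + w) := by
  refine extPiece_induction (P := fun p b m => m * v ∈ G.extPiece (p + q, b + w))
    (by simp) (fun p w u v hu hv => by rw [add_mul]; exact add_mem hu hv)
    (fun p w q u hu => by rw [smul_mul_assoc]; exact Submodule.smul_mem _ _ hu)
    (by rwa [one_mul, zero_add, zero_add])
    (fun p b r x m hx _ h => ?_) hm
  rw [wedge, mul_assoc, add_right_comm p 1, add_right_comm b r]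
  exact wedge_mem_extPiece hx h

theorem mul_one_tmul_mem {p q n w : ℕ} {v : ExteriorAlgebra ℚ L} (hv : v ∈ G.extPiece (q, w))
    {k : Koszul L} (hk : k ∈ G.koszulPiece (p, n)) :
    k * (1 ⊗ₜ v) ∈ G.koszulPiece (p + q, n + w) := by
  refine map_mem_of_koszulPiece (f := LinearMap.mulRight ℚ ((1 : U L) ⊗ₜ[ℚ] v)) ?_ hk
  rintro a b u m hu hm rfl
  rw [LinearMap.mulRight_apply, Algebra.TensorProduct.tmul_mul_tmul, mul_one, add_assoc]
  exact tmul_mem_koszulPiece hu (mul_mem_extPiece hm hv)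

theorem crossedEuler_mem {n : ℕ} {u : U L} (hu : u ∈ G.envPiece n) :
    G.crossedEuler u ∈ G.koszulPiece (1, n) := by
  rw [envPiece] at hu
  induction hu using Submodule.pow_induction_on_right' with
  | algebraMap r =>
    rw [Algebra.algebraMap_eq_smul_one, map_smul, crossedEuler_one, smul_zero]
    exact zero_mem _
  | add u v n _ _ h1 h2 => rw [map_add]; exact add_mem h1 h2
  | mul_mem n u hu' hu m hm =>
    obtain ⟨x, hx, rfl⟩ := hm
    change G.crossedEuler (u * UniversalEnvelopingAlgebra.ι ℚ x) ∈ G.koszulPiece (1, n + 1)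
    rw [crossedEuler_mul]
    refine add_mem (koszulAct_mem hx hu) ?_
    rw [G.euler_of_mem hx, map_smul, TensorProduct.tmul_smul]
    have hu'' : u ∈ G.envPiece n := hu'
    exact Submodule.smul_mem _ _ (tmul_mem_koszulPiece hu'' (ι_mem_extPiece hx))

theorem koszulS_mem {p n : ℕ} {k : Koszul L} (hk : k ∈ G.koszulPiece (p, n)) :
    G.koszulS k ∈ G.koszulPiece (p + 1, n) := by
  refine map_mem_of_koszulPiece (f := G.koszulS) (fun a b u v hu hv hab => ?_) hk
  rw [koszulS_tmul, add_comm p 1, ← hab]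
  exact mul_one_tmul_mem (p := 1) (q := p) (n := a) (w := b) hv (crossedEuler_mem hu)

theorem koszulH_of_mem {p n : ℕ} {k : Koszul L} (hk : k ∈ G.koszulPiece (p, n)) :
    G.koszulH k = (n : ℚ) • k := by
  refine eq_of_koszulPiece (g := (n : ℚ) • LinearMap.id) ?_ hk
  rintro a b u v hu hv rfl
  rw [G.koszulH_tmul hu hv]
  rfl

theorem eq_zero_of_mem_koszulPiece_of_lt {p n : ℕ} (hpn : n < p) {k : Koszul L}
    (hk : k ∈ G.koszulPiece (p, n)) : k = 0 := by
  refine eq_of_koszulPiece (f := LinearMap.id) (g := 0) ?_ hk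
  rintro a b u v hu hv rfl
  rw [eq_zero_of_mem_extPiece_of_lt (by omega) hv, TensorProduct.tmul_zero, map_zero, map_zero]

variable (L) in
/-- The augmentation of the Koszul resolution. -/
noncomputable def koszulAug : Koszul L →ₗ[ℚ] ℚ :=
  TensorProduct.lift ((LinearMap.mul ℚ ℚ).compl₁₂ (envAug L).toLinearMap
    (ExteriorAlgebra.algebraMapInv : ExteriorAlgebra ℚ L →ₐ[ℚ] ℚ).toLinearMap)

theorem koszulAug_tmul (u : U L) (v : ExteriorAlgebra ℚ L) :
    koszulAug L (u ⊗ₜ v) = envAug L u * ExteriorAlgebra.algebraMapInv v := by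
  simp [koszulAug]

variable (G) in
/-- The inverse of the Laplacian in positive weights. -/
noncomputable def koszulGreen : Koszul L →ₗ[ℚ] Koszul L :=
  diag G.koszulPiece (fun i => (i.2 : ℚ)⁻¹)

theorem koszulGreen_mem {p n : ℕ} {k : Koszul L} (hk : k ∈ G.koszulPiece (p, n)) :
    G.koszulGreen k ∈ G.koszulPiece (p, n) := by
  rw [koszulGreen, diag_of_mem G.koszulPiece hk]
  exact Submodule.smul_mem _ _ hk

variable (G) in
theorem koszulD_koszulGreen (k : Koszul L) :
    koszulD L (G.koszulGreen k) = G.koszulGreen (koszulD L k) := by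
  refine diag_comm G.koszulPiece G.koszulPiece (σ := fun i => (i.1 - 1, i.2)) ?_ k
  rintro ⟨q, v⟩ x hx
  cases q with
  | zero => exact Or.inl (koszulD_eq_zero hx)
  | succ q => exact Or.inr ⟨koszulD_mem hx, rfl⟩

variable (G) in
/-- The part of exterior degree `p` of the Koszul resolution. -/
def koszulDegree (p : ℕ) : Submodule ℚ (Koszul L) := ⨆ n, G.koszulPiece (p, n)

theorem map_mem_koszulDegree {f : Koszul L →ₗ[ℚ] Koszul L} {p q : ℕ}
    (h : ∀ n, ∀ k ∈ G.koszulPiece (p, n), f k ∈ G.koszulPiece (q, n)) {k : Koszul L}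
    (hk : k ∈ G.koszulDegree p) : f k ∈ G.koszulDegree q := by
  refine (iSup_le (a := (G.koszulDegree q).comap f) fun n k hk => ?_ :
    G.koszulDegree p ≤ (G.koszulDegree q).comap f) hk
  exact Submodule.mem_iSup_of_mem n (h n k hk)

theorem eq_of_koszulDegree {M : Type*} [AddCommGroup M] [Module ℚ M] {f g : Koszul L →ₗ[ℚ] M}
    {p : ℕ} (h : ∀ n, ∀ k ∈ G.koszulPiece (p, n), f k = g k) {k : Koszul L}
    (hk : k ∈ G.koszulDegree p) : f k = g k := by
  refine (iSup_le (a := LinearMap.eqLocus f g) fun n k hk => ?_ :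
    G.koszulDegree p ≤ LinearMap.eqLocus f g) hk
  exact h n k hk

/-- With `K = koszulGreen`, which commutes with `D`, a cycle satisfies `z = (DS + SD) K z = D (S K
z)`. -/
theorem exists_of_koszulH_koszulGreen {p : ℕ} {z : Koszul L} (hz : z ∈ G.koszulDegree p)
    (h : G.koszulH (G.koszulGreen z) = z) (hd : koszulD L z = 0) :
    ∃ y ∈ G.koszulDegree (p + 1), koszulD L y = z := by
  refine ⟨G.koszulS (G.koszulGreen z), map_mem_koszulDegree (f := G.koszulS ∘ₗ G.koszulGreen)
    (fun n k hk => koszulS_mem (koszulGreen_mem hk)) hz, ?_⟩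
  rw [koszulH_apply, koszulD_koszulGreen, hd, map_zero, map_zero, add_zero] at h
  exact h

/-- In positive exterior degree the part of weight zero vanishes, so the Laplacian is invertible. -/
theorem koszul_exact {p : ℕ} {z : Koszul L} (hz : z ∈ G.koszulDegree (p + 1))
    (hd : koszulD L z = 0) : ∃ y ∈ G.koszulDegree (p + 2), koszulD L y = z := by
  refine exists_of_koszulH_koszulGreen hz ?_ hd
  refine eq_of_koszulDegree (f := G.koszulH ∘ₗ G.koszulGreen) (g := LinearMap.id)
    (fun n k hk => ?_) hz
  rw [LinearMap.comp_apply, koszulH_of_mem (koszulGreen_mem hk), koszulGreen,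
    diag_of_mem G.koszulPiece hk, LinearMap.id_apply]
  by_cases hn : n = 0
  · rw [eq_zero_of_mem_koszulPiece_of_lt (by omega) hk, smul_zero, smul_zero]
  · have : (n : ℚ) ≠ 0 := Nat.cast_ne_zero.2 hn
    rw [smul_smul, mul_inv_cancel₀ this, one_smul]

theorem koszulAug_eq_zero {n : ℕ} (hn : n ≠ 0) {k : Koszul L} (hk : k ∈ G.koszulPiece (0, n)) :
    koszulAug L k = 0 := by
  refine eq_of_koszulPiece (g := 0) (fun a b u v hu hv hab => ?_) hk
  rw [koszulAug_tmul, LinearMap.zero_apply]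
  by_cases ha : a = 0
  · obtain ⟨q, hq, rfl⟩ := exists_algebraMap_of_mem_extPiece hv
    have : q = 0 := by
      by_contra h0
      have := hq h0
      omega
    rw [this, map_zero, map_zero, mul_zero]
  · rw [aug_eq_zero G.isConnectedGrading ha hu, zero_mul]

theorem koszul_exact_zero {z : Koszul L} (hz : z ∈ G.koszulDegree 0) (hη : koszulAug L z = 0) :
    ∃ y ∈ G.koszulDegree 1, koszulD L y = z := by
  refine exists_of_koszulH_koszulGreen hz ?_
    (eq_of_koszulDegree (g := 0) (fun n k hk => koszulD_eq_zero hk) hz)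
  -- In exterior degree zero the only obstruction is the line through `1 ⊗ 1` in weight zero.
  -- Laplacian times inverse is the identity minus the projection onto that line, which is given by
  -- the augmentation.
  have h1 := eq_of_koszulDegree (f := G.koszulH ∘ₗ G.koszulGreen)
    (g := LinearMap.id - (LinearMap.toSpanSingleton ℚ (Koszul L) (1 ⊗ₜ 1)) ∘ₗ koszulAug L)
    (fun n k hk => ?_) hz
  · rw [LinearMap.comp_apply, LinearMap.sub_apply, LinearMap.comp_apply, hη, map_zero, sub_zero,
      LinearMap.id_apply] at h1
    exact h1
  · rw [LinearMap.comp_apply, koszulH_of_mem (koszulGreen_mem hk), koszulGreen,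
      diag_of_mem G.koszulPiece hk, LinearMap.sub_apply, LinearMap.id_apply, LinearMap.comp_apply]
    by_cases hn : n = 0
    · subst hn
      rw [Nat.cast_zero, zero_smul]
      symm
      rw [sub_eq_zero]
      refine eq_of_koszulPiece (f := LinearMap.id)
        (g := (LinearMap.toSpanSingleton ℚ (Koszul L) (1 ⊗ₜ 1)) ∘ₗ koszulAug L) ?_ hk
      intro a b u v hu hv hab
      obtain rfl : a = 0 := by omega
      obtain ⟨q, -, rfl⟩ := exists_algebraMap_of_mem_extPiece hv
      rw [envPiece, pow_zero, Submodule.mem_one] at hu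
      obtain ⟨q', rfl⟩ := hu
      rw [LinearMap.comp_apply, koszulAug_tmul, AlgHom.commutes, AlgHom.commutes]
      rw [Algebra.algebraMap_eq_smul_one, Algebra.algebraMap_eq_smul_one,
        TensorProduct.smul_tmul_smul]
      rfl
    · have h2 := koszulAug_eq_zero hn hk
      have : (n : ℚ) ≠ 0 := Nat.cast_ne_zero.2 hn
      rw [h2, map_zero, sub_zero, smul_smul, mul_inv_cancel₀ this, one_smul]

theorem koszulAug_koszulD {k : Koszul L} (hk : k ∈ G.koszulDegree 1) :
    koszulAug L (koszulD L k) = 0 := by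
  refine eq_of_koszulDegree (f := koszulAug L ∘ₗ koszulD L) (g := 0) (fun n k hk => ?_) hk
  rw [LinearMap.comp_apply, LinearMap.zero_apply]
  by_cases hn : n = 0
  · rw [eq_zero_of_mem_koszulPiece_of_lt (by omega) hk, map_zero, map_zero]
  · exact koszulAug_eq_zero hn (koszulD_mem hk)

end LieGrading

end LieDepth

/-! ### Truncating the Koszul resolution by exterior weight -/

namespace LieDepth
open scoped TensorProduct

section KoszulSpan

variable {L : Type u} [LieRing L] [LieAlgebra ℚ L]

local notation "U" => UniversalEnvelopingAlgebra ℚ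

/-- The submodule of the Koszul resolution that is generated by a subspace of the exterior
algebra. -/
def koszulSpan (X : Submodule ℚ (ExteriorAlgebra ℚ L)) : Submodule ℚ (Koszul L) :=
  Submodule.map₂ (TensorProduct.mk ℚ (U L) (ExteriorAlgebra ℚ L)) ⊤ X

theorem tmul_mem_koszulSpan {X : Submodule ℚ (ExteriorAlgebra ℚ L)} (u : U L)
    {v : ExteriorAlgebra ℚ L} (hv : v ∈ X) : u ⊗ₜ v ∈ koszulSpan X :=
  Submodule.apply_mem_map₂ (TensorProduct.mk ℚ (U L) (ExteriorAlgebra ℚ L)) Submodule.mem_top hv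

theorem map_mem_of_koszulSpan {M : Type*} [AddCommGroup M] [Module ℚ M]
    {X : Submodule ℚ (ExteriorAlgebra ℚ L)} {f : Koszul L →ₗ[ℚ] M} {N : Submodule ℚ M}
    (h : ∀ u, ∀ v ∈ X, f (u ⊗ₜ v) ∈ N) {k : Koszul L} (hk : k ∈ koszulSpan X) : f k ∈ N :=
  (Submodule.map₂_le.2 fun u _ v hv => h u v hv : koszulSpan X ≤ N.comap f) hk

theorem eq_of_koszulSpan {M : Type*} [AddCommGroup M] [Module ℚ M]
    {X : Submodule ℚ (ExteriorAlgebra ℚ L)} {f g : Koszul L →ₗ[ℚ] M}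
    (h : ∀ u, ∀ v ∈ X, f (u ⊗ₜ v) = g (u ⊗ₜ v)) {k : Koszul L} (hk : k ∈ koszulSpan X) :
    f k = g k :=
  (Submodule.map₂_le.2 fun u _ v hv => h u v hv : koszulSpan X ≤ LinearMap.eqLocus f g) hk

theorem koszulSpan_mono {X Y : Submodule ℚ (ExteriorAlgebra ℚ L)} (h : X ≤ Y) :
    koszulSpan X ≤ koszulSpan Y :=
  Submodule.map₂_le_map₂ le_rfl h

theorem koszulMul_mem_koszulSpan {X : Submodule ℚ (ExteriorAlgebra ℚ L)} (u : U L) {k : Koszul L}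
    (hk : k ∈ koszulSpan X) : koszulMul u k ∈ koszulSpan X :=
  map_mem_of_koszulSpan (f := koszulMul u)
    (fun v w hw => by rw [koszulMul_tmul]; exact tmul_mem_koszulSpan _ hw) hk

end KoszulSpan

namespace LieGrading

variable {L : Type u} [LieRing L] [LieAlgebra ℚ L] (G : LieGrading L)

local notation "U" => UniversalEnvelopingAlgebra ℚ

/-- The part of exterior degree `p` and of weight less than `M` of the exterior algebra. -/
def extBelow (p M : ℕ) : Submodule ℚ (ExteriorAlgebra ℚ L) := ⨆ b : Fin M, G.extPiece (p, b)

variable {G}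

theorem extPiece_le_extBelow {p b M : ℕ} (h : b < M) : G.extPiece (p, b) ≤ G.extBelow p M :=
  le_iSup (fun b : Fin M => G.extPiece (p, b)) ⟨b, h⟩

theorem extBelow_le {p M : ℕ} {X : Submodule ℚ (ExteriorAlgebra ℚ L)}
    (h : ∀ b < M, G.extPiece (p, b) ≤ X) : G.extBelow p M ≤ X :=
  iSup_le fun b => h b b.2

theorem extBelow_mono (p : ℕ) {M M' : ℕ} (h : M ≤ M') : G.extBelow p M ≤ G.extBelow p M' :=
  extBelow_le fun _ hb => extPiece_le_extBelow (hb.trans_le h)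

theorem extBelow_succ_le (p M : ℕ) :
    G.extBelow p (M + 1) ≤ G.extBelow p M ⊔ G.extPiece (p, M) := by
  refine extBelow_le fun b hb => ?_
  rcases Nat.lt_succ_iff_lt_or_eq.1 hb with h | rfl
  · exact (extPiece_le_extBelow h).trans le_sup_left
  · exact le_sup_right

theorem koszulWedge_mem_koszulSpan {s p M : ℕ} {y : L} (hy : y ∈ G.W s) {k : Koszul L}
    (hk : k ∈ koszulSpan (G.extBelow p M)) :
    koszulWedge y k ∈ koszulSpan (G.extBelow (p + 1) (M + s)) := by
  refine map_mem_of_koszulSpan (f := koszulWedge y) (fun u v hv => ?_) hk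
  rw [koszulWedge_tmul]
  refine tmul_mem_koszulSpan _ ?_
  refine (extBelow_le (X := (G.extBelow (p + 1) (M + s)).comap
    (LinearMap.mulLeft ℚ (ExteriorAlgebra.ι ℚ y))) fun b hb v hv => ?_) hv
  exact extPiece_le_extBelow (Nat.add_lt_add_right hb s) (wedge_mem_extPiece hy hv)

/-- Up to terms of lower weight, the differential of the Koszul resolution is the
Chevalley–Eilenberg differential. -/
theorem koszulGen_sub_mem {p w : ℕ} {v : ExteriorAlgebra ℚ L} (hv : v ∈ G.extPiece (p + 1, w)) :
    koszulGen L v - 1 ⊗ₜ ceDifferential L v ∈ koszulSpan (G.extBelow p w) := by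
  refine extPiece_induction (P := fun q w v => ∀ p, q = p + 1 →
      koszulGen L v - 1 ⊗ₜ ceDifferential L v ∈ koszulSpan (G.extBelow p w))
    (by simp) (fun p w u v hu hv p h => ?_) (fun p w q u hu p h => ?_)
    (fun p h => by omega) (fun q w s y m hy hm ih p h => ?_) hv p rfl
  · rw [map_add, map_add, TensorProduct.tmul_add, add_sub_add_comm]
    exact add_mem (hu p h) (hv p h)
  · rw [map_smul, map_smul, TensorProduct.tmul_smul, ← smul_sub]
    exact Submodule.smul_mem _ _ (hu p h)
  · obtain rfl : q = p := by omega
    -- As `W 0 = ⊥`, a nonzero `y` has positive weight, and moving it into `UL` strictly lowers the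
    -- exterior weight.
    cases s with
    | zero =>
      rw [G.zero, Submodule.mem_bot] at hy
      simp [hy, wedge]
    | succ s =>
      have key : koszulGen L (wedge y m) - 1 ⊗ₜ ceDifferential L (wedge y m) =
          UniversalEnvelopingAlgebra.ι ℚ y ⊗ₜ m -
            koszulWedge y (koszulGen L m - 1 ⊗ₜ ceDifferential L m) := by
        rw [koszulGen_wedge, ceDifferential_wedge, koszulAct_tmul, one_mul, map_sub,
          koszulWedge_tmul, TensorProduct.tmul_sub, TensorProduct.tmul_neg]
        abel
      rw [key]
      refine sub_mem (tmul_mem_koszulSpan _ (extPiece_le_extBelow (by omega) hm)) ?_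
      cases q with
      | zero => simp [koszulGen_eq_zero hm, ceDifferential_eq_zero_of_mem hm]
      | succ q => exact koszulWedge_mem_koszulSpan hy (ih q rfl)

theorem koszulD_sub_mem {p w : ℕ} {k : Koszul L} (hk : k ∈ koszulSpan (G.extPiece (p + 1, w))) :
    koszulD L k - LinearMap.lTensor _ (ceDifferential L) k ∈ koszulSpan (G.extBelow p w) := by
  refine map_mem_of_koszulSpan (f := koszulD L - LinearMap.lTensor _ (ceDifferential L))
    (fun u v hv => ?_) hk
  have h := koszulMul_mem_koszulSpan u (koszulGen_sub_mem hv)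
  rwa [map_sub, koszulMul_tmul, mul_one, ← koszulD_tmul] at h

theorem koszulD_mem_koszulSpan {p M : ℕ} {k : Koszul L}
    (hk : k ∈ koszulSpan (G.extBelow (p + 1) M)) : koszulD L k ∈ koszulSpan (G.extBelow p M) := by
  refine map_mem_of_koszulSpan (f := koszulD L) (fun u v hv => ?_) hk
  refine (extBelow_le (X := (koszulSpan (G.extBelow p M)).comap
    (koszulD L ∘ₗ TensorProduct.mk ℚ _ _ u)) fun b hb v hv => ?_) hv
  have h1 := koszulD_sub_mem (tmul_mem_koszulSpan u hv)
  have h2 := koszulSpan_mono (extBelow_mono p hb.le) h1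
  have h3 := add_mem h2
    (tmul_mem_koszulSpan u (extPiece_le_extBelow hb (ceDifferential_mem_extPiece hv)))
  rw [LinearMap.lTensor_tmul, sub_add_cancel] at h3
  exact h3

theorem exists_mem_koszulSpan_of_mem_koszulDegree {p : ℕ} {k : Koszul L}
    (hk : k ∈ G.koszulDegree p) : ∃ M, k ∈ koszulSpan (G.extBelow p M) := by
  induction hk using Submodule.iSup_induction' with
  | mem n k hk =>
    refine ⟨n + 1, map_mem_of_koszulPiece (f := LinearMap.id) (fun a b u v _ hv hab => ?_) hk⟩
    exact tmul_mem_koszulSpan u (extPiece_le_extBelow (by omega) hv)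
  | zero => exact ⟨0, zero_mem _⟩
  | add k l _ _ hk hl =>
    obtain ⟨M, hM⟩ := hk
    obtain ⟨M', hM'⟩ := hl
    exact ⟨max M M', add_mem (koszulSpan_mono (extBelow_mono p (le_max_left _ _)) hM)
      (koszulSpan_mono (extBelow_mono p (le_max_right _ _)) hM')⟩

theorem koszulSpan_extBelow_le (p M : ℕ) : koszulSpan (G.extBelow p M) ≤ G.koszulDegree p := by
  intro k hk
  refine map_mem_of_koszulSpan (f := LinearMap.id) (fun u v hv => ?_) hk
  refine (extBelow_le (X := (G.koszulDegree p).comap (TensorProduct.mk ℚ _ _ u))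
    fun b hb v hv => ?_) hv
  change u ⊗ₜ v ∈ G.koszulDegree p
  induction u using DirectSum.Decomposition.inductionOn G.envPiece with
  | zero => simp
  | @homogeneous a u => exact Submodule.mem_iSup_of_mem (a + b) (tmul_mem_koszulPiece u.2 hv)
  | add m m' h h' => rw [TensorProduct.add_tmul]; exact add_mem h h'

section Truncation

variable {N : ℕ} (hN : ∀ p, ∀ w ≥ N, ∀ z ∈ G.extPiece (p, w), ceDifferential L z = 0 →
  ∃ y ∈ G.extPiece (p + 1, w), ceDifferential L y = z)
include hN

/-- Split `y` into lower terms `y₁` and a part `y₂` of exterior weight `M`. The part of `D y` in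
weight `M` is `(1 ⊗ ∂) y₂`, which must vanish. By the splitting, `y₂ = (1 ⊗ ∂) s y₂`, and this
equals `D (s y₂)` up to lower weights. Subtracting `D (s y₂)` removes `y₂` without changing `D y`.
-/
theorem exists_lower_weight {p M : ℕ} (hM : N ≤ M) {y : Koszul L}
    (hy : y ∈ koszulSpan (G.extBelow (p + 1) (M + 1)))
    (hdy : koszulD L y ∈ koszulSpan (G.extBelow p N)) :
    ∃ y' ∈ koszulSpan (G.extBelow (p + 1) M), koszulD L y' = koszulD L y := by
  have hy' := koszulSpan_mono (extBelow_succ_le (p + 1) M) hy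
  rw [koszulSpan, Submodule.map₂_sup_right] at hy'
  obtain ⟨y₁, hy₁, y₂, hy₂, rfl⟩ := Submodule.mem_sup.1 hy'
  change y₁ ∈ koszulSpan _ at hy₁
  change y₂ ∈ koszulSpan _ at hy₂
  have h1 := koszulD_sub_mem hy₂
  have h2 := koszulD_mem_koszulSpan hy₁
  have h3 : LinearMap.lTensor (U L) (ceDifferential L) y₂ ∈ koszulSpan (G.extBelow p M) := by
    have h4 := sub_mem (sub_mem (koszulSpan_mono (extBelow_mono p hM) hdy) h2) h1
    rw [map_add] at h4
    convert h4 using 1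
    abel
  -- The projection to weight `M` fixes this element because `∂` preserves weight, and kills it
  -- because it lies in lower weights.
  have h5 : LinearMap.lTensor (U L) (ceDifferential L) y₂ = 0 := by
    have h6 : LinearMap.lTensor (U L) (G.extProj (p, M))
        (LinearMap.lTensor (U L) (ceDifferential L) y₂) =
        LinearMap.lTensor (U L) (ceDifferential L) y₂ :=
      eq_of_koszulSpan (f := LinearMap.lTensor (U L) (G.extProj (p, M)) ∘ₗ
        LinearMap.lTensor (U L) (ceDifferential L)) (fun u v hv => by
          rw [LinearMap.comp_apply, LinearMap.lTensor_tmul, LinearMap.lTensor_tmul, extProj,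
            diag_single_of_mem G.extPiece (ceDifferential_mem_extPiece hv)]) hy₂
    rw [← h6]
    refine eq_of_koszulSpan (g := 0) (fun u v hv => ?_) h3
    rw [LinearMap.lTensor_tmul, LinearMap.zero_apply]
    have h7 : G.extProj (p, M) v = 0 := by
      refine (extBelow_le (X := LinearMap.ker (G.extProj (p, M))) fun b hb v hv => ?_) hv
      exact diag_single_of_mem_ne G.extPiece hv fun h => hb.ne (congrArg Prod.snd h)
    rw [h7, TensorProduct.tmul_zero]
  obtain ⟨s, t, hs, hst⟩ := G.exists_splitting (hN (p + 1) M hM)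
  have h8 : LinearMap.lTensor (U L) (ceDifferential L) (LinearMap.lTensor (U L) s y₂) = y₂ := by
    have h9 := eq_of_koszulSpan
      (f := LinearMap.lTensor (U L) (ceDifferential L) ∘ₗ LinearMap.lTensor (U L) s +
        LinearMap.lTensor (U L) t ∘ₗ LinearMap.lTensor (U L) (ceDifferential L))
      (g := LinearMap.id) (fun u v hv => by
        simp only [LinearMap.add_apply, LinearMap.comp_apply, LinearMap.lTensor_tmul,
          LinearMap.id_apply]
        rw [← TensorProduct.tmul_add, hst v hv]) hy₂
    rw [LinearMap.add_apply, LinearMap.comp_apply, LinearMap.comp_apply, h5, map_zero,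
      add_zero] at h9
    exact h9
  have h10 : LinearMap.lTensor (U L) s y₂ ∈ koszulSpan (G.extPiece (p + 1 + 1, M)) :=
    map_mem_of_koszulSpan (f := LinearMap.lTensor (U L) s)
      (fun u v _ => tmul_mem_koszulSpan u (hs v)) hy₂
  have h11 := koszulD_sub_mem h10
  rw [h8] at h11
  refine ⟨y₁ + y₂ - koszulD L (LinearMap.lTensor (U L) s y₂), ?_, ?_⟩
  · convert sub_mem hy₁ h11 using 1
    abel
  · rw [map_sub, koszulD_koszulD, sub_zero]

theorem exists_mem_koszulSpan_of_koszulD_mem {p : ℕ} {y : Koszul L}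
    (hy : y ∈ G.koszulDegree (p + 1)) (hdy : koszulD L y ∈ koszulSpan (G.extBelow p N)) :
    ∃ y' ∈ koszulSpan (G.extBelow (p + 1) N), koszulD L y' = koszulD L y := by
  obtain ⟨M, hM⟩ := exists_mem_koszulSpan_of_mem_koszulDegree hy
  -- From here `M` measures the excess over `N`, and each induction step lowers it by one.
  have hM' := koszulSpan_mono (extBelow_mono (p + 1) (Nat.le_add_left M N)) hM
  clear hM hy
  induction M generalizing y with
  | zero => exact ⟨y, hM', rfl⟩
  | succ M ih =>
    obtain ⟨y', hy', h⟩ := exists_lower_weight hN (Nat.le_add_right N M) hM' hdy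
    obtain ⟨y'', hy'', h'⟩ := ih (h ▸ hdy) hy'
    exact ⟨y'', hy'', h'.trans h⟩

theorem koszulSpan_exact {p : ℕ} {z : Koszul L} (hz : z ∈ koszulSpan (G.extBelow (p + 1) N))
    (hd : koszulD L z = 0) : ∃ y ∈ koszulSpan (G.extBelow (p + 2) N), koszulD L y = z := by
  obtain ⟨y, hy, rfl⟩ := koszul_exact (koszulSpan_extBelow_le _ _ hz) hd
  exact exists_mem_koszulSpan_of_koszulD_mem hN hy hz

theorem koszulSpan_exact_zero {z : Koszul L} (hz : z ∈ koszulSpan (G.extBelow 0 N))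
    (hη : koszulAug L z = 0) : ∃ y ∈ koszulSpan (G.extBelow 1 N), koszulD L y = z := by
  obtain ⟨y, hy, rfl⟩ := koszul_exact_zero (koszulSpan_extBelow_le _ _ hz) hη
  exact exists_mem_koszulSpan_of_koszulD_mem hN hy hz

end Truncation

end LieGrading

end LieDepth

/-! ### Matrices of the truncated resolution and the conclusion -/

namespace LieDepth
open scoped TensorProduct

namespace LieGrading

section KoszulMatrix

variable {L : Type u} [LieRing L] [LieAlgebra ℚ L] (G : LieGrading L)
  [FiniteDimensional ℚ (G.W 1)]

local notation "U" => UniversalEnvelopingAlgebra ℚ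

instance finiteDimensional_extPiece (i : ℕ × ℕ) : FiniteDimensional ℚ (G.extPiece i) :=
  Module.Finite.iff_fg.2 (G.fg_extPiece (Module.Finite.iff_fg.1 inferInstance) i.1 i.2)

/-- An index set for a basis of the part of exterior degree `p` and of weight less than `N` of the
exterior algebra. -/
abbrev KoszulIndex (N p : ℕ) : Type :=
  Σ b : Fin N, Fin (Module.finrank ℚ (G.extPiece (p, b)))

variable {G} {N p : ℕ}

/-- The basis vectors of the part of exterior degree `p` and of weight less than `N` of the
exterior algebra. -/
noncomputable def extVector (i : G.KoszulIndex N p) : ExteriorAlgebra ℚ L :=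
  (Module.finBasis ℚ (G.extPiece (p, i.1)) i.2 : G.extPiece (p, i.1))

theorem extVector_mem (i : G.KoszulIndex N p) : extVector i ∈ G.extPiece (p, i.1) :=
  (Module.finBasis ℚ (G.extPiece (p, i.1)) i.2).2

/-- The coordinate functions of the basis `extVector`. -/
noncomputable def extCoord (i : G.KoszulIndex N p) : ExteriorAlgebra ℚ L →ₗ[ℚ] ℚ :=
  (Module.finBasis ℚ (G.extPiece (p, i.1))).coord i.2 ∘ₗ
    LinearMap.codRestrict (G.extPiece (p, i.1)) (G.extProj (p, i.1))
      (fun x => diag_single_mem G.extPiece _ x)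

theorem extCoord_of_mem_of_ne {i : G.KoszulIndex N p} {b : ℕ} {v : ExteriorAlgebra ℚ L}
    (hv : v ∈ G.extPiece (p, b)) (hb : b ≠ i.1) : extCoord i v = 0 := by
  have h : LinearMap.codRestrict (G.extPiece (p, i.1)) (G.extProj (p, i.1))
      (fun x => diag_single_mem G.extPiece _ x) v = 0 :=
    Subtype.ext (diag_single_of_mem_ne G.extPiece hv fun h => hb (congrArg Prod.snd h))
  rw [extCoord, LinearMap.comp_apply, h, map_zero]

theorem extCoord_of_mem {b : Fin N} {j : Fin (Module.finrank ℚ (G.extPiece (p, b)))}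
    {v : ExteriorAlgebra ℚ L} (hv : v ∈ G.extPiece (p, b)) :
    extCoord (⟨b, j⟩ : G.KoszulIndex N p) v =
      (Module.finBasis ℚ (G.extPiece (p, b))).repr ⟨v, hv⟩ j := by
  have h : LinearMap.codRestrict (G.extPiece (p, b)) (G.extProj (p, b))
      (fun x => diag_single_mem G.extPiece _ x) v = ⟨v, hv⟩ :=
    Subtype.ext (diag_single_of_mem G.extPiece hv)
  rw [extCoord, LinearMap.comp_apply, h, Module.Basis.coord_apply]

theorem extCoord_extVector_mk (b : Fin N) (i j : Fin (Module.finrank ℚ (G.extPiece (p, b)))) :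
    extCoord (⟨b, i⟩ : G.KoszulIndex N p) (extVector (⟨b, j⟩ : G.KoszulIndex N p)) =
      Finsupp.single j 1 i := by
  rw [extCoord_of_mem (extVector_mem (⟨b, j⟩ : G.KoszulIndex N p)), ← (Module.finBasis ℚ (G.extPiece (p, b))).repr_self]
  rfl

theorem extCoord_extVector [DecidableEq (G.KoszulIndex N p)] (i j : G.KoszulIndex N p) :
    extCoord i (extVector j) = if i = j then 1 else 0 := by
  obtain ⟨b, i⟩ := i
  obtain ⟨b', j⟩ := j
  by_cases hb : b' = b
  · subst hb
    rw [extCoord_extVector_mk, Finsupp.single_apply]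
    refine if_congr ⟨?_, ?_⟩ rfl rfl
    · rintro rfl
      rfl
    · intro h
      exact (eq_of_heq (Sigma.mk.inj h).2).symm
  · rw [if_neg fun h => hb (congrArg Sigma.fst h).symm]
    exact extCoord_of_mem_of_ne (extVector_mem _) fun h' => hb (Fin.ext h')

theorem sum_extCoord_smul_extVector {b : Fin N} {v : ExteriorAlgebra ℚ L}
    (hv : v ∈ G.extPiece (p, b)) :
    ∑ j, extCoord (⟨b, j⟩ : G.KoszulIndex N p) v • extVector (⟨b, j⟩ : G.KoszulIndex N p) = v := by
  have h := congrArg (G.extPiece (p, b)).subtype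
    ((Module.finBasis ℚ (G.extPiece (p, b))).sum_repr ⟨v, hv⟩)
  rw [map_sum] at h
  refine Eq.trans (Finset.sum_congr rfl fun j _ => ?_) h
  rw [extCoord_of_mem hv, map_smul]
  rfl

theorem sum_extCoord_smul_extVector_of_mem_extBelow {v : ExteriorAlgebra ℚ L}
    (hv : v ∈ G.extBelow p N) : ∑ i : G.KoszulIndex N p, extCoord i v • extVector i = v := by
  have h : G.extBelow p N ≤ LinearMap.eqLocus
      (∑ i : G.KoszulIndex N p, (extCoord i).smulRight (extVector i)) LinearMap.id := by
    refine extBelow_le fun b hb v hv => ?_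
    rw [LinearMap.mem_eqLocus, LinearMap.id_apply, LinearMap.sum_apply, Fintype.sum_sigma,
      Finset.sum_eq_single_of_mem (⟨b, hb⟩ : Fin N) (Finset.mem_univ _)]
    · exact sum_extCoord_smul_extVector (b := ⟨b, hb⟩) hv
    · intro b' _ hb'
      refine Finset.sum_eq_zero fun j _ => ?_
      rw [LinearMap.smulRight_apply, extCoord_of_mem_of_ne hv, zero_smul]
      exact fun h => hb' (Fin.ext h.symm)
  have h' := h hv
  rw [LinearMap.mem_eqLocus, LinearMap.sum_apply] at h'
  exact h'

/-- The linear combinations of the vectors `1 ⊗ extVector i` with coefficients in the enveloping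
algebra. -/
noncomputable def koszulCombination (x : G.KoszulIndex N p → U L) : Koszul L :=
  ∑ i, x i ⊗ₜ extVector i

/-- The coordinate functions of the Koszul resolution as a module over the enveloping algebra. -/
noncomputable def koszulCoord (i : G.KoszulIndex N p) : Koszul L →ₗ[ℚ] U L :=
  (TensorProduct.rid ℚ (U L)).toLinearMap ∘ₗ LinearMap.lTensor (U L) (extCoord i)

theorem koszulCoord_tmul (i : G.KoszulIndex N p) (u : U L) (v : ExteriorAlgebra ℚ L) :
    koszulCoord i (u ⊗ₜ v) = extCoord i v • u := rfl

theorem koszulCoord_koszulCombination (i : G.KoszulIndex N p) (x : G.KoszulIndex N p → U L) :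
    koszulCoord i (koszulCombination x) = x i := by
  classical
  simp [koszulCombination, koszulCoord_tmul, extCoord_extVector]

theorem koszulCombination_injective :
    Function.Injective (koszulCombination : (G.KoszulIndex N p → U L) → Koszul L) :=
  fun x y h => funext fun i => by
    rw [← koszulCoord_koszulCombination i x, h, koszulCoord_koszulCombination]

theorem koszulCombination_mem (x : G.KoszulIndex N p → U L) :
    koszulCombination x ∈ koszulSpan (G.extBelow p N) :=
  sum_mem fun i _ => tmul_mem_koszulSpan _ (extPiece_le_extBelow i.1.2 (extVector_mem i))

theorem koszulCombination_koszulCoord {k : Koszul L} (hk : k ∈ koszulSpan (G.extBelow p N)) :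
    koszulCombination (fun i : G.KoszulIndex N p => koszulCoord i k) = k := by
  have h := eq_of_koszulSpan
    (f := ∑ i : G.KoszulIndex N p, (TensorProduct.mk ℚ (U L) _).flip (extVector i) ∘ₗ koszulCoord i)
    (g := LinearMap.id) (fun u v hv => ?_) hk
  · rw [LinearMap.sum_apply] at h
    exact h
  · have h := congrArg (fun w => u ⊗ₜ[ℚ] w) (sum_extCoord_smul_extVector_of_mem_extBelow hv)
    rw [LinearMap.id_apply, LinearMap.sum_apply]
    refine Eq.trans ?_ h
    rw [TensorProduct.tmul_sum]
    exact Finset.sum_congr rfl fun i _ => TensorProduct.smul_tmul (extCoord i v) u (extVector i)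

/-- The total weight is the sum of the weights of both factors, so the coefficient of a basis vector
carries the remaining weight. This makes the matrices homogeneous. -/
theorem koszulCoord_mem {i : G.KoszulIndex N p} {n : ℕ} {k : Koszul L}
    (hk : k ∈ G.koszulPiece (p, n)) :
    koszulCoord i k = 0 ∨ ∃ m, n = i.1 + m ∧ koszulCoord i k ∈ G.envPiece m := by
  rcases le_or_gt (i.1 : ℕ) n with h | h
  · obtain ⟨m, rfl⟩ := Nat.exists_eq_add_of_le h
    refine Or.inr ⟨m, rfl, map_mem_of_koszulPiece (fun a b u v hu hv hab => ?_) hk⟩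
    rw [koszulCoord_tmul]
    by_cases hb : b = i.1
    · obtain rfl : a = m := by omega
      exact Submodule.smul_mem _ _ hu
    · rw [extCoord_of_mem_of_ne hv hb, zero_smul]
      exact zero_mem _
  · refine Or.inl (eq_of_koszulPiece (g := 0) (fun a b u v hu hv hab => ?_) hk)
    rw [koszulCoord_tmul, extCoord_of_mem_of_ne hv (by omega), zero_smul, LinearMap.zero_apply]

variable (G N) in
/-- The matrices of the truncated Koszul resolution. -/
noncomputable def koszulMatrix (p : ℕ) (i : G.KoszulIndex N (p + 1)) (j : G.KoszulIndex N p) :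
    U L :=
  koszulCoord j (koszulD L (1 ⊗ₜ extVector i))

variable (G N) in
theorem isHomogeneousMatrix_koszulMatrix (p : ℕ) :
    IsHomogeneousMatrix G.envPiece (fun i : G.KoszulIndex N (p + 1) => (i.1 : ℕ))
      (fun j : G.KoszulIndex N p => (j.1 : ℕ)) (G.koszulMatrix N p) :=
  fun i _ => koszulCoord_mem (koszulD_mem (one_tmul_mem (extVector_mem i)))

theorem koszulCombination_smul (u : U L) (x : G.KoszulIndex N p → U L) :
    koszulCombination (u • x) = koszulMul u (koszulCombination x) := by
  simp [koszulCombination, koszulMul_tmul]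

theorem koszulCombination_sum {κ : Type*} (s : Finset κ) (x : κ → G.KoszulIndex N p → U L) :
    koszulCombination (∑ k ∈ s, x k) = ∑ k ∈ s, koszulCombination (x k) := by
  simp only [koszulCombination, Finset.sum_apply, TensorProduct.sum_tmul]
  exact Finset.sum_comm

theorem koszulCombination_linearCombination (x : G.KoszulIndex N (p + 1) → U L) :
    koszulCombination (Fintype.linearCombination (U L) (G.koszulMatrix N p) x) =
      koszulD L (koszulCombination x) := by
  rw [Fintype.linearCombination_apply, koszulCombination_sum, koszulCombination, map_sum]
  refine Finset.sum_congr rfl fun i _ => ?_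
  rw [koszulCombination_smul]
  have h := koszulCombination_koszulCoord (koszulD_mem_koszulSpan (tmul_mem_koszulSpan (1 : U L)
    (extPiece_le_extBelow i.1.2 (extVector_mem i))))
  refine (congrArg (koszulMul (x i)) h).trans ?_
  rw [← koszulD_koszulMul, koszulMul_tmul, mul_one]

/-- The values of the augmentation on the generators of exterior degree `0`. -/
noncomputable def koszulScalar (i : G.KoszulIndex N 0) : ℚ :=
  ExteriorAlgebra.algebraMapInv (extVector i)

theorem koszulScalar_ne_zero {i : G.KoszulIndex N 0} (h : koszulScalar i ≠ 0) :
    (i.1 : ℕ) = 0 := by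
  obtain ⟨q, hq, h'⟩ := exists_algebraMap_of_mem_extPiece (extVector_mem i)
  refine hq fun h0 => h ?_
  rw [koszulScalar, ← h', h0, map_zero, map_zero]

theorem koszulAug_koszulCombination (x : G.KoszulIndex N 0 → U L) :
    koszulAug L (koszulCombination x) = augSum (envAug L) koszulScalar x := by
  rw [koszulCombination, map_sum]
  exact Finset.sum_congr rfl fun i _ => koszulAug_tmul _ _

theorem exists_koszulScalar_ne_zero (hN : 0 < N) :
    ∃ i : G.KoszulIndex N 0, koszulScalar i ≠ 0 := by
  by_contra! h
  -- The element `1 ⊗ 1` has augmentation `1` and survives the truncation because `N` is positive.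
  have h1 : (1 : U L) ⊗ₜ (1 : ExteriorAlgebra ℚ L) ∈ koszulSpan (G.extBelow 0 N) :=
    tmul_mem_koszulSpan _ (extPiece_le_extBelow hN one_mem_extPiece)
  have h2 := congrArg (koszulAug L) (koszulCombination_koszulCoord h1)
  rw [koszulAug_koszulCombination, koszulAug_tmul, map_one, map_one, mul_one] at h2
  refine zero_ne_one (Eq.trans (Eq.symm ?_) h2)
  exact Finset.sum_eq_zero fun i _ => by rw [h i, mul_zero]

end KoszulMatrix

/-- The depth of the enveloping algebra of a graded Lie algebra with homology of finite dimension
agrees with that of the completion. -/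
theorem depth_eq {L : Type u} [LieRing L] [LieAlgebra ℚ L] (G : LieGrading L)
    [FiniteDimensional ℚ (CEHomology L)] :
    depth (envAug L) = lieDepth L ∧ lieDepth L = depth (completionAug (envAug L)) := by
  obtain ⟨M, hM⟩ := G.exists_weight_bound
  have := G.finiteDimensional_piece_one
  -- Exactness holds in weights strictly above `M`, while the truncation keeps weights strictly
  -- below its bound; hence the bound `M + 1`.
  have hN : ∀ p, ∀ w ≥ M + 1, ∀ z ∈ G.extPiece (p, w), ceDifferential L z = 0 →
    ∃ y ∈ G.extPiece (p + 1, w), ceDifferential L y = z := fun p w hw => hM p w hw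
  refine depth_eq_of_resolution G.isConnectedGrading (N := M + 1)
    (wt := fun p (i : G.KoszulIndex (M + 1) p) => (i.1 : ℕ)) (fun p i => i.1.2.le)
    (G.isHomogeneousMatrix_koszulMatrix (M + 1)) (fun _ => koszulScalar_ne_zero)
    (exists_koszulScalar_ne_zero M.succ_pos) (fun x => ⟨fun hx => ?_, ?_⟩)
    (fun p x => ⟨fun hx => ?_, ?_⟩)
  · rw [← koszulAug_koszulCombination] at hx
    obtain ⟨y, hy, h⟩ := koszulSpan_exact_zero hN (koszulCombination_mem x) hx
    refine ⟨fun i => koszulCoord i y, koszulCombination_injective ?_⟩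
    rw [koszulCombination_linearCombination, koszulCombination_koszulCoord hy, h]
  · rintro ⟨y, rfl⟩
    rw [← koszulAug_koszulCombination, koszulCombination_linearCombination]
    exact koszulAug_koszulD (koszulSpan_extBelow_le _ _ (koszulCombination_mem y))
  · have hx' : koszulD L (koszulCombination x) = 0 := by
      rw [← koszulCombination_linearCombination, hx]
      simp [koszulCombination]
    obtain ⟨y, hy, h⟩ := koszulSpan_exact hN (koszulCombination_mem x) hx'
    refine ⟨fun i => koszulCoord i y, koszulCombination_injective ?_⟩
    rw [koszulCombination_linearCombination, koszulCombination_koszulCoord hy, h]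
  · rintro ⟨y, rfl⟩
    refine koszulCombination_injective ?_
    rw [koszulCombination_linearCombination, koszulCombination_linearCombination, koszulD_koszulD]
    simp [koszulCombination]

end LieGrading

end LieDepth

theorem proposition4 (S : Type u) (T : Set (FreeLieAlgebra ℚ S))
    (hT : ∀ t ∈ T, ∃ r : ℕ, t ∈ LieDepth.bracketSpan S r)
    (hfin : FiniteDimensional ℚ (LieDepth.CEHomology (LieDepth.PresentedLie S T))) :
    LieDepth.depth (LieDepth.envAug (LieDepth.PresentedLie S T))
        = LieDepth.lieDepth (LieDepth.PresentedLie S T) ∧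
      LieDepth.lieDepth (LieDepth.PresentedLie S T)
        = LieDepth.depth
            (LieDepth.completionAug (LieDepth.envAug (LieDepth.PresentedLie S T))) := by
  have := hfin
  exact (LieDepth.presentedGrading hT).depth_eq
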